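/- Let $\mathbb O$ be the octonions with imaginary units $i,j,k,k\ell,j\ell,i\ell,\ell$ ($k\,\ell=k\ell$, $i\,(j\ell)=-k\ell$), and let $H_3(\mathbb O)$ be the 27-dimensional real space of octonionic Hermitian $3\times3$ matrices, with Jordan product $A\circ B=\frac12(AB+BA)$, Freudenthal product $$A*B=A\circ B-\tfrac12\big(A\,\mathrm{tr}B+B\,\mathrm{tr}A\big)+\tfrac12\big(\mathrm{tr}A\,\mathrm{tr}B-\mathrm{tr}(A\circ B)\big)I,$$ and determinant $\det A=\frac13\mathrm{tr}((A*A)\circ A)$. Let $E_6$ be the group of real linear automorphisms of $H_3(\mathbb O)$ preserving $\det$, let $F_4$ be the group of automorphisms of $\circ$, and let $\mathfrak e_6$, $\mathfrak f_4$ be their Lie algebras (the velocities of one-parameter subgroups); $\mathfrak e_6$ consists of the linear maps $D$ with $N(DX,Y,Z)+N(X,DY,Z)+N(X,Y,DZ)=0$ for $N(X,Y,Z)=\mathrm{tr}((X*Y)\circ Z)$, and $\mathfrak f_4$ of the derivations of $\circ$. For imaginary units $p$ and $p\neq q$ consider the following 45 one-parameter families of $2\times 2$ matrices $\mathbf M$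 (the basis transformations of $SL(2,\mathbb O)$), acting by $\mathbf X\mapsto\mathbf M\mathbf X\mathbf M^\dagger$. * 28 rotations of $SO(8)$: $\mathrm{diag}(e^{-p\theta/2},e^{p\theta/2})$ (7 of them), and the 21 nested flips $\mathbf X\mapsto \mathbf M_2(\mathbf M_1\mathbf X\mathbf M_1^\dagger)\mathbf M_2^\dagger$, one for each pair $\{p,q\}$ in a fixed order, with $\mathbf M_1=-p\,\mathbf I$ and $\mathbf M_2=(p\cos\frac\theta2+q\sin\frac\theta2)\,\mathbf I$. * 8 further rotations: $\begin{pmatrix}\cos\frac\theta2&-p\sin\frac\theta2\\-p\sin\frac\theta2&\cos\frac\theta2\end{pmatrix}$ (7 of them) and $\begin{pmatrix}\cos\frac\theta2&-\sin\frac\theta2\\ \sin\frac\theta2&\cos\frac\theta2\end{pmatrix}$. * 9 boosts: $\begin{pmatrix}\cosh\frac\theta2&\sinh\frac\theta2\\ \sinh\frac\theta2&\cosh\frac\theta2\end{pmatrix}$, $\begin{pmatrix}\cosh\frac\theta2&-p\sinh\frac\theta2\\ p\sinh\frac\theta2&\cosh\frac\theta2\end{pmatrix}$ (7 of them), and the $tz$-boost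 $\mathrm{diag}(e^{\theta/2},e^{-\theta/2})$. The type I, II, III version of such a transformation is its action on $H_3(\mathbb O)$ after each $\mathbf M$ is replaced by the $3\times3$ matrix having the block $\mathbf M$ in the rows and columns $(1,2)$, $(2,3)$, $(3,1)$, in this order, a $1$ in the remaining diagonal place, and zeros elsewhere. Then: 1. All $3\times45$ families are one-parameter subgroups of $E_6$. 2. (Triality) The subgroups of $E_6$ generated by the 28 $SO(8)$ rotations of type I, of type II and of type III are equal, and so are the spans of their infinitesimal generators. Counting these 28 once leaves $28+3\cdot8+3\cdot9=79$ transformations. 3. The three $tz$-boosts are not independent: for each value of the parameter their product is the identity. For each choice of the type that represents the $SO(8)$ rotations, and each choice of one $tz$-boost to be removed, the infinitesimal generators of the remaining 78 transformations (26 boosts and 52 rotations) form a basis of $\mathfrak e_6$. 4. $\mathfrak e_6$ is the real form $E_{6(-26)}$: its complexification is the simple complex Lie algebra with Cartan matrix $E_6$, and its Killing form has 26 positive and 52 negative squares. The generators of all boosts span a 26-dimensional space, on which the Killing form is positive definite; the generators of all rotations span a 52-dimensional space, on which it is negative definite. 5. $F_4$ is the subgroup of $E_6$ that preserves the trace; it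 is compact and equals the group generated by all rotations of types I, II, III. Correspondingly $\mathfrak f_4=\{D\in\mathfrak e_6:\mathrm{tr}(DX)=0\ \text{for all }X\}$ is the span of the generators of the rotations, and it is the compact real form of the simple complex Lie algebra with Cartan matrix $F_4$ (its Killing form is negative definite). -/

import Mathlib

open scoped Quaternion Matrix TensorProduct

attribute [local instance 100] LieRing.ofAssociativeRing

noncomputable section

namespace OctonionicE6

/-! ### The octonions -/

/-- The octonions: the pair `(a, b)` of quaternions stands for `a + b ℓ`. -/
def Octonion : Type := ℍ[ℝ] × ℍ[ℝ]

namespace Octonion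

instance : AddCommGroup Octonion := inferInstanceAs (AddCommGroup (ℍ[ℝ] × ℍ[ℝ]))
instance : Module ℝ Octonion := inferInstanceAs (Module ℝ (ℍ[ℝ] × ℍ[ℝ]))
instance : Module.Finite ℝ Octonion := inferInstanceAs (Module.Finite ℝ (ℍ[ℝ] × ℍ[ℝ]))
instance : TopologicalSpace Octonion := inferInstanceAs (TopologicalSpace (ℍ[ℝ] × ℍ[ℝ]))
instance : T2Space Octonion := inferInstanceAs (T2Space (ℍ[ℝ] × ℍ[ℝ]))
instance : IsTopologicalAddGroup Octonion :=
  inferInstanceAs (IsTopologicalAddGroup (ℍ[ℝ] × ℍ[ℝ]))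
instance : ContinuousSMul ℝ Octonion := inferInstanceAs (ContinuousSMul ℝ (ℍ[ℝ] × ℍ[ℝ]))

/-- The octonion `a + b ℓ`. -/
def mk (a b : ℍ[ℝ]) : Octonion := (a, b)

/-- The quaternion `a` in `a + b ℓ`. -/
def fst (x : Octonion) : ℍ[ℝ] := Prod.fst x

/-- The quaternion `b` in `a + b ℓ`. -/
def snd (x : Octonion) : ℍ[ℝ] := Prod.snd x

@[ext] theorem ext {x y : Octonion} (h₁ : x.fst = y.fst) (h₂ : x.snd = y.snd) : x = y :=
  Prod.ext h₁ h₂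

@[simp] theorem fst_mk (a b : ℍ[ℝ]) : (mk a b).fst = a := rfl
@[simp] theorem snd_mk (a b : ℍ[ℝ]) : (mk a b).snd = b := rfl
@[simp] theorem fst_zero : (0 : Octonion).fst = 0 := rfl
@[simp] theorem snd_zero : (0 : Octonion).snd = 0 := rfl
@[simp] theorem fst_add (x y : Octonion) : (x + y).fst = x.fst + y.fst := rfl
@[simp] theorem snd_add (x y : Octonion) : (x + y).snd = x.snd + y.snd := rfl
@[simp] theorem fst_neg (x : Octonion) : (-x).fst = -x.fst := rfl
@[simp] theorem snd_neg (x : Octonion) : (-x).snd = -x.snd := rfl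
@[simp] theorem fst_smul (r : ℝ) (x : Octonion) : (r • x).fst = r • x.fst := rfl
@[simp] theorem snd_smul (r : ℝ) (x : Octonion) : (r • x).snd = r • x.snd := rfl

/-- The Cayley-Dickson product; it gives `k * ℓ = kℓ`, `ℓ * kℓ = k`, `kℓ * k = ℓ` and
`i * jℓ = -kℓ`. -/
instance : Mul Octonion :=
  ⟨fun x y => mk (x.fst * y.fst - star y.snd * x.snd) (y.snd * x.fst + x.snd * star y.fst)⟩

@[simp] theorem fst_mul (x y : Octonion) :
    (x * y).fst = x.fst * y.fst - star y.snd * x.snd := rfl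
@[simp] theorem snd_mul (x y : Octonion) :
    (x * y).snd = y.snd * x.fst + x.snd * star y.fst := rfl

instance : One Octonion := ⟨mk 1 0⟩

@[simp] theorem fst_one : (1 : Octonion).fst = 1 := rfl
@[simp] theorem snd_one : (1 : Octonion).snd = 0 := rfl

instance : NonAssocRing Octonion where
  __ := (inferInstance : AddCommGroup Octonion)
  left_distrib x y z := by ext1 <;> simp [mul_add, add_mul] <;> abel
  right_distrib x y z := by ext1 <;> simp [mul_add, add_mul] <;> abel
  zero_mul x := by ext1 <;> simp
  mul_zero x := by ext1 <;> simp
  one_mul x := by ext1 <;> simp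
  mul_one x := by ext1 <;> simp

/-- Octonionic conjugation. -/
instance : Star Octonion := ⟨fun x => mk (star x.fst) (-x.snd)⟩

@[simp] theorem fst_star (x : Octonion) : (star x).fst = star x.fst := rfl
@[simp] theorem snd_star (x : Octonion) : (star x).snd = -x.snd := rfl

instance : StarRing Octonion where
  star_involutive x := by ext1 <;> simp
  star_mul x y := by
    ext1
    · simp
    · simp [add_comm]
  star_add x y := by
    ext1
    · simp
    · simp [add_comm]

instance : StarModule ℝ Octonion where
  star_smul r x := by ext1 <;> simp

instance : IsScalarTower ℝ Octonion Octonion where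
  smul_assoc r x y := by ext1 <;> simp [smul_sub, smul_add]

instance : SMulCommClass ℝ Octonion Octonion where
  smul_comm r x y := by ext1 <;> simp [smul_sub, smul_add]

/-- The real part. -/
def re : Octonion →ₗ[ℝ] ℝ where
  toFun x := x.fst.re
  map_add' _ _ := by simp
  map_smul' _ _ := by simp

theorem re_apply (x : Octonion) : re x = x.fst.re := rfl

/-- The quaternion `a + b i + c j + d k`. -/
def quat (a b c d : ℝ) : ℍ[ℝ] := ⟨a, b, c, d⟩

@[simp] theorem re_quat (a b c d : ℝ) : (quat a b c d).re = a := rfl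
@[simp] theorem imI_quat (a b c d : ℝ) : (quat a b c d).imI = b := rfl
@[simp] theorem imJ_quat (a b c d : ℝ) : (quat a b c d).imJ = c := rfl
@[simp] theorem imK_quat (a b c d : ℝ) : (quat a b c d).imK = d := rfl

/-- The seven imaginary units `i, j, k, kℓ, jℓ, iℓ, ℓ`. -/
def unit : Fin 7 → Octonion :=
  ![mk (quat 0 1 0 0) 0, mk (quat 0 0 1 0) 0, mk (quat 0 0 0 1) 0,
    mk 0 (quat 0 0 0 1), mk 0 (quat 0 0 1 0), mk 0 (quat 0 1 0 0), mk 0 1]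

end Octonion

/-! ### The Albert algebra -/

/-- `3 × 3` octonionic matrices. -/
abbrev Mat3 : Type := Matrix (Fin 3) (Fin 3) Octonion

/-- `2 × 2` octonionic matrices. -/
abbrev Mat2 : Type := Matrix (Fin 2) (Fin 2) Octonion

/-- The real vector space `H₃(𝕆)` of octonionic Hermitian matrices. -/
def H3Submodule : Submodule ℝ Mat3 where
  carrier := {X | Xᴴ = X}
  add_mem' {X Y} hX hY := by
    simp only [Set.mem_ofPred_eq] at *
    rw [Matrix.conjTranspose_add, hX, hY]
  zero_mem' := Matrix.conjTranspose_zero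
  smul_mem' r X hX := by
    simp only [Set.mem_ofPred_eq] at *
    rw [Matrix.conjTranspose_smul, hX, star_trivial]

/-- The real vector space `H₃(𝕆)` of octonionic Hermitian matrices. -/
abbrev H3 : Type := H3Submodule

/-- The identity matrix as an element of `H₃(𝕆)`. -/
def idH3 : H3 := ⟨1, Matrix.conjTranspose_one⟩

/-- The trace on `H₃(𝕆)`; the diagonal entries of a Hermitian matrix are real. -/
def trace : H3 →ₗ[ℝ] ℝ where
  toFun X := Octonion.re (Matrix.trace X.1)
  map_add' X Y := by simp
  map_smul' r X := by simp

/-- The Jordan product `A ∘ B = (A B + B A) / 2`. -/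
def jordan : H3 →ₗ[ℝ] H3 →ₗ[ℝ] H3 :=
  LinearMap.mk₂ ℝ
    (fun A B => ⟨(1 / 2 : ℝ) • (A.1 * B.1 + B.1 * A.1), by
      have hA : A.1ᴴ = A.1 := A.2
      have hB : B.1ᴴ = B.1 := B.2
      change ((1 / 2 : ℝ) • (A.1 * B.1 + B.1 * A.1))ᴴ = _
      have h (X Y : Mat3) : (X * Y)ᴴ = Yᴴ * Xᴴ := Matrix.conjTranspose_mul X Y
      rw [Matrix.conjTranspose_smul, Matrix.conjTranspose_add, h, h, hA, hB, star_trivial,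
        add_comm]⟩)
    (fun A A' B => Subtype.ext <| by
      simp only [Submodule.coe_add, Matrix.add_mul, Matrix.mul_add, ← smul_add]
      congr 1; abel)
    (fun r A B => Subtype.ext <| by
      simp only [Submodule.coe_smul, Matrix.smul_mul, Matrix.mul_smul, ← smul_add]
      rw [smul_comm])
    (fun A B B' => Subtype.ext <| by
      simp only [Submodule.coe_add, Matrix.add_mul, Matrix.mul_add, ← smul_add]
      congr 1; abel)
    (fun r A B => Subtype.ext <| by
      simp only [Submodule.coe_smul, Matrix.smul_mul, Matrix.mul_smul, ← smul_add]
      rw [smul_comm])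

/-- The Freudenthal product. -/
def freudenthal (A B : H3) : H3 :=
  jordan A B - (1 / 2 : ℝ) • (trace B • A + trace A • B)
    + ((1 / 2 : ℝ) * (trace A * trace B - trace (jordan A B))) • idH3

/-- The determinant `tr ((A * A) ∘ A) / 3`, where `*` is the Freudenthal product. -/
def det (A : H3) : ℝ := (1 / 3 : ℝ) * trace (jordan (freudenthal A A) A)

/-- The trilinear form `tr ((A * B) ∘ C)`, the polarization of `3 det`. -/
def cubic (A B C : H3) : ℝ := trace (jordan (freudenthal A B) C)

/-! ### The groups and their Lie algebras -/

/-- The group `E₆` of real linear automorphisms of `H₃(𝕆)` that leave the determinant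
invariant. -/
def E6 : Subgroup (H3 ≃ₗ[ℝ] H3) where
  carrier := {g | ∀ X, det (g X) = det X}
  mul_mem' {g h} hg hh X := by rw [LinearEquiv.mul_apply, hg, hh]
  one_mem' _ := rfl
  inv_mem' {g} hg X := by
    have h := hg (g⁻¹ X)
    rw [← LinearEquiv.mul_apply, mul_inv_cancel] at h
    exact h.symm

/-- The group `F₄` of automorphisms of the Jordan product of `H₃(𝕆)`. -/
def F4 : Subgroup (H3 ≃ₗ[ℝ] H3) where
  carrier := {g | ∀ X Y, g (jordan X Y) = jordan (g X) (g Y)}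
  mul_mem' {g h} hg hh X Y := by simp only [LinearEquiv.mul_apply]; rw [hh, hg]
  one_mem' _ _ := rfl
  inv_mem' {g} hg X Y := by
    have e (Z : H3) : g (g⁻¹ Z) = Z := by
      rw [← LinearEquiv.mul_apply, mul_inv_cancel]; rfl
    apply g.injective
    rw [hg, e, e, e]

/-- `D` is a tangent vector at the identity of the group `G` of linear transformations of
`H₃(𝕆)`: it is the velocity of a one-parameter subgroup of `G`. -/
def IsTangent (G : Subgroup (H3 ≃ₗ[ℝ] H3)) (D : Module.End ℝ H3) : Prop :=
  ∃ φ : Multiplicative ℝ →* (H3 ≃ₗ[ℝ] H3), (∀ s, φ s ∈ G) ∧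
    ∀ X : H3, HasDerivAt (fun t : ℝ => φ (Multiplicative.ofAdd t) X) (D X) 0

theorem freudenthal_add_left (A A' B : H3) :
    freudenthal (A + A') B = freudenthal A B + freudenthal A' B := by
  simp only [freudenthal, map_add, LinearMap.add_apply]
  module

theorem freudenthal_sub_left (A A' B : H3) :
    freudenthal (A - A') B = freudenthal A B - freudenthal A' B := by
  simp only [freudenthal, map_sub, LinearMap.sub_apply]
  module

theorem freudenthal_smul_left (r : ℝ) (A B : H3) :
    freudenthal (r • A) B = r • freudenthal A B := by
  simp only [freudenthal, map_smul, LinearMap.smul_apply, smul_eq_mul]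
  module

theorem freudenthal_add_right (A B B' : H3) :
    freudenthal A (B + B') = freudenthal A B + freudenthal A B' := by
  simp only [freudenthal, map_add]
  module

theorem freudenthal_sub_right (A B B' : H3) :
    freudenthal A (B - B') = freudenthal A B - freudenthal A B' := by
  simp only [freudenthal, map_sub]
  module

theorem freudenthal_smul_right (r : ℝ) (A B : H3) :
    freudenthal A (r • B) = r • freudenthal A B := by
  simp only [freudenthal, map_smul, smul_eq_mul]
  module

/-- The Lie algebra of linear maps that leave the determinant infinitesimally invariant. -/
def e6 : LieSubalgebra ℝ (Module.End ℝ H3) where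
  carrier := {D | ∀ X Y Z, cubic (D X) Y Z + cubic X (D Y) Z + cubic X Y (D Z) = 0}
  add_mem' {D E} hD hE X Y Z := by
    have h₁ := hD X Y Z
    have h₂ := hE X Y Z
    simp only [cubic, LinearMap.add_apply, freudenthal_add_left, freudenthal_add_right,
      map_add] at *
    linarith
  zero_mem' X Y Z := by
    have h (A : H3) : freudenthal A 0 = 0 := by
      simpa using freudenthal_smul_right 0 A 0
    have h' (A : H3) : freudenthal 0 A = 0 := by
      simpa using freudenthal_smul_left 0 0 A
    simp [cubic, h, h']
  smul_mem' r D hD X Y Z := by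
    have h₁ := hD X Y Z
    simp only [cubic, LinearMap.smul_apply, freudenthal_smul_left, freudenthal_smul_right,
      map_smul, smul_eq_mul] at *
    rw [← mul_add, ← mul_add, h₁, mul_zero]
  lie_mem' {D E} hD hE X Y Z := by
    have a₁ := hD (E X) Y Z
    have a₂ := hD X (E Y) Z
    have a₃ := hD X Y (E Z)
    have b₁ := hE (D X) Y Z
    have b₂ := hE X (D Y) Z
    have b₃ := hE X Y (D Z)
    simp only [cubic, LieRing.of_associative_ring_bracket, Module.End.mul_apply, freudenthal_sub_left,
      freudenthal_sub_right, map_sub, LinearMap.sub_apply] at *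
    linarith

/-- The Lie algebra of derivations of the Jordan product of `H₃(𝕆)`. -/
def f4 : LieSubalgebra ℝ (Module.End ℝ H3) where
  carrier := {D | ∀ X Y, D (jordan X Y) = jordan (D X) Y + jordan X (D Y)}
  add_mem' {D E} hD hE X Y := by
    simp only [LinearMap.add_apply, map_add]
    rw [hD, hE]; abel
  zero_mem' X Y := by simp
  smul_mem' r D hD X Y := by
    simp only [LinearMap.smul_apply, map_smul]
    rw [hD, smul_add]
  lie_mem' {D E} hD hE X Y := by
    have h₁ := hD X Y
    have h₂ := hE X Y
    simp only [LieRing.of_associative_ring_bracket, Module.End.mul_apply, LinearMap.sub_apply]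
    rw [h₁, h₂, map_add, map_add, hD, hD, hE, hE]
    simp only [map_sub, LinearMap.sub_apply]
    abel

/-- A finite-dimensional complex Lie algebra is semisimple with Cartan matrix `A`: its Killing
form is non-degenerate, and its root system with respect to some Cartan subalgebra has a base
whose Cartan matrix is `A`. -/
def IsOfType {ι : Type} (A : Matrix ι ι ℤ) (L : Type) [LieRing L] [LieAlgebra ℂ L]
    [FiniteDimensional ℂ L] : Prop :=
  ∃ (_ : LieAlgebra.IsKilling ℂ L) (H : LieSubalgebra ℂ L) (_ : H.IsCartanSubalgebra)
    (b : (LieAlgebra.IsKilling.rootSystem H).Base) (e : ι ≃ b.support),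
    ∀ i j, b.cartanMatrix (e i) (e j) = A i j

/-- A finite-dimensional real Lie algebra is a real form of the complex semisimple Lie algebra
with Cartan matrix `A`. -/
def IsRealForm {ι : Type} (A : Matrix ι ι ℤ) (L : Type) [LieRing L] [LieAlgebra ℝ L]
    [FiniteDimensional ℝ L] : Prop :=
  IsOfType A (ℂ ⊗[ℝ] L)

/-- The Killing form as a quadratic form. -/
def killingQuadratic (L : Type) [LieRing L] [LieAlgebra ℝ L] : QuadraticForm ℝ L :=
  LinearMap.BilinMap.toQuadraticMap (killingForm ℝ L)

/-- The real form `E₆₍₋₂₆₎`: the real form of `E₆` whose Killing form has 26 positive and 52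
negative squares, so that their difference is `-26`. -/
def IsE6Neg26 (L : Type) [LieRing L] [LieAlgebra ℝ L] [FiniteDimensional ℝ L] : Prop :=
  IsRealForm CartanMatrix.E₆ L ∧ sigPos (killingQuadratic L) = 26 ∧
    sigNeg (killingQuadratic L) = 52

/-- The compact real form of `F₄`. -/
def IsCompactF4 (L : Type) [LieRing L] [LieAlgebra ℝ L] [FiniteDimensional ℝ L] : Prop :=
  IsRealForm CartanMatrix.F₄ L ∧ ∀ D : L, D ≠ 0 → killingForm ℝ L D D < 0

/-! ### The basis transformations -/

/-- The three block embeddings of `2 × 2` matrices, of type I, II and III for `τ = 0, 1, 2`: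
the block occupies the rows and columns `(0, 1)`, `(1, 2)` and `(2, 0)`, in this order, and the
remaining diagonal entry is `1`. -/
def embed (τ : Fin 3) (M : Mat2) : Mat3 :=
  Matrix.of fun i j =>
    (!![M 0 0, M 0 1, 0;
        M 1 0, M 1 1, 0;
        0, 0, 1] : Mat3) (i - τ) (j - τ)

/-- The action `X ↦ M X M†`. -/
def act (M X : Mat3) : Mat3 := M * X * Mᴴ

/-- The 28 basis rotations of `SO(8)`: the rotations in the `xy`-plane, where `y` is the
coordinate of the imaginary unit `p`, and the rotations in the plane of the imaginary units
`p`, `q`, which make up `SO(7)`. -/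
inductive SO8Label
  | xy (p : Fin 7)
  | im (p q : Fin 7) (h : p < q)
  deriving DecidableEq, Fintype

/-- The 8 additional basis rotations of `SO(9)`. -/
inductive SO9Label
  | yz (p : Fin 7)
  | zx
  deriving DecidableEq, Fintype

/-- The 9 basis boosts of `SO(9,1)`. -/
inductive BoostLabel
  | tx
  | ty (p : Fin 7)
  | tz
  deriving DecidableEq, Fintype

/-- The basis transformations of `SL(2, 𝕆)`. -/
abbrev SL2Label : Type := SO8Label ⊕ SO9Label ⊕ BoostLabel

/-- The basis transformations that are rotations of `SL(2, 𝕆)`. -/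
def IsRotation : SL2Label → Prop
  | .inl _ => True
  | .inr (.inl _) => True
  | .inr (.inr _) => False

open Octonion in
/-- The basis transformations of `SL(2, 𝕆)` with parameter `θ`, as lists of `2 × 2` matrices that
act one after the other, the last one in the list first. The rotations of the imaginary units are
nested flips. -/
def sl2Matrices (θ : ℝ) : SL2Label → List Mat2
  | .inl (.xy p) =>
    [!![Real.cos (θ / 2) • 1 - Real.sin (θ / 2) • unit p, 0;
        0, Real.cos (θ / 2) • 1 + Real.sin (θ / 2) • unit p]]
  | .inl (.im p q _) =>
    [!![Real.cos (θ / 2) • unit p + Real.sin (θ / 2) • unit q, 0;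
        0, Real.cos (θ / 2) • unit p + Real.sin (θ / 2) • unit q],
     !![-unit p, 0; 0, -unit p]]
  | .inr (.inl (.yz p)) =>
    [!![Real.cos (θ / 2) • 1, -(Real.sin (θ / 2) • unit p);
        -(Real.sin (θ / 2) • unit p), Real.cos (θ / 2) • 1]]
  | .inr (.inl .zx) =>
    [!![Real.cos (θ / 2) • 1, -(Real.sin (θ / 2) • 1);
        Real.sin (θ / 2) • 1, Real.cos (θ / 2) • 1]]
  | .inr (.inr .tx) =>
    [!![Real.cosh (θ / 2) • 1, Real.sinh (θ / 2) • 1;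
        Real.sinh (θ / 2) • 1, Real.cosh (θ / 2) • 1]]
  | .inr (.inr (.ty p)) =>
    [!![Real.cosh (θ / 2) • 1, -(Real.sinh (θ / 2) • unit p);
        Real.sinh (θ / 2) • unit p, Real.cosh (θ / 2) • 1]]
  | .inr (.inr .tz) =>
    [!![Real.exp (θ / 2) • 1, 0; 0, Real.exp (-θ / 2) • 1]]

/-- The type `τ` version of a basis transformation of `SL(2, 𝕆)` with parameter `θ`. -/
def transform (τ : Fin 3) (a : SL2Label) (θ : ℝ) (X : Mat3) : Mat3 :=
  (sl2Matrices θ a).foldr (fun M Y => act (embed τ M) Y) X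

/-- `g` is the type `τ` version of the basis transformation `a` for some parameter. -/
def IsTransform (τ : Fin 3) (a : SL2Label) (g : H3 ≃ₗ[ℝ] H3) : Prop :=
  ∃ θ : ℝ, ∀ X : H3, (g X : Mat3) = transform τ a θ X

/-- `D` is the infinitesimal generator of the type `τ` version of the transformation `a`. -/
def IsGenerator (τ : Fin 3) (a : SL2Label) (D : Module.End ℝ H3) : Prop :=
  ∀ X : H3, HasDerivAt (fun θ : ℝ => transform τ a θ X) (D X : Mat3) 0

/-- The type `τ` copy of `SO(8)`, the group generated by its 28 basis rotations. -/
def so8Group (τ : Fin 3) : Subgroup (H3 ≃ₗ[ℝ] H3) :=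
  Subgroup.closure {g | ∃ a : SO8Label, IsTransform τ (.inl a) g}

/-- The group generated by the rotations of all three types. -/
def rotationGroup : Subgroup (H3 ≃ₗ[ℝ] H3) :=
  Subgroup.closure {g | ∃ τ a, IsRotation a ∧ IsTransform τ a g}

/-- The span of the infinitesimal generators of the type `τ` copy of `SO(8)`. -/
def so8Span (τ : Fin 3) : Submodule ℝ (Module.End ℝ H3) :=
  Submodule.span ℝ {D | ∃ a : SO8Label, IsGenerator τ (.inl a) D}

/-- The span of the infinitesimal generators of the rotations of all three types. -/
def rotationSpan : Submodule ℝ (Module.End ℝ H3) :=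
  Submodule.span ℝ {D | ∃ τ a, IsRotation a ∧ IsGenerator τ a D}

/-- The span of the infinitesimal generators of the boosts of all three types. -/
def boostSpan : Submodule ℝ (Module.End ℝ H3) :=
  Submodule.span ℝ {D | ∃ τ a, ¬ IsRotation a ∧ IsGenerator τ a D}

/-- The labels of the transformations that are left when the three copies of `SO(8)` are
identified: one copy of `SO(8)`, three copies of the 8 rotations that complete it to `SO(9)`, and
three copies of the 9 boosts. -/
abbrev Label : Type := SO8Label ⊕ (Fin 3 × SO9Label) ⊕ (Fin 3 × BoostLabel)

/-- The type of the transformation with a given label, when the rotations of `SO(8)` are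
represented by those of type `σ`. -/
def Label.type (σ : Fin 3) : Label → Fin 3
  | .inl _ => σ
  | .inr (.inl (τ, _)) => τ
  | .inr (.inr (τ, _)) => τ

/-- The underlying transformation of `SL(2, 𝕆)`. -/
def Label.toSL2 : Label → SL2Label
  | .inl a => .inl a
  | .inr (.inl (_, b)) => .inr (.inl b)
  | .inr (.inr (_, c)) => .inr (.inr c)

/-- The `tz`-boost of type `τ`. -/
def tzLabel (τ : Fin 3) : Label := .inr (.inr (τ, .tz))

end OctonionicE6

end

noncomputable section
set_option maxSynthPendingDepth 3
set_option linter.unusedSimpArgs false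

namespace OctonionicE6

/-! ### Composition algebra identities for the octonions -/

namespace Octonion

/-! A Hermitian matrix is given by three real diagonal entries and three octonions, with indices
read cyclically. In these coordinates the polarized determinant is explicit (`cubic_formula`). The
octonion identities used most are the Clifford relation `star_mul_mul_add` and the associativity of
the real part of a product.

Structure of 𝔢₆. The diagonal idempotents have rank one, so an element of 𝔢₆ moves them only along
the rank-one cone. What it does there is matched by infinitesimal shears `upper`, `lower` and
traceless diagonal maps, and the remainder annihilates the idempotents (`sub_mem_so8`). Such a
remainder acts on each off-diagonal octonion by a skew map, and the three maps satisfy infinitesimal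
triality. Since the nucleus of the octonions is real, one block determines all three
(`eq_zero_of_block_eq_zero`); hence the 28 brackets of rotations of any one type span the same space
`so8`. Counting boosts and rotations separately gives dimension (24 + 2) + (24 + 28) = 78. Every
basis transformation is the flow of its generator, because its explicit orbit solves the linear
differential equation (`transform_eq_flow`).

Killing form. The form tr(X ∘ Y) is positive definite; boosts are symmetric for it and rotations
skew. The induced Hilbert-Schmidt form on endomorphisms makes ad of a boost symmetric and ad of a
rotation skew, so tr(ad D ²) has a definite sign unless D is central (`killingForm_pos`). Nothing
nonzero commutes with all rotations, so the signature is (26, 52) and 𝔣₄ is negative definite.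

Cartan types. Four commuting plane rotations, together with two diagonal matrices for 𝔢₆, have a
simultaneous eigenbasis in the complexification with integral weights. The commuting elements are
orthogonal for the Killing form, so once simple roots and multiples of the fundamental coweights are
listed, the Cartan matrix is a finite integer computation (`WeightBasis.isOfType`).

Groups. A linear map preserving the determinant and the trace fixes the identity and the trace form,
hence the Jordan product (`mem_F4_iff`). Rotations carry the image of the idempotent frame back to
the frame, because a rank-one matrix can be diagonalized one 2 × 2 block at a time. In the
stabilizer of the frame, plane rotations of one type reduce an element until it fixes all imaginary
units of one slot. Group triality then leaves only the identity and the rotation by 2π, so this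
stabilizer is the group generated by the SO(8) rotations of each type (`idemStab_le`). This gives
both triality for groups and generation of F₄ by rotations. Compactness holds because F₄ is closed
and preserves a positive definite form. -/

theorem ext_coords {x y : Octonion}
    (h₀ : x.fst.re = y.fst.re) (h₁ : x.fst.imI = y.fst.imI) (h₂ : x.fst.imJ = y.fst.imJ)
    (h₃ : x.fst.imK = y.fst.imK) (h₄ : x.snd.re = y.snd.re) (h₅ : x.snd.imI = y.snd.imI)
    (h₆ : x.snd.imJ = y.snd.imJ) (h₇ : x.snd.imK = y.snd.imK) : x = y :=
  Octonion.ext (Quaternion.ext _ _ h₀ h₁ h₂ h₃) (Quaternion.ext _ _ h₄ h₅ h₆ h₇)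

@[simp] theorem fst_sub (x y : Octonion) : (x - y).fst = x.fst - y.fst := rfl
@[simp] theorem snd_sub (x y : Octonion) : (x - y).snd = x.snd - y.snd := rfl

/-- The Euclidean inner product of the octonions. -/
def ip : Octonion →ₗ[ℝ] Octonion →ₗ[ℝ] ℝ :=
  LinearMap.mk₂ ℝ (fun x y => re (x * star y))
    (fun x y z => by simp [add_mul]) (fun r x y => by simp [smul_mul_assoc])
    (fun x y z => by simp [mul_add]) (fun r x y => by simp [mul_smul_comm])

theorem ip_def (x y : Octonion) : ip x y = re (x * star y) := rfl

theorem ip_eq (x y : Octonion) : ip x y =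
    x.fst.re * y.fst.re + x.fst.imI * y.fst.imI + x.fst.imJ * y.fst.imJ + x.fst.imK * y.fst.imK +
    x.snd.re * y.snd.re + x.snd.imI * y.snd.imI + x.snd.imJ * y.snd.imJ +
    x.snd.imK * y.snd.imK := by
  simp [ip_def, re_apply]
  ring

theorem ip_comm (x y : Octonion) : ip x y = ip y x := by
  simp only [ip_eq]; ring

theorem ip_self_nonneg (x : Octonion) : 0 ≤ ip x x := by
  rw [ip_eq]
  simp only [← sq]
  positivity

theorem ip_self_eq_zero {x : Octonion} : ip x x = 0 ↔ x = 0 := by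
  refine ⟨fun h => ?_, fun h => by simp [h]⟩
  rw [ip_eq] at h
  apply ext_coords <;> simp <;> nlinarith

theorem eq_zero_of_ip {x : Octonion} (h : ∀ y, ip x y = 0) : x = 0 := ip_self_eq_zero.1 (h x)

theorem ext_ip {x y : Octonion} (h : ∀ z, ip x z = ip y z) : x = y :=
  sub_eq_zero.1 <| eq_zero_of_ip fun z => by simp [h]

@[simp] theorem re_star (x : Octonion) : re (star x) = re x := by simp [re_apply]

@[simp] theorem re_one : re (1 : Octonion) = 1 := by simp [re_apply]

@[simp] theorem star_smul' (r : ℝ) (x : Octonion) : star (r • x) = r • star x := by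
  ext1 <;> simp

@[simp] theorem ip_star_star (x y : Octonion) : ip (star x) (star y) = ip x y := by
  simp only [ip_eq]; simp

theorem re_mul_comm (x y : Octonion) : re (x * y) = re (y * x) := by
  simp [re_apply]; ring

/-- Associators are purely imaginary, so the trilinear form `re (x y z)` needs no brackets. With
`re_mul_comm` it is also cyclic. -/
theorem re_mul_assoc (x y z : Octonion) : re (x * y * z) = re (x * (y * z)) := by
  simp [re_apply]; ring

theorem add_star_self (x : Octonion) : x + star x = (2 * re x) • (1 : Octonion) := by
  apply ext_coords <;> simp [re_apply]; ring

theorem ip_one_left (x : Octonion) : ip 1 x = re x := by simp [ip_def]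

theorem ip_one_right (x : Octonion) : ip x 1 = re x := by simp [ip_def]

/-- The adjoint of a multiplication is multiplication by the conjugate, because the real part is
commutative and associative. -/
theorem ip_mul_left (a x y : Octonion) : ip (a * x) y = ip x (star a * y) := by
  rw [ip_def, ip_def, star_mul, star_star, re_mul_comm, ← re_mul_assoc, re_mul_comm]

theorem ip_mul_right (a x y : Octonion) : ip (x * a) y = ip x (y * star a) := by
  rw [ip_def, ip_def, star_mul, star_star, re_mul_assoc]

/-- The Clifford relation, which is the polarized left alternative law. It is checked in coordinates
once; conjugation gives the right-handed version, and `a = b` gives the cancellation and norm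
identities. -/
theorem star_mul_mul_add (a b x : Octonion) :
    star a * (b * x) + star b * (a * x) = (2 * ip a b) • x := by
  rw [ip_eq]
  apply ext_coords <;> simp <;> ring

theorem mul_mul_star_add (a b x : Octonion) :
    x * a * star b + x * b * star a = (2 * ip a b) • x := by
  apply star_injective
  have := star_mul_mul_add (star b) (star a) (star x)
  simp only [star_add, star_mul, star_star, star_smul', ip_star_star] at this ⊢
  rw [add_comm, ip_comm a b, ← this, add_comm]

theorem star_mul_cancel (a x : Octonion) : star a * (a * x) = ip a a • x := by
  have h := star_mul_mul_add a a x
  rw [← two_smul ℝ, mul_smul] at h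
  exact smul_right_injective _ two_ne_zero h

theorem mul_star_cancel (a x : Octonion) : a * (star a * x) = ip a a • x := by
  simpa using star_mul_cancel (star a) x

theorem mul_mul_star_cancel (a x : Octonion) : x * a * star a = ip a a • x := by
  have h := mul_mul_star_add a a x
  rw [← two_smul ℝ, mul_smul] at h
  exact smul_right_injective _ two_ne_zero h

theorem mul_star_mul_cancel (a x : Octonion) : x * star a * a = ip a a • x := by
  simpa using mul_mul_star_cancel (star a) x

theorem ip_mul_mul_left (a x y : Octonion) : ip (a * x) (a * y) = ip a a * ip x y := by
  rw [ip_mul_left, star_mul_cancel, map_smul, smul_eq_mul]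

theorem ip_mul_mul_right (a x y : Octonion) : ip (x * a) (y * a) = ip a a * ip x y := by
  rw [ip_mul_right, mul_mul_star_cancel, map_smul, smul_eq_mul]

/-- The orthonormal basis of the octonions that consists of `1` and the imaginary units. -/
def e : Fin 8 → Octonion :=
  ![1, mk (quat 0 1 0 0) 0, mk (quat 0 0 1 0) 0, mk (quat 0 0 0 1) 0,
    mk 0 (quat 0 0 0 1), mk 0 (quat 0 0 1 0), mk 0 (quat 0 1 0 0), mk 0 1]

theorem e_zero : e 0 = 1 := rfl

theorem e_succ (p : Fin 7) : e p.succ = unit p := by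
  fin_cases p <;> rfl

theorem ip_e (a b : Fin 8) : ip (e a) (e b) = if a = b then 1 else 0 := by
  fin_cases a <;> fin_cases b <;> simp [e, ip_eq]

theorem sum_ip_e (x : Octonion) : ∑ a, ip (e a) x • e a = x := by
  simp only [Fin.sum_univ_eight, ip_eq]
  apply ext_coords <;> simp [e]

theorem ext_e {x y : Octonion} (h : ∀ a, ip (e a) x = ip (e a) y) : x = y := by
  rw [← sum_ip_e x, ← sum_ip_e y]
  simp only [h]

/-- The basis of the octonions that consists of `1` and the imaginary units. -/
def basis : Module.Basis (Fin 8) ℝ Octonion :=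
  Module.Basis.mk (v := e)
    (by
      rw [Fintype.linearIndependent_iff]
      intro g hg b
      have := congrArg (ip (e b)) hg
      simpa [map_sum, ip_e] using this)
    (by
      rintro x -
      rw [← sum_ip_e x]
      exact Submodule.sum_mem _ fun a _ => Submodule.smul_mem _ _ (Submodule.subset_span ⟨a, rfl⟩))

@[simp] theorem basis_apply (a : Fin 8) : basis a = e a := by simp [basis]

end Octonion

open Octonion

/-! ### Coordinates on `H₃(𝕆)` -/

/-- The Hermitian matrix with diagonal entries `a` and off-diagonal entries `x`, where `x i` is in
row `i + 1` and column `i + 2`. -/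
def hm (a : Fin 3 → ℝ) (x : Fin 3 → Octonion) : H3 :=
  ⟨!![a 0 • 1, x 2, star (x 1); star (x 2), a 1 • 1, x 0; x 1, star (x 0), a 2 • 1], by
    change _ᴴ = _
    refine Matrix.ext fun i j => ?_
    fin_cases i <;> fin_cases j <;> simp [Matrix.conjTranspose_apply]⟩

/-- The diagonal entries. -/
def dg (i : Fin 3) : H3 →ₗ[ℝ] ℝ where
  toFun X := re (X.1 i i)
  map_add' _ _ := by simp
  map_smul' _ _ := by simp

/-- The off-diagonal entries. -/
def od (i : Fin 3) : H3 →ₗ[ℝ] Octonion where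
  toFun X := X.1 (i + 1) (i + 2)
  map_add' _ _ := by simp
  map_smul' _ _ := by simp

@[simp] theorem dg_hm (a : Fin 3 → ℝ) (x : Fin 3 → Octonion) (i : Fin 3) :
    dg i (hm a x) = a i := by
  fin_cases i <;> simp [dg, hm]

@[simp] theorem od_hm (a : Fin 3 → ℝ) (x : Fin 3 → Octonion) (i : Fin 3) :
    od i (hm a x) = x i := by
  fin_cases i <;> simp [od, hm]

theorem hm_dg_od (X : H3) : hm (fun i => dg i X) (fun i => od i X) = X := by
  have h : X.1ᴴ = X.1 := X.2
  have h' (i j) : star (X.1 j i) = X.1 i j := congrFun (congrFun h i) j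
  have hd (i) : re (X.1 i i) • (1 : Octonion) = X.1 i i := by
    have := add_star_self (X.1 i i)
    rw [h', ← two_smul ℝ, mul_smul] at this
    exact (smul_right_injective _ (two_ne_zero' ℝ) this).symm
  refine Subtype.ext (Matrix.ext fun i j => ?_)
  fin_cases i <;> fin_cases j <;> simp [hm, dg, od, hd, h']

theorem H3_ext {X Y : H3} (h₁ : ∀ i, dg i X = dg i Y) (h₂ : ∀ i, od i X = od i Y) :
    X = Y := by
  rw [← hm_dg_od X, ← hm_dg_od Y]
  simp only [h₁, h₂]

theorem exists_hm (X : H3) : ∃ a x, X = hm a x := ⟨_, _, (hm_dg_od X).symm⟩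

theorem trace_eq (X : H3) : trace X = ∑ i, dg i X := by
  simp [trace, dg, Matrix.trace]

theorem dg_jordan (i : Fin 3) (A B : H3) : dg i (jordan A B) =
    dg i A * dg i B + ip (od (i + 1) A) (od (i + 1) B) + ip (od (i + 2) A) (od (i + 2) B) := by
  obtain ⟨a, x, rfl⟩ := exists_hm A
  obtain ⟨b, y, rfl⟩ := exists_hm B
  have h (u v : Octonion) : re (star u * v) = ip u v := by
    rw [re_mul_comm, ip_comm]; rfl
  have h' (u v : Octonion) : re (u * star v) = ip u v := rfl
  simp only [dg_hm, od_hm]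
  fin_cases i <;>
  simp [dg, jordan, hm, Matrix.mul_apply, Fin.sum_univ_three, h, h', smul_mul_assoc,
    ip_comm (y _)] <;> ring

theorem od_jordan (i : Fin 3) (A B : H3) : od i (jordan A B) = (1 / 2 : ℝ) •
    ((dg (i + 1) A + dg (i + 2) A) • od i B + (dg (i + 1) B + dg (i + 2) B) • od i A
      + star (od (i + 1) B * od (i + 2) A) + star (od (i + 1) A * od (i + 2) B)) := by
  obtain ⟨a, x, rfl⟩ := exists_hm A
  obtain ⟨b, y, rfl⟩ := exists_hm B
  simp only [dg_hm, od_hm]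
  fin_cases i <;>
  simp [od, jordan, hm, Matrix.mul_apply, Fin.sum_univ_three, smul_mul_assoc,
    mul_smul_comm] <;> module

@[simp] theorem dg_idH3 (i : Fin 3) : dg i idH3 = 1 := by simp [dg, idH3]

@[simp] theorem od_idH3 (i : Fin 3) : od i idH3 = 0 := by
  fin_cases i <;> simp [od, idH3]

theorem trace_jordan (A B : H3) :
    trace (jordan A B) = ∑ i, (dg i A * dg i B + 2 * ip (od i A) (od i B)) := by
  simp only [trace_eq, dg_jordan, Fin.sum_univ_three]
  simp
  ring

/-- The Freudenthal product polarizes the adjugate: for `A = B` this is the complementary 2 × 2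
principal minor. -/
theorem dg_freudenthal (i : Fin 3) (A B : H3) : dg i (freudenthal A B) =
    1 / 2 * (dg (i + 1) A * dg (i + 2) B + dg (i + 2) A * dg (i + 1) B)
      - ip (od i A) (od i B) := by
  simp only [freudenthal, map_add, map_sub, map_smul, dg_jordan, dg_idH3, trace_eq,
    Fin.sum_univ_three, smul_eq_mul]
  fin_cases i <;> simp <;> ring

theorem od_freudenthal (i : Fin 3) (A B : H3) : od i (freudenthal A B) = (1 / 2 : ℝ) •
    (star (od (i + 1) B * od (i + 2) A) + star (od (i + 1) A * od (i + 2) B)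
      - dg i A • od i B - dg i B • od i A) := by
  simp only [freudenthal, map_add, map_sub, map_smul, od_jordan, od_idH3, trace_eq,
    Fin.sum_univ_three]
  fin_cases i <;> simp <;> module

theorem jordan_comm (A B : H3) : jordan A B = jordan B A := by
  refine H3_ext (fun i => ?_) (fun i => ?_)
  · simp only [dg_jordan, ip_comm (od _ A)]; ring
  · simp only [od_jordan]; module

theorem freudenthal_comm (A B : H3) : freudenthal A B = freudenthal B A := by
  simp only [freudenthal, jordan_comm A B]
  module

/-! ### The polarized determinant as a symmetric trilinear form -/

theorem cubic_eq (A B C : H3) :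
    cubic A B C = trace (jordan (freudenthal A B) C) := rfl

theorem cubic_swap_left (A B C : H3) : cubic A B C = cubic B A C := by
  rw [cubic, cubic, freudenthal_comm]

theorem ip_star_left (u z : Octonion) : ip (star u) z = re (z * u) := by
  rw [← ip_star_star, star_star, ip_def, star_star, re_mul_comm]

theorem re_mul_cycle (x y z : Octonion) : re (x * (y * z)) = re (y * (z * x)) := by
  rw [re_mul_comm, re_mul_assoc]

/-- The trilinear form `N(X, Y, Z)` in coordinates. -/
theorem cubic_formula (A B C : H3) : cubic A B C =
    1 / 2 * (dg 0 A * dg 1 B * dg 2 C + dg 0 A * dg 2 B * dg 1 C + dg 1 A * dg 0 B * dg 2 C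
      + dg 1 A * dg 2 B * dg 0 C + dg 2 A * dg 0 B * dg 1 C + dg 2 A * dg 1 B * dg 0 C)
    - ∑ i, (dg i A * ip (od i B) (od i C) + dg i B * ip (od i A) (od i C)
      + dg i C * ip (od i A) (od i B))
    + (re (od 0 A * (od 1 B * od 2 C)) + re (od 0 A * (od 1 C * od 2 B))
      + re (od 0 B * (od 1 A * od 2 C)) + re (od 0 B * (od 1 C * od 2 A))
      + re (od 0 C * (od 1 A * od 2 B)) + re (od 0 C * (od 1 B * od 2 A))) := by
  have h₁ (A B C : H3) : re (od 1 A * (od 2 B * od 0 C)) = re (od 0 C * (od 1 A * od 2 B)) := by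
    rw [re_mul_cycle, re_mul_cycle]
  have h₂ (A B C : H3) : re (od 2 A * (od 0 B * od 1 C)) = re (od 0 B * (od 1 C * od 2 A)) :=
    re_mul_cycle _ _ _
  simp only [cubic_eq, trace_jordan, dg_freudenthal, od_freudenthal, Fin.sum_univ_three, map_smul,
    map_sub, map_add, LinearMap.smul_apply, LinearMap.sub_apply, LinearMap.add_apply, ip_star_left,
    smul_eq_mul, Fin.isValue, zero_add, Fin.reduceAdd, h₁, h₂]
  ring

theorem cubic_swap_right (A B C : H3) : cubic A B C = cubic A C B := by
  simp only [cubic_formula, Fin.sum_univ_three, ip_comm (od _ C) (od _ B)]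
  ring

theorem cubic_add_left (A A' B C : H3) : cubic (A + A') B C = cubic A B C + cubic A' B C := by
  simp [cubic, freudenthal_add_left]

/-- A symmetric triadditive form that vanishes on the diagonal is zero. -/
theorem eq_zero_of_diagonal {V : Type*} [AddCommGroup V] {T : V → V → V → ℝ}
    (hadd : ∀ X X' Y Z, T (X + X') Y Z = T X Y Z + T X' Y Z)
    (h₁ : ∀ X Y Z, T X Y Z = T Y X Z) (h₂ : ∀ X Y Z, T X Y Z = T X Z Y)
    (hd : ∀ X, T X X X = 0) (X Y Z : V) : T X Y Z = 0 := by
  have hadd₂ (X Y Y' Z) : T X (Y + Y') Z = T X Y Z + T X Y' Z := by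
    rw [h₁, hadd, h₁ Y, h₁ Y']
  have hadd₃ (X Y Z Z') : T X Y (Z + Z') = T X Y Z + T X Y Z' := by
    rw [h₂, hadd₂, h₂ X Z, h₂ X Z']
  have e₁ := hd (X + Y + Z)
  have e₂ := hd (X + Y)
  have e₃ := hd (X + Z)
  have e₄ := hd (Y + Z)
  simp only [hadd, hadd₂, hadd₃, hd] at e₁ e₂ e₃ e₄
  have s₁ := h₂ X Y Z
  have s₂ := h₁ X Y Z
  have s₃ := h₂ Y X Z
  have s₄ := h₁ X Z Y
  have s₅ := h₂ Z X Y
  linarith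

theorem mem_e6_iff {D : Module.End ℝ H3} :
    D ∈ e6 ↔ ∀ X Y Z, cubic (D X) Y Z + cubic X (D Y) Z + cubic X Y (D Z) = 0 := Iff.rfl

/-- The defining expression of `e6` is symmetric and additive in each argument, so polarization
reduces it to the diagonal, where its three terms agree. -/
theorem mem_e6_of_diagonal {D : Module.End ℝ H3} (h : ∀ X, cubic (D X) X X = 0) : D ∈ e6 := by
  refine eq_zero_of_diagonal (fun X X' Y Z => ?_) (fun X Y Z => ?_) (fun X Y Z => ?_)
    (fun X => ?_)
  · simp only [map_add, cubic_add_left]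
    ring
  · rw [cubic_swap_left (D X), cubic_swap_left X (D Y), cubic_swap_left X Y]
    ring
  · rw [cubic_swap_right (D X), cubic_swap_right X (D Y), cubic_swap_right X Y]
    ring
  · have := h X
    rw [cubic_swap_left X (D X), cubic_swap_right X X (D X), cubic_swap_left X (D X), this]
    simp

theorem cubic_self (X : H3) : cubic X X X = 3 * det X := by
  rw [cubic, det]; ring

theorem mem_E6_iff_cubic {g : H3 ≃ₗ[ℝ] H3} :
    g ∈ E6 ↔ ∀ X Y Z, cubic (g X) (g Y) (g Z) = cubic X Y Z := by
  refine ⟨fun hg X Y Z => sub_eq_zero.1 ?_, fun h X => ?_⟩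
  · refine eq_zero_of_diagonal (T := fun X Y Z => cubic (g X) (g Y) (g Z) - cubic X Y Z)
      (fun X X' Y Z => ?_) (fun X Y Z => ?_) (fun X Y Z => ?_) (fun X => ?_) X Y Z
    · simp only [map_add, cubic_add_left]; ring
    · simp only [cubic_swap_left (g X), cubic_swap_left X]
    · simp only [cubic_swap_right (g X), cubic_swap_right X]
    · have := hg X
      simp only [cubic_self, this, sub_self]
  · have := h X X X
    rw [cubic_self, cubic_self] at this
    linarith

/-- The trace form is a sum of squares in which the off-diagonal entries count twice. -/
theorem trace_jordan_self_eq_zero {X : H3} (h : trace (jordan X X) = 0) : X = 0 := by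
  have h₁ (i) : 0 ≤ dg i X * dg i X := mul_self_nonneg _
  have h₂ (i) : 0 ≤ ip (od i X) (od i X) := ip_self_nonneg _
  rw [trace_jordan, Finset.sum_eq_zero_iff_of_nonneg
    (fun i _ => by linarith [h₁ i, h₂ i])] at h
  refine H3_ext (fun i => ?_) (fun i => ?_)
  · have := h i (Finset.mem_univ i)
    simpa using (by linarith [h₁ i, h₂ i] : dg i X * dg i X = 0)
  · have := h i (Finset.mem_univ i)
    simpa [ip_self_eq_zero] using (by linarith [h₁ i, h₂ i] : ip (od i X) (od i X) = 0)

theorem ext_trace_jordan {X Y : H3} (h : ∀ Z, trace (jordan X Z) = trace (jordan Y Z)) :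
    X = Y :=
  sub_eq_zero.1 <| trace_jordan_self_eq_zero <| by
    rw [map_sub jordan, LinearMap.sub_apply, map_sub, h, sub_self]

theorem cubic_idH3 (X Y : H3) :
    cubic X Y idH3 = 1 / 2 * (trace X * trace Y - trace (jordan X Y)) := by
  rw [trace_jordan]
  simp only [cubic_formula, trace_eq, dg_idH3, od_idH3, Fin.sum_univ_three]
  simp
  ring

/-- The Jordan product is recovered from the cubic form, the trace and the identity. This is why the
trace cuts `F4` out of `E6`. -/
theorem jordan_eq_freudenthal (X Y : H3) : jordan X Y = freudenthal X Y +
    (1 / 2 : ℝ) • (trace Y • X + trace X • Y) - cubic X Y idH3 • idH3 := by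
  rw [cubic_idH3, freudenthal]
  module

/-! ### Elements of `𝔢₆` -/

/-- The map `X ↦ M X + X M†`, where `M` has the entry `v` in row `i + 1` and column `i + 2`. -/
def upper (i : Fin 3) : Octonion →ₗ[ℝ] Module.End ℝ H3 :=
  LinearMap.mk₂ ℝ (fun v X => hm (fun j => if j = i + 1 then 2 * ip v (od i X) else 0)
      (fun j => if j = i then dg (i + 2) X • v else
        if j = i + 2 then star (v * od (i + 1) X) else 0))
    (fun v v' X => by
      refine H3_ext (fun j => ?_) (fun j => ?_) <;>
        simp only [dg_hm, od_hm, map_add, map_smul, LinearMap.add_apply, LinearMap.smul_apply,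
          smul_eq_mul] <;> split_ifs <;>
        (try simp only [mul_add, add_mul, smul_mul_assoc, mul_smul_comm, star_add,
          star_smul']) <;> first | ring1 | module)
    (fun r v X => by
      refine H3_ext (fun j => ?_) (fun j => ?_) <;>
        simp only [dg_hm, od_hm, map_add, map_smul, LinearMap.add_apply, LinearMap.smul_apply,
          smul_eq_mul] <;> split_ifs <;>
        (try simp only [mul_add, add_mul, smul_mul_assoc, mul_smul_comm, star_add,
          star_smul']) <;> first | ring1 | module)
    (fun v X X' => by
      refine H3_ext (fun j => ?_) (fun j => ?_) <;>
        simp only [dg_hm, od_hm, map_add, map_smul, LinearMap.add_apply, LinearMap.smul_apply,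
          smul_eq_mul] <;> split_ifs <;>
        (try simp only [mul_add, add_mul, smul_mul_assoc, mul_smul_comm, star_add,
          star_smul']) <;> first | ring1 | module)
    (fun r v X => by
      refine H3_ext (fun j => ?_) (fun j => ?_) <;>
        simp only [dg_hm, od_hm, map_add, map_smul, LinearMap.add_apply, LinearMap.smul_apply,
          smul_eq_mul] <;> split_ifs <;>
        (try simp only [mul_add, add_mul, smul_mul_assoc, mul_smul_comm, star_add,
          star_smul']) <;> first | ring1 | module)

/-- The map `X ↦ M X + X M†`, where `M` has the entry `star v` in row `i + 2` and column
`i + 1`. -/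
def lower (i : Fin 3) : Octonion →ₗ[ℝ] Module.End ℝ H3 :=
  LinearMap.mk₂ ℝ (fun v X => hm (fun j => if j = i + 2 then 2 * ip v (od i X) else 0)
      (fun j => if j = i then dg (i + 1) X • v else
        if j = i + 1 then star (od (i + 2) X * v) else 0))
    (fun v v' X => by
      refine H3_ext (fun j => ?_) (fun j => ?_) <;>
        simp only [dg_hm, od_hm, map_add, map_smul, LinearMap.add_apply, LinearMap.smul_apply,
          smul_eq_mul] <;> split_ifs <;>
        (try simp only [mul_add, add_mul, smul_mul_assoc, mul_smul_comm, star_add,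
          star_smul']) <;> first | ring1 | module)
    (fun r v X => by
      refine H3_ext (fun j => ?_) (fun j => ?_) <;>
        simp only [dg_hm, od_hm, map_add, map_smul, LinearMap.add_apply, LinearMap.smul_apply,
          smul_eq_mul] <;> split_ifs <;>
        (try simp only [mul_add, add_mul, smul_mul_assoc, mul_smul_comm, star_add,
          star_smul']) <;> first | ring1 | module)
    (fun v X X' => by
      refine H3_ext (fun j => ?_) (fun j => ?_) <;>
        simp only [dg_hm, od_hm, map_add, map_smul, LinearMap.add_apply, LinearMap.smul_apply,
          smul_eq_mul] <;> split_ifs <;>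
        (try simp only [mul_add, add_mul, smul_mul_assoc, mul_smul_comm, star_add,
          star_smul']) <;> first | ring1 | module)
    (fun r v X => by
      refine H3_ext (fun j => ?_) (fun j => ?_) <;>
        simp only [dg_hm, od_hm, map_add, map_smul, LinearMap.add_apply, LinearMap.smul_apply,
          smul_eq_mul] <;> split_ifs <;>
        (try simp only [mul_add, add_mul, smul_mul_assoc, mul_smul_comm, star_add,
          star_smul']) <;> first | ring1 | module)

/-- The map `X ↦ M X + X M†`, where `M` is the diagonal matrix with entries `m`. -/
def diagMap : (Fin 3 → ℝ) →ₗ[ℝ] Module.End ℝ H3 :=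
  LinearMap.mk₂ ℝ (fun m X => hm (fun j => 2 * m j * dg j X)
      (fun j => (m (j + 1) + m (j + 2)) • od j X))
    (fun v v' X => by
      refine H3_ext (fun j => ?_) (fun j => ?_) <;>
        simp only [dg_hm, od_hm, map_add, map_smul, LinearMap.add_apply, LinearMap.smul_apply,
          smul_eq_mul, Pi.add_apply, Pi.smul_apply] <;> first | ring1 | module)
    (fun r v X => by
      refine H3_ext (fun j => ?_) (fun j => ?_) <;>
        simp only [dg_hm, od_hm, map_add, map_smul, LinearMap.add_apply, LinearMap.smul_apply,
          smul_eq_mul, Pi.add_apply, Pi.smul_apply] <;> first | ring1 | module)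
    (fun v X X' => by
      refine H3_ext (fun j => ?_) (fun j => ?_) <;>
        simp only [dg_hm, od_hm, map_add, map_smul, LinearMap.add_apply, LinearMap.smul_apply,
          smul_eq_mul, Pi.add_apply, Pi.smul_apply] <;> first | ring1 | module)
    (fun r v X => by
      refine H3_ext (fun j => ?_) (fun j => ?_) <;>
        simp only [dg_hm, od_hm, map_add, map_smul, LinearMap.add_apply, LinearMap.smul_apply,
          smul_eq_mul, Pi.add_apply, Pi.smul_apply] <;> first | ring1 | module)

theorem dg_upper (i j : Fin 3) (v : Octonion) (X : H3) :
    dg j (upper i v X) = if j = i + 1 then 2 * ip v (od i X) else 0 := by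
  rw [upper, LinearMap.mk₂_apply, dg_hm]

theorem od_upper (i j : Fin 3) (v : Octonion) (X : H3) :
    od j (upper i v X) = if j = i then dg (i + 2) X • v else
      if j = i + 2 then star (v * od (i + 1) X) else 0 := by
  rw [upper, LinearMap.mk₂_apply, od_hm]

theorem dg_lower (i j : Fin 3) (v : Octonion) (X : H3) :
    dg j (lower i v X) = if j = i + 2 then 2 * ip v (od i X) else 0 := by
  rw [lower, LinearMap.mk₂_apply, dg_hm]

theorem od_lower (i j : Fin 3) (v : Octonion) (X : H3) :
    od j (lower i v X) = if j = i then dg (i + 1) X • v else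
      if j = i + 1 then star (od (i + 2) X * v) else 0 := by
  rw [lower, LinearMap.mk₂_apply, od_hm]

theorem dg_diagMap (m : Fin 3 → ℝ) (j : Fin 3) (X : H3) :
    dg j (diagMap m X) = 2 * m j * dg j X := by
  rw [diagMap, LinearMap.mk₂_apply, dg_hm]

theorem od_diagMap (m : Fin 3 → ℝ) (j : Fin 3) (X : H3) :
    od j (diagMap m X) = (m (j + 1) + m (j + 2)) • od j X := by
  rw [diagMap, LinearMap.mk₂_apply, od_hm]

/-- The derivative of the determinant at `X` is the pairing with the adjugate of `X`; membership in
`e6` becomes a single scalar identity. -/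
theorem cubic_diag_formula (X Y : H3) : cubic Y X X =
    ∑ j, (dg j Y * (dg (j + 1) X * dg (j + 2) X - ip (od j X) (od j X))
      + 2 * ip (od j Y) (star (od (j + 1) X * od (j + 2) X))
      - 2 * (dg j X * ip (od j Y) (od j X))) := by
  rw [cubic_swap_left, cubic_swap_right, cubic_eq, trace_jordan]
  simp only [dg_freudenthal, od_freudenthal, Fin.sum_univ_three, map_smul, map_sub, map_add,
    LinearMap.smul_apply, LinearMap.sub_apply, LinearMap.add_apply, ip_comm (od _ X) (od _ Y),
    ip_comm (star _), smul_eq_mul]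
  ring

theorem ip_star_right (u z : Octonion) : ip z (star u) = re (z * u) := by
  rw [ip_comm, ip_star_left]

/-- An infinitesimal shear preserves the determinant: the terms cancel in pairs by the composition
law for norms and the cyclicity of the real part of a triple product. -/
theorem upper_mem_e6 (i : Fin 3) (v : Octonion) : upper i v ∈ e6 := by
  refine mem_e6_of_diagonal fun X => ?_
  rw [cubic_diag_formula]
  have h₁ (x y z : Octonion) : ip (star (x * y)) z = re (x * (y * z)) := by
    rw [ip_star_left, re_mul_cycle]
  fin_cases i <;> simp [dg_upper, od_upper, Fin.sum_univ_three, ip_mul_mul_right, -star_mul] <;>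
    simp only [h₁, ip_star_right] <;> ring

theorem lower_mem_e6 (i : Fin 3) (v : Octonion) : lower i v ∈ e6 := by
  refine mem_e6_of_diagonal fun X => ?_
  rw [cubic_diag_formula]
  have h₁ (x y z : Octonion) : ip (star (x * y)) z = re (y * (z * x)) := by
    rw [ip_star_left, re_mul_cycle, re_mul_cycle]
  fin_cases i <;> simp [dg_lower, od_lower, Fin.sum_univ_three, ip_mul_mul_left, -star_mul] <;>
    simp only [h₁, ip_star_right] <;> ring

theorem diagMap_mem_e6 {m : Fin 3 → ℝ} (hm : ∑ i, m i = 0) : diagMap m ∈ e6 := by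
  refine mem_e6_of_diagonal fun X => ?_
  rw [cubic_diag_formula]
  have h₁ (x y z : Octonion) : re (y * (z * x)) = re (x * (y * z)) := by
    rw [re_mul_cycle, re_mul_cycle]
  rw [Fin.sum_univ_three] at hm
  simp [dg_diagMap, od_diagMap, Fin.sum_univ_three, ip_star_right, h₁ (od 0 X),
    re_mul_cycle (od 2 X) (od 0 X), -star_mul]
  have h₂ : m 2 = - m 0 - m 1 := by linarith
  rw [h₂]
  ring

/-- The infinitesimal rotations `upper - lower`. -/
def rot (i : Fin 3) : Octonion →ₗ[ℝ] Module.End ℝ H3 := upper i - lower i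

/-- The infinitesimal boosts `upper + lower`. -/
def boost (i : Fin 3) : Octonion →ₗ[ℝ] Module.End ℝ H3 := upper i + lower i

theorem rot_apply (i : Fin 3) (v : Octonion) (X : H3) :
    rot i v X = upper i v X - lower i v X := rfl

theorem boost_apply (i : Fin 3) (v : Octonion) (X : H3) :
    boost i v X = upper i v X + lower i v X := rfl

theorem rot_mem_e6 (i : Fin 3) (v : Octonion) : rot i v ∈ e6 :=
  sub_mem (upper_mem_e6 i v) (lower_mem_e6 i v)

theorem boost_mem_e6 (i : Fin 3) (v : Octonion) : boost i v ∈ e6 :=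
  add_mem (upper_mem_e6 i v) (lower_mem_e6 i v)

/-! ### Derivations and automorphisms of the Jordan product -/

/-- The basis of `H₃(𝕆)` given by the coordinates. -/
def coordEquiv : H3 ≃ₗ[ℝ] (Fin 3 ⊕ Fin 3 × Fin 8 → ℝ) where
  toFun X := Sum.elim (fun i => dg i X) fun k => ip (e k.2) (od k.1 X)
  map_add' X Y := by ext (i | k) <;> simp
  map_smul' r X := by ext (i | k) <;> simp
  invFun c := hm (fun i => c (.inl i)) fun i => ∑ a, c (.inr (i, a)) • e a
  left_inv X := H3_ext (fun i => by simp) fun i => by simp [sum_ip_e]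
  right_inv c := by ext (i | k) <;> simp [map_sum, ip_e]

/-- This expresses the matrix trace through the Jordan product alone, so automorphisms and
derivations respect it. The idempotents contribute each diagonal entry once; each of the eight
directions of an off-diagonal slot contributes half the sum of two diagonal entries, which adds
eight times the trace. -/
theorem linearMap_trace_jordan (X : H3) : LinearMap.trace ℝ H3 (jordan X) = 9 * trace X := by
  rw [LinearMap.trace_eq_matrix_trace ℝ (Module.Basis.ofEquivFun coordEquiv), Matrix.trace]
  simp only [Matrix.diag_apply, LinearMap.toMatrix_apply, Module.Basis.ofEquivFun_repr_apply,
    Module.Basis.coe_ofEquivFun, Fintype.sum_sum_type, Fintype.sum_prod_type]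
  have h₁ (i : Fin 3) : coordEquiv (jordan X (coordEquiv.symm (Function.update 0 (.inl i) 1)))
      (.inl i) = dg i X := by
    change dg i _ = _
    simp [dg_jordan, coordEquiv]
  have h₂ (i : Fin 3) (a : Fin 8) :
      coordEquiv (jordan X (coordEquiv.symm (Function.update 0 (.inr (i, a)) 1)))
      (.inr (i, a)) = 1 / 2 * (dg (i + 1) X + dg (i + 2) X) := by
    change ip (e a) (od i _) = _
    rw [od_jordan]
    have : ∑ b, Function.update (0 : Fin 3 ⊕ Fin 3 × Fin 8 → ℝ) (.inr (i, a)) 1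
        (.inr (i, b)) • e b = e a := by
      simp [Function.update_apply]
    fin_cases i <;> simp [coordEquiv, Function.update_apply, ip_e]
  simp only [Pi.single, h₁, h₂, trace_eq, Fin.sum_univ_three]
  simp
  ring

theorem trace_eq_zero_of_mem_f4 {D : Module.End ℝ H3} (hD : D ∈ f4) (X : H3) :
    trace (D X) = 0 := by
  have h : jordan (D X) = D * jordan X - jordan X * D := by
    ext1 Y
    simp [hD X Y]
  have := linearMap_trace_jordan (D X)
  rw [h, map_sub, LinearMap.trace_mul_comm, sub_self] at this
  linarith

theorem trace_eq_of_mem_F4 {g : H3 ≃ₗ[ℝ] H3} (hg : g ∈ F4) (X : H3) :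
    trace (g X) = trace X := by
  have h : jordan (g X) = g.conj (jordan X) := by
    ext1 Y
    have := hg X (g.symm Y)
    simp_all [LinearEquiv.conj_apply]
  have := linearMap_trace_jordan (g X)
  rw [h, LinearMap.trace_conj', linearMap_trace_jordan] at this
  linarith

theorem map_idH3_of_mem_F4 {g : H3 ≃ₗ[ℝ] H3} (hg : g ∈ F4) : g idH3 = idH3 := by
  have h (X : H3) : jordan idH3 X = X := by
    refine H3_ext (fun i => ?_) (fun i => ?_)
    · simp [dg_jordan]
    · simp only [od_jordan, dg_idH3, od_idH3]; simp; module
  have h₁ := hg idH3 (g.symm idH3)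
  rw [h, g.apply_symm_apply, jordan_comm, h] at h₁
  exact h₁.symm

theorem mem_F4_iff {g : H3 ≃ₗ[ℝ] H3} : g ∈ F4 ↔ g ∈ E6 ∧ ∀ X, trace (g X) = trace X := by
  constructor
  · intro hg
    have ht := trace_eq_of_mem_F4 hg
    have h1 := map_idH3_of_mem_F4 hg
    refine ⟨fun X => ?_, ht⟩
    have hf (A B : H3) : g (freudenthal A B) = freudenthal (g A) (g B) := by
      simp only [freudenthal, map_add, map_sub, map_smul, h1, hg A B, ht]
      rw [← hg A B, ht]
    rw [det, det, ← hf, ← hg, ht]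
  · rintro ⟨hg, ht⟩
    rw [mem_E6_iff_cubic] at hg
    -- Invariance of N on the triple (I, I, I) and of the trace gives tr(gI ∘ gI) = 3 and tr(gI ∘ I)
    -- = 3. Hence the squared length of gI − I is 3 − 3 − 3 + 3 = 0.
    have h1 : g idH3 = idH3 := by
      have h₁ (X : H3) : cubic X (g idH3) (g idH3) = trace X := by
        have := hg (g.symm X) idH3 idH3
        rw [g.apply_symm_apply] at this
        rw [this, cubic_idH3, ← ht (g.symm X), g.apply_symm_apply]
        have h₀ : trace (jordan (g.symm X) idH3) = trace X := by
          rw [← g.apply_symm_apply X, ht, g.symm_apply_apply, trace_jordan, trace_eq]; simp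
        rw [h₀]
        simp [trace_eq]
        ring
      have h₂ := h₁ idH3
      rw [cubic_swap_left, cubic_swap_right, cubic_idH3, ht] at h₂
      apply sub_eq_zero.1
      apply trace_jordan_self_eq_zero
      have h₃ : trace (jordan (g idH3) idH3) = trace idH3 := by
        rw [← ht idH3, trace_jordan, trace_eq]; simp
      have h₄ : trace (jordan idH3 idH3) = trace idH3 := by
        rw [trace_jordan, trace_eq]; simp
      have h₅ : trace idH3 = 3 := by simp [trace_eq]
      rw [map_sub jordan, LinearMap.sub_apply, map_sub, map_sub, map_sub, map_sub,
        map_sub, jordan_comm idH3 (g idH3), h₃, h₄]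
      rw [h₅] at h₂ ⊢
      linarith
    have hp (A B : H3) : trace (jordan (g A) (g B)) = trace (jordan A B) := by
      have := hg A B idH3
      rw [h1, cubic_idH3, cubic_idH3, ht, ht] at this
      linarith
    -- The Freudenthal product is dual to N with respect to the trace form, and `g` preserves both.
    have hf (A B : H3) : g (freudenthal A B) = freudenthal (g A) (g B) := by
      refine ext_trace_jordan fun Z => ?_
      obtain ⟨Z, rfl⟩ := g.surjective Z
      rw [hp, ← cubic_eq, ← cubic_eq, hg]
    intro X Y
    have h₂ := hg X Y idH3
    rw [h1] at h₂
    rw [jordan_eq_freudenthal X Y, jordan_eq_freudenthal (g X) (g Y), ← hf, map_sub, map_add,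
      map_smul, map_smul, map_add, map_smul, map_smul, h1, ht, ht, h₂]

theorem mem_f4_iff {D : Module.End ℝ H3} : D ∈ f4 ↔ D ∈ e6 ∧ ∀ X, trace (D X) = 0 := by
  constructor
  · intro hD
    have ht := trace_eq_zero_of_mem_f4 hD
    have h1 : D idH3 = 0 := by
      have h (X : H3) : jordan idH3 X = X := by
        refine H3_ext (fun i => ?_) (fun i => ?_)
        · simp [dg_jordan]
        · simp only [od_jordan, dg_idH3, od_idH3]; simp; module
      have h₁ := hD idH3 idH3
      rw [h, h, jordan_comm, h] at h₁
      simpa using h₁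
    refine ⟨mem_e6_of_diagonal fun X => ?_, ht⟩
    have hs (A B : H3) : trace (jordan (D A) B) + trace (jordan A (D B)) = 0 := by
      rw [← map_add, ← hD, ht]
    have hf (A : H3) : D (freudenthal A A) = (2 : ℝ) • freudenthal (D A) A := by
      simp only [freudenthal, map_add, map_sub, map_smul, h1, hD A A, ht]
      rw [jordan_comm A (D A)]
      have := hs A A
      rw [jordan_comm A (D A)] at this
      have h0 : trace (jordan (D A) A) = 0 := by linarith
      rw [h0]
      module
    have h := hs (freudenthal X X) X
    rw [hf, map_smul, LinearMap.smul_apply, map_smul, ← cubic_eq, ← cubic_eq, smul_eq_mul,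
      cubic_swap_right X X, cubic_swap_left X] at h
    linarith
  · rintro ⟨hD, ht⟩
    rw [mem_e6_iff] at hD
    have ht1 (X : H3) : cubic X idH3 idH3 = trace X := by
      rw [cubic_idH3, trace_jordan, trace_eq]
      simp [trace_eq, Fin.sum_univ_three]
      ring
    -- Evaluating the invariance of N on (X, I, I) leaves tr(X ∘ D I) = 0 for all X.
    have h1 : D idH3 = 0 := by
      refine ext_trace_jordan fun X => ?_
      have h := hD X idH3 idH3
      rw [ht1, ht, cubic_swap_right X idH3, cubic_idH3, ht, jordan_comm] at h
      simp
      linarith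
    have hp (A B : H3) : trace (jordan (D A) B) + trace (jordan A (D B)) = 0 := by
      have := hD A B idH3
      have h0 : cubic A B 0 = 0 := by simp [cubic]
      rw [h1, cubic_idH3, cubic_idH3, ht, ht, h0] at this
      linarith
    have hf (A B : H3) : D (freudenthal A B) = freudenthal (D A) B + freudenthal A (D B) := by
      refine ext_trace_jordan fun Z => ?_
      have h₁ := hD A B Z
      have h₂ := hp (freudenthal A B) Z
      simp only [cubic_eq] at h₁
      rw [map_add jordan, LinearMap.add_apply, map_add]
      linarith
    intro X Y
    have h₃ := hD X Y idH3
    have h0 : cubic X Y 0 = 0 := by simp [cubic]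
    rw [h1, h0] at h₃
    have h₄ : cubic X (D Y) idH3 = - cubic (D X) Y idH3 := by linarith
    rw [jordan_eq_freudenthal, jordan_eq_freudenthal (D X), jordan_eq_freudenthal X (D Y), map_sub,
      map_add, hf, map_smul, map_add, map_smul, map_smul, map_smul, ht, ht, h1, h₄]
    module

theorem rot_mem_f4 (i : Fin 3) (v : Octonion) : rot i v ∈ f4 := by
  refine mem_f4_iff.2 ⟨rot_mem_e6 i v, fun X => ?_⟩
  rw [trace_eq]
  fin_cases i <;> simp [rot_apply, dg_upper, dg_lower, Fin.sum_univ_three]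

/-! ### The structure of `𝔢₆` -/

/-- The diagonal idempotents. -/
def idem (i : Fin 3) : H3 := hm (Pi.single i 1) 0

/-- The matrix whose only nonzero entries are an off-diagonal entry and its conjugate. -/
def off (i : Fin 3) : Octonion →ₗ[ℝ] H3 where
  toFun v := hm 0 (Pi.single i v)
  map_add' v w := H3_ext (fun j => by simp) fun j => by simp [Pi.single_add]
  map_smul' r v := H3_ext (fun j => by simp) fun j => by simp [Pi.single_smul]

@[simp] theorem dg_idem (i j : Fin 3) : dg j (idem i) = if j = i then 1 else 0 := by
  simp [idem, Pi.single_apply]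

@[simp] theorem od_idem (i j : Fin 3) : od j (idem i) = 0 := by simp [idem]

@[simp] theorem dg_off (i j : Fin 3) (v : Octonion) : dg j (off i v) = 0 := by simp [off]

@[simp] theorem od_off (i j : Fin 3) (v : Octonion) :
    od j (off i v) = if j = i then v else 0 := by
  simp [off, Pi.single_apply]

theorem sum_idem_off (X : H3) : ∑ i, (dg i X • idem i + off i (od i X)) = X := by
  refine H3_ext (fun j => ?_) (fun j => ?_) <;> fin_cases j <;> simp [Fin.sum_univ_three]

/-- A linear map on `H₃(𝕆)` is determined by its values on the idempotents and on the matrices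
with a single off-diagonal entry. -/
theorem end_ext {V : Type*} [AddCommMonoid V] [Module ℝ V] {D D' : H3 →ₗ[ℝ] V}
    (h₁ : ∀ i, D (idem i) = D' (idem i)) (h₂ : ∀ i v, D (off i v) = D' (off i v)) : D = D' := by
  ext1 X
  rw [← sum_idem_off X]
  simp only [map_sum, map_add, map_smul, h₁, h₂]

theorem cubic_idem (i : Fin 3) (Y Z : H3) : cubic (idem i) Y Z =
    1 / 2 * (dg (i + 1) Y * dg (i + 2) Z + dg (i + 2) Y * dg (i + 1) Z)
      - ip (od i Y) (od i Z) := by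
  rw [cubic_formula]
  fin_cases i <;> simp [Fin.sum_univ_three, add_comm]

theorem cubic_off (i : Fin 3) (x y z : Octonion) :
    cubic (off i x) (off (i + 1) y) (off (i + 2) z) = re (x * (y * z)) := by
  rw [cubic_formula]
  fin_cases i <;> simp [Fin.sum_univ_three, re_mul_cycle]
  exact (re_mul_cycle _ _ _).symm

/-- A diagonal idempotent E has rank one, that is N(E, E, Z) = 0 for all Z; invariance then gives 2
N(E, D E, Z) = 0. Testing this against suitable Z confines D E to the tangent space of the rank-one
cone. -/
theorem cubic_map_idem {D : Module.End ℝ H3} (hD : D ∈ e6) (i : Fin 3) (Z : H3) :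
    cubic (idem i) (D (idem i)) Z = 0 := by
  have h := mem_e6_iff.1 hD (idem i) (idem i) Z
  rw [cubic_swap_left (D _), cubic_idem i (idem i)] at h
  fin_cases i <;> simp at h ⊢ <;> linarith

theorem od_map_idem {D : Module.End ℝ H3} (hD : D ∈ e6) (i : Fin 3) : od i (D (idem i)) = 0 := by
  refine eq_zero_of_ip fun y => ?_
  have h := cubic_map_idem hD i (off i y)
  rw [cubic_idem] at h
  simpa using h

theorem dg_map_idem {D : Module.End ℝ H3} (hD : D ∈ e6) {i j : Fin 3} (hij : j ≠ i) :
    dg j (D (idem i)) = 0 := by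
  have h₁ := cubic_map_idem hD i (idem (i + 1))
  have h₂ := cubic_map_idem hD i (idem (i + 2))
  rw [cubic_idem] at h₁ h₂
  fin_cases i <;> fin_cases j <;> simp_all

/-- Invariance of N on the three diagonal idempotents; this is the source of tracelessness of the
diagonal part. -/
theorem sum_dg_map_idem {D : Module.End ℝ H3} (hD : D ∈ e6) : ∑ i, dg i (D (idem i)) = 0 := by
  have h := mem_e6_iff.1 hD (idem 0) (idem 1) (idem 2)
  rw [cubic_swap_left (D _), cubic_swap_right (idem 1), cubic_swap_left (idem 1), cubic_idem,
    cubic_idem, cubic_idem] at h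
  simp [cubic_swap_left, cubic_idem] at h
  rw [Fin.sum_univ_three]
  linarith

/-! ### The subalgebra 𝔰𝔬(8) and infinitesimal triality -/

/-- The subspace of `𝔢₆` that annihilates the diagonal matrices. -/
def so8 : Submodule ℝ (Module.End ℝ H3) where
  carrier := {D | D ∈ e6 ∧ ∀ i, D (idem i) = 0}
  add_mem' {D D'} h h' := ⟨add_mem h.1 h'.1, fun i => by simp [h.2, h'.2]⟩
  zero_mem' := ⟨zero_mem _, fun i => by simp⟩
  smul_mem' r D h := ⟨SMulMemClass.smul_mem r h.1, fun i => by simp [h.2]⟩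

/-- The `i`-th off-diagonal block of a linear map. -/
def block (i : Fin 3) : Module.End ℝ H3 →ₗ[ℝ] Octonion →ₗ[ℝ] Octonion where
  toFun D := od i ∘ₗ D ∘ₗ off i
  map_add' D D' := by ext1; simp
  map_smul' r D := by ext1; simp

theorem block_apply (i : Fin 3) (D : Module.End ℝ H3) (v : Octonion) :
    block i D v = od i (D (off i v)) := rfl

theorem dg_of_mem_so8 {D : Module.End ℝ H3} (hD : D ∈ so8) (i : Fin 3) (X : H3) :
    dg i (D X) = 0 := by
  have h := mem_e6_iff.1 hD.1 (idem (i + 1)) (idem (i + 2)) X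
  rw [hD.2, hD.2, cubic_swap_left 0, cubic_idem, cubic_idem, cubic_idem] at h
  fin_cases i <;> simpa using h

/-- N(E, X, Y) for an idempotent E contains the inner product of the opposite off-diagonal entries.
As E is annihilated and diagonal entries of images vanish, that inner product is invariant. -/
theorem ip_od_of_mem_so8 {D : Module.End ℝ H3} (hD : D ∈ so8) (i : Fin 3) (X Y : H3) :
    ip (od i (D X)) (od i Y) + ip (od i X) (od i (D Y)) = 0 := by
  have h := mem_e6_iff.1 hD.1 (idem i) X Y
  rw [hD.2, cubic_idem, cubic_idem] at h
  simp only [dg_of_mem_so8 hD] at h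
  have h0 : cubic 0 X Y = 0 := by simp [cubic_formula]
  rw [h0] at h
  linarith

theorem block_skew {D : Module.End ℝ H3} (hD : D ∈ so8) (i : Fin 3) (v w : Octonion) :
    ip (block i D v) w + ip v (block i D w) = 0 := by
  have h := ip_od_of_mem_so8 hD i (off i v) (off i w)
  simpa [block_apply] using h

theorem map_off_of_mem_so8 {D : Module.End ℝ H3} (hD : D ∈ so8) (i : Fin 3) (v : Octonion) :
    D (off i v) = off i (block i D v) := by
  refine H3_ext (fun j => by simp [dg_of_mem_so8 hD]) fun j => ?_
  rw [od_off]
  split_ifs with h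
  · rw [h]; rfl
  · refine eq_zero_of_ip fun y => ?_
    have := ip_od_of_mem_so8 hD j (off i v) (off j y)
    simpa [h] using this

/-- Infinitesimal triality is the invariance of N on three matrices, one from each off-diagonal
slot, where N is the real part of the triple product. -/
theorem block_triality {D : Module.End ℝ H3} (hD : D ∈ so8) (i : Fin 3) (x y z : Octonion) :
    re (block i D x * (y * z)) + re (x * (block (i + 1) D y * z))
      + re (x * (y * block (i + 2) D z)) = 0 := by
  have h := mem_e6_iff.1 hD.1 (off i x) (off (i + 1) y) (off (i + 2) z)
  rwa [map_off_of_mem_so8 hD, map_off_of_mem_so8 hD, map_off_of_mem_so8 hD, cubic_off, cubic_off,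
    cubic_off] at h

/-- The nucleus of the octonions is real. -/
theorem eq_re_of_assoc {t : Octonion} (h : ∀ y z : Octonion, y * t * z = y * (t * z)) :
    t = re t • 1 := by
  -- An octonion associates between two of these units only if it lies in the quaternion subalgebra
  -- they generate. The subalgebras for the chosen pairs meet in the reals.
  have h₁ := h (e 1) (e 2)
  have h₂ := h (e 1) (e 4)
  have h₃ := h (e 2) (e 4)
  have h₄ := h (e 1) (e 5)
  have c (x y : Octonion) (hxy : x = y) : x.fst.re = y.fst.re ∧ x.fst.imI = y.fst.imI ∧
      x.fst.imJ = y.fst.imJ ∧ x.fst.imK = y.fst.imK ∧ x.snd.re = y.snd.re ∧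
      x.snd.imI = y.snd.imI ∧ x.snd.imJ = y.snd.imJ ∧ x.snd.imK = y.snd.imK := by
    simp [hxy]
  have c₁ := c _ _ h₁
  have c₂ := c _ _ h₂
  have c₃ := c _ _ h₃
  have c₄ := c _ _ h₄
  simp [e] at c₁ c₂ c₃ c₄
  apply ext_coords <;> simp [re_apply] <;> linarith

theorem re_mul_eq_ip (x y : Octonion) : re (x * y) = ip x (star y) := by
  rw [ip_def, star_star]

/-- With one block zero, triality says `T y * z + y * U z = 0`. So `T` is right multiplication by `t
= T 1`, `U` is minus left multiplication by `t`, and `t` lies in the nucleus. It is therefore real,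
and skewness of `T` makes it zero. -/
theorem eq_zero_of_block_eq_zero {D : Module.End ℝ H3} (hD : D ∈ so8) {k : Fin 3}
    (hk : block k D = 0) : D = 0 := by
  set T := block (k + 1) D
  set U := block (k + 2) D
  have h₁ (y z : Octonion) : T y * z + y * U z = 0 := by
    apply star_injective
    rw [star_zero]
    refine eq_zero_of_ip fun x => ?_
    have := block_triality hD k x y z
    rw [hk] at this
    rw [ip_comm, ← re_mul_eq_ip, mul_add, map_add]
    simpa using this
  have hU (z : Octonion) : U z = - (T 1 * z) := by
    have := h₁ 1 z
    rw [one_mul] at this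
    exact (neg_eq_of_add_eq_zero_right this).symm
  have hT (y : Octonion) : T y = y * T 1 := by
    have := h₁ y 1
    rw [mul_one, hU, mul_one, mul_neg] at this
    exact add_neg_eq_zero.1 this
  have ht : T 1 = re (T 1) • 1 := by
    refine eq_re_of_assoc fun y z => ?_
    have := h₁ y z
    rw [hU, hT, mul_neg] at this
    exact add_neg_eq_zero.1 this
  have hre : re (T 1) = 0 := by
    have := block_skew hD (k + 1) 1 1
    rw [ip_one_right, ip_one_left] at this
    change re (T 1) + re (T 1) = 0 at this
    linarith
  rw [hre, zero_smul] at ht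
  refine end_ext (fun i => by rw [hD.2]; rfl) fun i v => ?_
  rw [map_off_of_mem_so8 hD]
  have hi : ∀ i k : Fin 3, i = k ∨ i = k + 1 ∨ i = k + 2 := by decide
  obtain rfl | rfl | rfl := hi i k
  · simp [hk]
  · change off _ (T v) = _
    rw [hT v, ht, mul_zero]
    simp
  · change off _ (U v) = _
    rw [hU v, ht, zero_mul, neg_zero]
    simp

/-! ### Brackets of rotations, and the decomposition of 𝔢₆ -/

/-- The brackets of infinitesimal rotations, which span the subalgebra `so8`. -/
def wedge (k : Fin 3) (a b : Octonion) : Module.End ℝ H3 := ⁅rot k a, rot k b⁆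

theorem wedge_apply (k : Fin 3) (a b : Octonion) (X : H3) :
    wedge k a b X = rot k a (rot k b X) - rot k b (rot k a X) := by
  rw [wedge, LieRing.of_associative_ring_bracket]; rfl

theorem dg_rot (i j : Fin 3) (v : Octonion) (X : H3) : dg j (rot i v X) =
    (if j = i + 1 then 2 * ip v (od i X) else 0)
      - if j = i + 2 then 2 * ip v (od i X) else 0 := by
  rw [rot_apply, map_sub, dg_upper, dg_lower]

theorem od_rot (i j : Fin 3) (v : Octonion) (X : H3) : od j (rot i v X) =
    (if j = i then dg (i + 2) X • v else if j = i + 2 then star (v * od (i + 1) X) else 0)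
      - if j = i then dg (i + 1) X • v else
        if j = i + 1 then star (od (i + 2) X * v) else 0 := by
  rw [rot_apply, map_sub, od_upper, od_lower]

theorem wedge_mem_f4 (k : Fin 3) (a b : Octonion) : wedge k a b ∈ f4 :=
  f4.lie_mem (rot_mem_f4 k a) (rot_mem_f4 k b)

theorem wedge_mem_so8 (k : Fin 3) (a b : Octonion) : wedge k a b ∈ so8 := by
  refine ⟨(mem_f4_iff.1 (wedge_mem_f4 k a b)).1, fun i => ?_⟩
  rw [wedge_apply]
  refine H3_ext (fun j => ?_) (fun j => ?_)
  · simp only [map_sub, dg_rot, od_rot, dg_idem, od_idem]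
    fin_cases k <;> fin_cases i <;> fin_cases j <;> simp [ip_comm b a]
  · simp only [map_sub, dg_rot, od_rot, dg_idem, od_idem]
    fin_cases k <;> fin_cases i <;> fin_cases j <;> simp

/-- In its own slot the bracket is four times an infinitesimal plane rotation, the vector
representation. The two lemmas that follow give the half-spin representations in the other slots as
Clifford products. -/
theorem block_wedge (k : Fin 3) (a b x : Octonion) :
    block k (wedge k a b) x = (4 * ip a x) • b - (4 * ip b x) • a := by
  rw [block_apply, wedge_apply]
  simp only [map_sub, od_rot, dg_rot, od_off, dg_off]
  fin_cases k <;> simp <;> module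

theorem block_wedge_one (k : Fin 3) (a b x : Octonion) :
    block (k + 1) (wedge k a b) x = star b * (a * x) - star a * (b * x) := by
  rw [block_apply, wedge_apply]
  simp only [map_sub, od_rot, dg_rot, od_off, dg_off]
  fin_cases k <;> simp <;> abel

theorem block_wedge_two (k : Fin 3) (a b x : Octonion) :
    block (k + 2) (wedge k a b) x = x * a * star b - x * b * star a := by
  rw [block_apply, wedge_apply]
  simp only [map_sub, od_rot, dg_rot, od_off, dg_off]
  fin_cases k <;> simp <;> abel

/-- A skew map is the combination of plane rotations given by its matrix, and block `k` determines
`D`. The factor 1/8 combines the 4 in `block_wedge` with the double count of each plane. -/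
theorem so8_eq_sum_wedge {D : Module.End ℝ H3} (hD : D ∈ so8) (k : Fin 3) :
    D = ∑ a, ∑ b, (1 / 8 * ip (block k D (e a)) (e b)) • wedge k (e a) (e b) := by
  rw [← sub_eq_zero]
  refine eq_zero_of_block_eq_zero (k := k) (sub_mem hD <| Submodule.sum_mem _ fun a _ =>
    Submodule.sum_mem _ fun b _ => Submodule.smul_mem _ _ (wedge_mem_so8 ..)) ?_
  refine basis.ext fun c => ?_
  simp only [map_sub, map_sum, map_smul, LinearMap.sub_apply, LinearMap.sum_apply,
    LinearMap.smul_apply, block_wedge, basis_apply, ip_e, LinearMap.zero_apply]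
  rw [sub_eq_zero]
  have h₁ : ∑ b, ip (block k D (e c)) (e b) • e b = block k D (e c) := by
    conv_rhs => rw [← sum_ip_e (block k D (e c))]
    simp only [ip_comm]
  have h₂ : ∑ a, ip (block k D (e a)) (e c) • e a = - block k D (e c) := by
    rw [← h₁, ← Finset.sum_neg_distrib]
    refine Finset.sum_congr rfl fun a _ => ?_
    have := block_skew hD k (e a) (e c)
    rw [ip_comm (e a)] at this
    rw [← neg_smul]
    congr 1
    linarith
  simp only [smul_sub, Finset.sum_sub_distrib, mul_ite, mul_one, mul_zero, ite_smul, zero_smul,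
    smul_ite, smul_zero, Finset.sum_ite_eq', Finset.sum_ite_eq, Finset.mem_univ, if_true,
    Finset.sum_const_zero, Finset.sum_ite_irrel, smul_smul]
  have h₃ : ∑ b, (1 / 8 * ip (block k D (e c)) (e b) * 4) • e b
      = (1 / 2 : ℝ) • block k D (e c) := by
    conv_rhs => rw [← h₁, Finset.smul_sum]
    refine Finset.sum_congr rfl fun a _ => ?_
    rw [smul_smul]; congr 1; ring
  have h₄ : ∑ a, (1 / 8 * ip (block k D (e a)) (e c) * 4) • e a
      = -((1 / 2 : ℝ) • block k D (e c)) := by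
    rw [← smul_neg, ← h₂, Finset.smul_sum]
    refine Finset.sum_congr rfl fun a _ => ?_
    rw [smul_smul]; congr 1; ring
  rw [h₃, h₄]
  module

/-- The subtracted terms have the same values on the idempotents as `D`: `upper i v` sends `idem (i
+ 2)` to `off i v`, `lower i v` does so from `idem (i + 1)`, and a diagonal matrix `m` scales `idem
j` by `2 * m j`. -/
theorem sub_mem_so8 {D : Module.End ℝ H3} (hD : D ∈ e6) :
    D - ∑ i, (upper i (od i (D (idem (i + 2)))) + lower i (od i (D (idem (i + 1)))))
      - diagMap (fun i => 1 / 2 * dg i (D (idem i))) ∈ so8 := by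
  have hs : ∑ i, 1 / 2 * dg i (D (idem i)) = 0 := by
    rw [← Finset.mul_sum, sum_dg_map_idem hD, mul_zero]
  refine ⟨sub_mem (sub_mem hD (sum_mem fun i _ => add_mem (upper_mem_e6 i _) (lower_mem_e6 i _)))
    (diagMap_mem_e6 hs), fun i => ?_⟩
  refine H3_ext (fun j => ?_) fun j => ?_
  · simp only [LinearMap.sub_apply, map_sub, Fin.sum_univ_three, LinearMap.add_apply, map_add,
      dg_upper, dg_lower, dg_diagMap, dg_idem, od_idem]
    by_cases h : j = i
    · subst h; simp
    · simp [h, dg_map_idem hD h]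
  · simp only [LinearMap.sub_apply, map_sub, Fin.sum_univ_three, LinearMap.add_apply, map_add,
      od_upper, od_lower, od_diagMap, dg_idem, od_idem]
    have := od_map_idem hD i
    fin_cases i <;> fin_cases j <;> simp_all

/-- An element of `𝔢₆` that commutes with the infinitesimal rotations is zero. -/
theorem eq_zero_of_commute_rot {D : Module.End ℝ H3} (hD : D ∈ e6)
    (h : ∀ i v X, D (rot i v X) = rot i v (D X)) : D = 0 := by
  have h₁ (i : Fin 3) (v : Octonion) : rot i v (idem i) = 0 := by
    refine H3_ext (fun j => ?_) fun j => ?_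
    · simp [dg_rot]
    · fin_cases i <;> simp [od_rot]
  -- Since `D` commutes with `rot i 1`, which kills `idem i`, the image of `idem i` is killed too;
  -- this removes its two remaining off-diagonal entries.
  have h₂ (i : Fin 3) : rot i 1 (D (idem i)) = 0 := by rw [← h, h₁, map_zero]
  have h₃ (i j : Fin 3) : od j (D (idem i)) = 0 := by
    have e₀ := od_map_idem hD i
    have e₁ := congrArg (od (i + 1)) (h₂ i)
    have e₂ := congrArg (od (i + 2)) (h₂ i)
    rw [od_rot] at e₁ e₂
    fin_cases i <;> fin_cases j <;> simp_all
  have h₄ (i : Fin 3) : D (idem i) = dg i (D (idem i)) • idem i := by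
    refine H3_ext (fun j => ?_) fun j => ?_
    · by_cases hj : j = i
      · simp [hj]
      · simp [hj, dg_map_idem hD hj]
    · simp [h₃]
  -- Each off-diagonal matrix is reached from two idempotents, so it inherits the eigenvalue of `D`
  -- on both. All eigenvalues agree, and those on the idempotents sum to zero.
  have h₅ (i : Fin 3) (v : Octonion) : rot i v (idem (i + 2)) = off i v := by
    refine H3_ext (fun j => ?_) fun j => ?_
    · simp [dg_rot]
    · fin_cases i <;> simp [od_rot]
  have h₆ (i : Fin 3) (v : Octonion) : rot i v (idem (i + 1)) = - off i v := by
    refine H3_ext (fun j => ?_) fun j => ?_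
    · simp [dg_rot]
    · fin_cases i <;> fin_cases j <;> simp [od_rot]
  have h₇ (i : Fin 3) (v : Octonion) : D (off i v) = dg (i + 2) (D (idem (i + 2))) • off i v := by
    rw [← h₅, h, h₄]
    simp
  have h₈ (i : Fin 3) (v : Octonion) : D (off i v) = dg (i + 1) (D (idem (i + 1))) • off i v := by
    rw [← neg_neg (off i v), ← h₆, map_neg, h, h₄]
    simp
  have h₉ (i : Fin 3) : dg (i + 2) (D (idem (i + 2))) = dg (i + 1) (D (idem (i + 1))) := by
    have := congrArg (fun X => re (od i X)) ((h₇ i 1).symm.trans (h₈ i 1))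
    simpa using this
  have e₀ := h₉ 0
  have e₁ := h₉ 1
  have e₂ := sum_dg_map_idem hD
  rw [Fin.sum_univ_three] at e₂
  simp at e₀ e₁
  have h₁₀ (i : Fin 3) : dg i (D (idem i)) = 0 := by
    fin_cases i <;> simp <;> linarith
  refine end_ext (fun i => ?_) fun i v => ?_
  · rw [h₄, h₁₀]; simp
  · rw [h₇, h₁₀]; simp

/-! ### Derivatives of curves and one-parameter groups -/

/-- `Octonion` carries a vector space topology but no norm, so the chain rule for linear maps is
taken from the definition of the derivative in topological vector spaces. Afterwards everything is
transported to real coordinates. -/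
theorem hasDerivAt_clm_comp {E F : Type*} [AddCommGroup E] [Module ℝ E] [TopologicalSpace E]
    [ContinuousSMul ℝ E] [AddCommGroup F] [Module ℝ F] [TopologicalSpace F] [ContinuousSMul ℝ F]
    (L : E →L[ℝ] F) {f : ℝ → E} {f' : E} {t : ℝ} (h : HasDerivAt f f' t) :
    HasDerivAt (fun s => L (f s)) (L f') t := by
  constructor
  have h₁ := h.isLittleOTVS
  have h₂ := (L.isBigOTVS_fun_comp (l := nhds t ×ˢ pure t)
    (f := fun p : ℝ × ℝ => f p.1 - f p.2 - (p.1 - p.2) • f')).trans_isLittleOTVS h₁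
  refine h₂.congr_left fun p => ?_
  simp

theorem hasDerivAt_linearMap_comp {E F : Type*} [AddCommGroup E] [Module ℝ E]
    [TopologicalSpace E] [IsTopologicalAddGroup E] [ContinuousSMul ℝ E] [T2Space E]
    [FiniteDimensional ℝ E] [AddCommGroup F] [Module ℝ F] [TopologicalSpace F]
    [IsTopologicalAddGroup F] [ContinuousSMul ℝ F] (L : E →ₗ[ℝ] F) {f : ℝ → E} {f' : E} {t : ℝ}
    (h : HasDerivAt f f' t) : HasDerivAt (fun s => L (f s)) (L f') t :=
  hasDerivAt_clm_comp (LinearMap.toContinuousLinearMap L) h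

theorem hasDerivAt_iff_coordEquiv {f : ℝ → H3} {f' : H3} {t : ℝ} :
    HasDerivAt f f' t ↔ HasDerivAt (fun s => coordEquiv (f s)) (coordEquiv f') t := by
  refine ⟨fun h => hasDerivAt_linearMap_comp coordEquiv.toLinearMap h, fun h => ?_⟩
  simpa using hasDerivAt_linearMap_comp coordEquiv.symm.toLinearMap h

theorem hasDerivAt_H3 {f : ℝ → H3} {f' : H3} {t : ℝ}
    (h₁ : ∀ i, HasDerivAt (fun s => dg i (f s)) (dg i f') t)
    (h₂ : ∀ i y, HasDerivAt (fun s => ip y (od i (f s))) (ip y (od i f')) t) :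
    HasDerivAt f f' t := by
  rw [hasDerivAt_iff_coordEquiv, hasDerivAt_pi]
  rintro (i | k)
  · exact h₁ i
  · exact h₂ k.1 (e k.2)

theorem hasDerivAt_unique {f : ℝ → H3} {f' g' : H3} {t : ℝ} (h₁ : HasDerivAt f f' t)
    (h₂ : HasDerivAt f g' t) : f' = g' :=
  coordEquiv.injective <|
    (hasDerivAt_iff_coordEquiv.1 h₁).unique (hasDerivAt_iff_coordEquiv.1 h₂)

theorem hasDerivAt_bilin_real (B : H3 →ₗ[ℝ] H3 →ₗ[ℝ] ℝ) {f g : ℝ → H3} {f' g' : H3} {t : ℝ}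
    (hf : HasDerivAt f f' t) (hg : HasDerivAt g g' t) :
    HasDerivAt (fun s => B (f s) (g s)) (B f' (g t) + B (f t) g') t := by
  have key (X Y : H3) : B X Y =
      ∑ c, coordEquiv X c * B (coordEquiv.symm (Pi.single c 1)) Y := by
    conv_lhs => rw [← coordEquiv.symm_apply_apply X, pi_eq_sum_univ' (coordEquiv X)]
    simp only [map_sum, LinearMap.sum_apply, map_smul, LinearMap.smul_apply, smul_eq_mul]
  have h₁ := hasDerivAt_pi.1 (hasDerivAt_iff_coordEquiv.1 hf)
  have h₂ (c) := hasDerivAt_linearMap_comp (B (coordEquiv.symm (Pi.single c 1))) hg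
  rw [funext fun s => key (f s) (g s), key f', key (f t), ← Finset.sum_add_distrib]
  exact HasDerivAt.fun_sum fun c _ => (h₁ c).mul (h₂ c)

theorem hasDerivAt_bilin (B : H3 →ₗ[ℝ] H3 →ₗ[ℝ] H3) {f g : ℝ → H3} {f' g' : H3} {t : ℝ}
    (hf : HasDerivAt f f' t) (hg : HasDerivAt g g' t) :
    HasDerivAt (fun s => B (f s) (g s)) (B f' (g t) + B (f t) g') t := by
  rw [hasDerivAt_iff_coordEquiv, hasDerivAt_pi]
  intro c
  rw [map_add, Pi.add_apply]
  exact hasDerivAt_bilin_real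
    (B.compr₂ (LinearMap.proj c ∘ₗ coordEquiv.toLinearMap)) hf hg

theorem hasDerivAt_cubic {f g h : ℝ → H3} {f' g' h' : H3} {t : ℝ}
    (hf : HasDerivAt f f' t) (hg : HasDerivAt g g' t) (hh : HasDerivAt h h' t) :
    HasDerivAt (fun s => cubic (f s) (g s) (h s))
      (cubic f' (g t) (h t) + cubic (f t) g' (h t) + cubic (f t) (g t) h') t := by
  have h₁ := hasDerivAt_bilin (LinearMap.mk₂ ℝ freudenthal freudenthal_add_left
    freudenthal_smul_left freudenthal_add_right freudenthal_smul_right) hf hg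
  have h₂ := hasDerivAt_bilin_real (jordan.compr₂ trace) h₁ hh
  simpa [cubic] using h₂

/-- A one-parameter group of linear automorphisms from a family of linear maps. -/
def homOfAdd (T : ℝ → Module.End ℝ H3) (h₀ : T 0 = 1) (h : ∀ s t, T (s + t) = T s * T t) :
    Multiplicative ℝ →* (H3 ≃ₗ[ℝ] H3) where
  toFun s := LinearEquiv.ofLinearMap (T s.toAdd) (T (-s.toAdd))
    (by rw [← Module.End.mul_eq_comp, ← h, add_neg_cancel, h₀]; rfl)
    (by rw [← Module.End.mul_eq_comp, ← h, neg_add_cancel, h₀]; rfl)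
  map_one' := LinearEquiv.ext fun X => by
    change T 0 X = X
    rw [h₀]; rfl
  map_mul' s t := LinearEquiv.ext fun X => by
    change T (s.toAdd + t.toAdd) X = T s.toAdd (T t.toAdd X)
    rw [h]; rfl

/-- A linear map in coordinates. -/
def coordMap (D : Module.End ℝ H3) :
    (Fin 3 ⊕ Fin 3 × Fin 8 → ℝ) →L[ℝ] (Fin 3 ⊕ Fin 3 × Fin 8 → ℝ) :=
  LinearMap.toContinuousLinearMap (coordEquiv.conj D)

theorem coordMap_apply (D : Module.End ℝ H3) (X : H3) :
    coordMap D (coordEquiv X) = coordEquiv (D X) := by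
  simp [coordMap, LinearEquiv.conj_apply]

theorem exp_add_smul {A : Type*} [NormedRing A] [NormedAlgebra ℝ A] [CompleteSpace A] (x : A)
    (s t : ℝ) : NormedSpace.exp ((s + t) • x) = NormedSpace.exp (s • x) * NormedSpace.exp (t • x) := by
  let _ := NormedAlgebra.restrictScalars ℚ ℝ A
  rw [add_smul, NormedSpace.exp_add_of_commute (((Commute.refl x).smul_left s).smul_right t)]

/-- The one-parameter group generated by a linear map. -/
def flow (D : Module.End ℝ H3) : Multiplicative ℝ →* (H3 ≃ₗ[ℝ] H3) :=
  homOfAdd (fun t => coordEquiv.symm.conj (NormedSpace.exp (t • coordMap D)).toLinearMap)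
    (by
      ext1 X
      simp [LinearEquiv.conj_apply])
    fun s t => by
      rw [exp_add_smul]
      ext1 X
      simp [LinearEquiv.conj_apply]

theorem coordEquiv_flow (D : Module.End ℝ H3) (t : ℝ) (X : H3) :
    coordEquiv (flow D (.ofAdd t) X) = NormedSpace.exp (t • coordMap D) (coordEquiv X) := by
  simp [flow, homOfAdd, LinearEquiv.conj_apply]

theorem flow_zero (D : Module.End ℝ H3) (X : H3) : flow D (.ofAdd 0) X = X := by
  rw [ofAdd_zero, map_one]; rfl

theorem hasDerivAt_flow (D : Module.End ℝ H3) (X : H3) (t : ℝ) :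
    HasDerivAt (fun s => flow D (.ofAdd s) X) (D (flow D (.ofAdd t) X)) t := by
  rw [hasDerivAt_iff_coordEquiv]
  simp only [coordEquiv_flow, ← coordMap_apply]
  exact (hasDerivAt_exp_smul_const' (coordMap D) t).clm_apply (hasDerivAt_const t _) |>.congr_deriv
    (by simp)

theorem hasDerivAt_flow_zero (D : Module.End ℝ H3) (X : H3) :
    HasDerivAt (fun s => flow D (.ofAdd s) X) (D X) 0 := by
  simpa only [flow_zero] using hasDerivAt_flow D X 0

/-- Solutions of the linear differential equation given by `D` are orbits of its flow. -/
theorem eq_flow {D : Module.End ℝ H3} {f : ℝ → H3} (hf : ∀ t, HasDerivAt f (D (f t)) t) (t : ℝ) :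
    f t = flow D (.ofAdd t) (f 0) := by
  -- Integrating factor: applying the inverse flow to a solution gives a curve with zero derivative.
  have h₁ (s : ℝ) : HasDerivAt (fun s => NormedSpace.exp (s • -coordMap D) (coordEquiv (f s)))
      0 s := by
    have := (hasDerivAt_exp_smul_const (-coordMap D) s).clm_apply
      (hasDerivAt_iff_coordEquiv.1 (hf s))
    refine this.congr_deriv ?_
    simp [← coordMap_apply]
  have h₂ := is_const_of_deriv_eq_zero (fun s => (h₁ s).differentiableAt)
    (fun s => (h₁ s).deriv) t 0
  apply coordEquiv.injective
  rw [coordEquiv_flow]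
  have h₃ := congrArg (fun w => (NormedSpace.exp (t • coordMap D)) w) h₂
  have h₄ := exp_add_smul (coordMap D) t (-t)
  rw [add_neg_cancel, zero_smul, NormedSpace.exp_zero, neg_smul, ← smul_neg] at h₄
  have h₅ := congrArg (fun L => L (coordEquiv (f t))) h₄
  simp only [ContinuousLinearMap.mul_apply', one_apply_eq_self] at h₅
  rw [zero_smul, NormedSpace.exp_zero] at h₃
  exact h₅.trans h₃

theorem flow_mem_E6 {D : Module.End ℝ H3} (hD : D ∈ e6) (s : Multiplicative ℝ) :
    flow D s ∈ E6 := by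
  rw [mem_E6_iff_cubic]
  intro X Y Z
  have h₁ (t : ℝ) := (hasDerivAt_cubic (hasDerivAt_flow D X t) (hasDerivAt_flow D Y t)
    (hasDerivAt_flow D Z t)).congr_deriv (mem_e6_iff.1 hD _ _ _)
  have h₂ := is_const_of_deriv_eq_zero (fun s => (h₁ s).differentiableAt)
    (fun s => (h₁ s).deriv) s.toAdd 0
  simpa [flow_zero] using h₂

/-- By the derivation rule the Jordan product of two orbits solves the equation of `D` itself, so
uniqueness identifies it with the orbit of the product. -/
theorem flow_mem_F4 {D : Module.End ℝ H3} (hD : D ∈ f4) (s : Multiplicative ℝ) :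
    flow D s ∈ F4 := by
  intro X Y
  have h (t : ℝ) := hasDerivAt_bilin jordan (hasDerivAt_flow D X t) (hasDerivAt_flow D Y t)
  simp only [← hD _ _] at h
  have := eq_flow h s.toAdd
  simp only [flow_zero] at this
  exact this.symm

/-- One direction exponentiates; the other differentiates the invariance of N along the
one-parameter subgroup at 0. -/
theorem mem_e6_iff_isTangent (D : Module.End ℝ H3) : D ∈ e6 ↔ IsTangent E6 D := by
  refine ⟨fun h => ⟨flow D, flow_mem_E6 h, hasDerivAt_flow_zero D⟩, ?_⟩
  rintro ⟨φ, hφ, h⟩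
  rw [mem_e6_iff]
  intro X Y Z
  have h₁ := hasDerivAt_cubic (h X) (h Y) (h Z)
  simp only [mem_E6_iff_cubic.1 (hφ _), ofAdd_zero, map_one] at h₁
  exact h₁.unique (hasDerivAt_const _ _)

theorem mem_f4_iff_isTangent (D : Module.End ℝ H3) : D ∈ f4 ↔ IsTangent F4 D := by
  refine ⟨fun h => ⟨flow D, flow_mem_F4 h, hasDerivAt_flow_zero D⟩, ?_⟩
  rintro ⟨φ, hφ, h⟩ X Y
  have h₁ := hasDerivAt_bilin jordan (h X) (h Y)
  have h₂ (s : ℝ) : jordan (φ (.ofAdd s) X) (φ (.ofAdd s) Y) = φ (.ofAdd s) (jordan X Y) :=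
    (hφ _ X Y).symm
  simp only [h₂] at h₁
  simpa using hasDerivAt_unique (h (jordan X Y)) h₁

/-! ### The basis transformations of `SL(2, 𝕆)` -/

theorem fin3_cases (k : Fin 3) {P : Fin 3 → Prop} (h₀ : P k) (h₁ : P (k + 1)) (h₂ : P (k + 2))
    (i : Fin 3) : P i := by
  have : ∀ i k : Fin 3, i = k ∨ i = k + 1 ∨ i = k + 2 := by decide
  obtain rfl | rfl | rfl := this i k <;> assumption

theorem fin3_add_one_ne (k : Fin 3) : k + 1 ≠ k := by revert k; decide
theorem fin3_add_two_ne (k : Fin 3) : k + 2 ≠ k := by revert k; decide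
theorem fin3_ne_add_two (k : Fin 3) : k ≠ k + 2 := by revert k; decide
theorem fin3_add_two_ne_add_one (k : Fin 3) : k + 2 ≠ k + 1 := by revert k; decide
theorem fin3_add_one_ne_add_two (k : Fin 3) : k + 1 ≠ k + 2 := by revert k; decide
theorem fin3_add_one_add_one (k : Fin 3) : k + 1 + 1 = k + 2 := by revert k; decide
theorem fin3_add_one_add_two (k : Fin 3) : k + 1 + 2 = k := by revert k; decide
theorem fin3_add_two_add_one (k : Fin 3) : k + 2 + 1 = k := by revert k; decide
theorem fin3_add_two_add_two (k : Fin 3) : k + 2 + 2 = k + 1 := by revert k; decide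

/-- The Hermitian matrix with given entries, listed cyclically. -/
def hmAt (k : Fin 3) (d₀ d₁ d₂ : ℝ) (x y z : Octonion) : H3 :=
  hm (fun i => if i = k then d₀ else if i = k + 1 then d₁ else d₂)
    (fun i => if i = k then x else if i = k + 1 then y else z)

section hmAt
variable (k : Fin 3) (d₀ d₁ d₂ : ℝ) (x y z : Octonion)

@[simp] theorem dg_hmAt : dg k (hmAt k d₀ d₁ d₂ x y z) = d₀ := by simp [hmAt]
@[simp] theorem dg_one_hmAt : dg (k + 1) (hmAt k d₀ d₁ d₂ x y z) = d₁ := by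
  simp [hmAt, fin3_add_one_ne]
@[simp] theorem dg_two_hmAt : dg (k + 2) (hmAt k d₀ d₁ d₂ x y z) = d₂ := by
  simp [hmAt, fin3_add_two_ne, fin3_add_two_ne_add_one]
@[simp] theorem od_hmAt : od k (hmAt k d₀ d₁ d₂ x y z) = x := by simp [hmAt]
@[simp] theorem od_one_hmAt : od (k + 1) (hmAt k d₀ d₁ d₂ x y z) = y := by
  simp [hmAt, fin3_add_one_ne]
@[simp] theorem od_two_hmAt : od (k + 2) (hmAt k d₀ d₁ d₂ x y z) = z := by
  simp [hmAt, fin3_add_two_ne, fin3_add_two_ne_add_one]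

end hmAt

theorem eq_hmAt {k : Fin 3} {d₀ d₁ d₂ : ℝ} {x y z : Octonion} {X : H3} (h₁ : dg k X = d₀)
    (h₂ : dg (k + 1) X = d₁) (h₃ : dg (k + 2) X = d₂) (h₄ : od k X = x) (h₅ : od (k + 1) X = y)
    (h₆ : od (k + 2) X = z) : X = hmAt k d₀ d₁ d₂ x y z :=
  H3_ext (fin3_cases k (by simpa) (by simpa) (by simpa))
    (fin3_cases k (by simpa) (by simpa) (by simpa))

theorem hmAt_dg_od (k : Fin 3) (X : H3) : hmAt k (dg k X) (dg (k + 1) X) (dg (k + 2) X) (od k X)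
    (od (k + 1) X) (od (k + 2) X) = X :=
  (eq_hmAt rfl rfl rfl rfl rfl rfl).symm

theorem hasDerivAt_hmAt {k : Fin 3} {d₀ d₁ d₂ : ℝ → ℝ} {x y z : ℝ → Octonion} {D : H3} {t : ℝ}
    (h₀ : HasDerivAt d₀ (dg k D) t) (h₁ : HasDerivAt d₁ (dg (k + 1) D) t)
    (h₂ : HasDerivAt d₂ (dg (k + 2) D) t)
    (h₃ : ∀ w, HasDerivAt (fun s => ip w (x s)) (ip w (od k D)) t)
    (h₄ : ∀ w, HasDerivAt (fun s => ip w (y s)) (ip w (od (k + 1) D)) t)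
    (h₅ : ∀ w, HasDerivAt (fun s => ip w (z s)) (ip w (od (k + 2) D)) t) :
    HasDerivAt (fun s => hmAt k (d₀ s) (d₁ s) (d₂ s) (x s) (y s) (z s)) D t := by
  refine hasDerivAt_H3 (fin3_cases k ?_ ?_ ?_) (fin3_cases k ?_ ?_ ?_) <;> simpa

/-- The block of type `k + 1` occupies the indices `k + 1` and `k + 2` and leaves `k` fixed, so
listing entries cyclically from `k` treats the three types at once. The brackets in the hypotheses
are those of (M X) M†. -/
theorem act_embed {k : Fin 3} {a b c d : Octonion} {X Z : H3}
    (h₁ : (dg (k + 1) X • a + b * star (od k X)) * star a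
      + (a * od k X + dg (k + 2) X • b) * star b = dg (k + 1) Z • 1)
    (h₂ : (dg (k + 1) X • a + b * star (od k X)) * star c
      + (a * od k X + dg (k + 2) X • b) * star d = od k Z)
    (h₃ : (dg (k + 1) X • c + d * star (od k X)) * star a
      + (c * od k X + dg (k + 2) X • d) * star b = star (od k Z))
    (h₄ : (dg (k + 1) X • c + d * star (od k X)) * star c
      + (c * od k X + dg (k + 2) X • d) * star d = dg (k + 2) Z • 1)
    (h₅ : c * star (od (k + 2) X) + d * od (k + 1) X = od (k + 1) Z)
    (h₆ : od (k + 2) X * star a + star (od (k + 1) X) * star b = od (k + 2) Z)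
    (h₇ : dg k X = dg k Z) :
    act (embed (k + 1) !![a, b; c, d]) X.1 = Z.1 := by
  have h₅' := congrArg star h₅
  have h₆' := congrArg star h₆
  obtain ⟨p, x, rfl⟩ := exists_hm X
  obtain ⟨q, z, rfl⟩ := exists_hm Z
  simp only [dg_hm, od_hm, star_add, star_mul, star_star] at *
  refine Matrix.ext fun i j => ?_
  fin_cases k <;> fin_cases i <;> fin_cases j <;>
    simp [act, embed, hm, Matrix.mul_apply, Fin.sum_univ_three] at * <;>
    first
      | assumption
      | rw [h₇]
      | (refine Eq.trans ?_ h₁; simp only [add_mul]; abel1)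
      | (refine Eq.trans ?_ h₂; simp only [add_mul]; abel1)
      | (refine Eq.trans ?_ h₃; simp only [add_mul]; abel1)
      | (refine Eq.trans ?_ h₄; simp only [add_mul]; abel1)
      | (rw [add_comm]; assumption)

theorem flexible (a x : Octonion) : a * x * a = a * (x * a) := by
  have h (y : Octonion) : y = (2 * re y) • 1 - star y := by rw [← add_star_self]; abel
  have h₁ := star_mul_cancel (star a) x
  have h₂ := mul_mul_star_cancel a x
  have h₃ : star a = (2 * re a) • 1 - a := by rw [← add_star_self]; abel
  have h₄ := re_mul_comm a x
  apply ext_coords <;> simp <;> ring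

/-- The hypothesis is the one associativity that is needed: without it (M X) M† might fail to be
Hermitian in the rows of the block. -/
theorem act_diag {k : Fin 3} {a d : Octonion} {X : H3}
    (h : d * star (od k X) * star a = star (a * od k X * star d)) :
    act (embed (k + 1) !![a, 0; 0, d]) X.1 =
      (hmAt k (dg k X) (ip a a * dg (k + 1) X) (ip d d * dg (k + 2) X) (a * od k X * star d)
        (d * od (k + 1) X) (od (k + 2) X * star a)).1 := by
  have h₁ (a : Octonion) : a * star a = ip a a • 1 := by simpa using mul_star_cancel a 1
  apply act_embed <;> simp [smul_mul_assoc, h₁, smul_smul, mul_comm]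
  simpa using h

/-- The action of a hyperbolic or elliptic `2 × 2` matrix. -/
def mix (ε : ℝ) (k : Fin 3) (v : Octonion) (c s : ℝ) (X : H3) : H3 :=
  hmAt k (dg k X)
    (c ^ 2 * dg (k + 1) X + 2 * ε * (c * s) * ip (star v) (od k X) + s ^ 2 * dg (k + 2) X)
    (s ^ 2 * dg (k + 1) X + 2 * (c * s) * ip (star v) (od k X) + c ^ 2 * dg (k + 2) X)
    ((c * s * (dg (k + 1) X + ε * dg (k + 2) X)) • star v
      + (ε * s ^ 2) • (star v * star (od k X) * star v) + c ^ 2 • od k X)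
    (s • (v * star (od (k + 2) X)) + c • od (k + 1) X)
    (c • od (k + 2) X + (ε * s) • (star (od (k + 1) X) * v))

/-- The sign ε = −1 gives rotations and ε = 1 boosts. Each entry involves only `v`, its conjugate
and a single entry of `X`, so alternativity and flexibility settle the brackets. -/
theorem act_mix {ε : ℝ} (hε : ε = 1 ∨ ε = -1) (k : Fin 3) {v : Octonion} (hv : ip v v = 1)
    (c s : ℝ) (X : H3) :
    act (embed (k + 1) !![c • 1, (ε * s) • star v; s • v, c • 1]) X.1 = (mix ε k v c s X).1 := by
  have h₁ : star v * v = 1 := by simpa [hv] using star_mul_cancel v 1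
  have h₂ : v * star v = 1 := by simpa [hv] using mul_star_cancel v 1
  have h₃ : star v * star (od k X) = (2 * ip (star v) (od k X)) • 1 - od k X * v := by
    rw [eq_sub_iff_add_eq, add_comm, ← star_mul, add_star_self, ip_comm, ip_def, star_star]
  have h₄ : star (od k X) * star v = (2 * ip (star v) (od k X)) • 1 - v * od k X := by
    rw [eq_sub_iff_add_eq, add_comm, ← star_mul, add_star_self, re_mul_comm, ip_comm, ip_def,
      star_star]
  have h₅ : v * od k X * v = v * (od k X * v) := flexible _ _
  obtain rfl | rfl := hε
  all_goals
    apply act_embed <;>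
      simp only [mix, dg_hmAt, dg_one_hmAt, dg_two_hmAt, od_hmAt, od_one_hmAt, od_two_hmAt,
        add_mul, mul_add, smul_mul_assoc, mul_smul_comm, one_mul, mul_one, star_smul', star_add,
        star_star, star_one, star_mul, h₁, h₂, h₅] <;>
      first
      | rfl
      | module
      | (rw [h₃]; module)
      | (rw [h₄]; module)

/-- The equations c' = ε s / 2 and s' = c / 2 cover the circular and hyperbolic functions of half
the parameter together. -/
theorem hasDerivAt_mix {ε : ℝ} (hε : ε = 1 ∨ ε = -1) (k : Fin 3) {v : Octonion}
    (hv : ip v v = 1) {c s : ℝ → ℝ} {t : ℝ} (hc : HasDerivAt c (1 / 2 * (ε * s t)) t)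
    (hs : HasDerivAt s (1 / 2 * c t) t) (X : H3) :
    HasDerivAt (fun θ => mix ε k v (c θ) (s θ) X)
      (((1 / 2 : ℝ) • (lower k (star v) + ε • upper k (star v))) (mix ε k v (c t) (s t) X)) t := by
  have h₃ : star v * star (od k X) = (2 * ip (star v) (od k X)) • 1 - od k X * v := by
    rw [eq_sub_iff_add_eq, add_comm, ← star_mul, add_star_self, ip_comm, ip_def, star_star]
  -- This makes the only quadratic expression in `v` linear in `X` and `v`, like a reflection, so
  -- that differentiation stays elementary.
  have h₄ : star v * star (od k X) * star v = (2 * ip (star v) (od k X)) • star v - od k X := by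
    rw [h₃, sub_mul, smul_mul_assoc, one_mul, mul_mul_star_cancel, hv, one_smul]
  have h₅ : ip (star v) (star v) = 1 := by rw [ip_star_star, hv]
  have h₆ (x : Octonion) : v * (star v * x) = x := by rw [mul_star_cancel, hv, one_smul]
  have h₇ (x : Octonion) : x * v * star v = x := by rw [mul_mul_star_cancel, hv, one_smul]
  have h₈ (x : Octonion) : x * star v * v = x := by rw [mul_star_mul_cancel, hv, one_smul]
  have hc2 := hc.fun_pow 2
  have hs2 := hs.fun_pow 2
  have hcs := hc.fun_mul hs
  unfold mix
  rw [h₄]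
  apply hasDerivAt_hmAt <;>
    simp only [LinearMap.smul_apply, LinearMap.add_apply, map_add, map_smul, map_sub, dg_lower,
      od_lower, dg_upper, od_upper, dg_hmAt, dg_one_hmAt, dg_two_hmAt, od_hmAt, od_one_hmAt,
      od_two_hmAt, fin3_add_one_ne, fin3_add_two_ne, fin3_ne_add_two, fin3_add_two_ne_add_one,
      fin3_add_one_ne_add_two, (fin3_add_one_ne k).symm, if_true, if_false, smul_eq_mul,
      star_add, star_smul', star_mul, star_star, add_mul, mul_add, smul_mul_assoc, mul_smul_comm,
      h₅, h₆, h₇, h₈, map_zero]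
  · simpa using hasDerivAt_const t _
  · refine (((hc2.mul_const _).add ((hcs.const_mul (2 * ε)).mul_const _)).add
      (hs2.mul_const _)).congr_deriv ?_
    obtain rfl | rfl := hε <;> simp <;> ring
  · refine (((hs2.mul_const _).add ((hcs.const_mul 2).mul_const _)).add
      (hc2.mul_const _)).congr_deriv ?_
    obtain rfl | rfl := hε <;> simp <;> ring
  · intro w
    refine (((((hcs.mul_const _).mul_const _).add ((hcs.mul_const _).mul_const _)).add ((hs2.const_mul ε).mul_const _)).add
      (hc2.mul_const _)).congr_deriv ?_
    obtain rfl | rfl := hε <;> simp <;> ring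
  · intro w
    refine ((hs.mul_const _).add (hc.mul_const _)).congr_deriv ?_
    obtain rfl | rfl := hε <;> simp <;> ring
  · intro w
    refine ((hc.mul_const _).add ((hs.const_mul ε).mul_const _)).congr_deriv ?_
    obtain rfl | rfl := hε <;> simp <;> ring

theorem od_of_mem_so8 {D : Module.End ℝ H3} (hD : D ∈ so8) (i : Fin 3) (X : H3) :
    od i (D X) = block i D (od i X) := by
  conv_lhs => rw [← sum_idem_off X]
  simp only [map_sum, map_add, map_smul, hD.2, smul_zero, zero_add, map_off_of_mem_so8 hD, od_off]
  simp

theorem ip_unit (p q : Fin 7) : ip (unit p) (unit q) = if p = q then 1 else 0 := by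
  rw [← e_succ, ← e_succ, ip_e]
  simp

theorem star_unit (p : Fin 7) : star (unit p) = -unit p := by
  fin_cases p <;> ext1 <;> simp [unit]

theorem re_unit (p : Fin 7) : re (unit p) = 0 := by
  fin_cases p <;> simp [unit, re_apply]

theorem unit_mul_unit_mul (p : Fin 7) (x : Octonion) : unit p * (unit p * x) = -x := by
  have := star_mul_cancel (unit p) x
  rw [star_unit, neg_mul, ip_unit] at this
  simpa [neg_eq_iff_eq_neg] using this

theorem mul_unit_mul_unit (p : Fin 7) (x : Octonion) : x * unit p * unit p = -x := by
  have := mul_mul_star_cancel (unit p) x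
  rw [star_unit, mul_neg, ip_unit] at this
  simpa [neg_eq_iff_eq_neg] using this

/-- The infinitesimal generators of the basis transformations. -/
def gen (τ : Fin 3) : SL2Label → Module.End ℝ H3
  | .inl (.xy p) => (1 / 4 : ℝ) • wedge (τ + 2) (unit p) 1
  | .inl (.im p q _) => (1 / 4 : ℝ) • wedge (τ + 2) (unit p) (unit q)
  | .inr (.inl (.yz p)) => (1 / 2 : ℝ) • (lower (τ + 2) (unit p) + (-1 : ℝ) • upper (τ + 2) (unit p))
  | .inr (.inl .zx) => (1 / 2 : ℝ) • (lower (τ + 2) 1 + (-1 : ℝ) • upper (τ + 2) 1)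
  | .inr (.inr .tx) => (1 / 2 : ℝ) • (lower (τ + 2) 1 + (1 : ℝ) • upper (τ + 2) 1)
  | .inr (.inr (.ty p)) =>
    (1 / 2 : ℝ) • (lower (τ + 2) (-unit p) + (1 : ℝ) • upper (τ + 2) (-unit p))
  | .inr (.inr .tz) => diagMap (Pi.single τ (1 / 2) - Pi.single (τ + 1) (1 / 2))

theorem hasDerivAt_cos_half (t : ℝ) :
    HasDerivAt (fun θ : ℝ => Real.cos (θ / 2)) (1 / 2 * (-1 * Real.sin (t / 2))) t := by
  refine ((Real.hasDerivAt_cos _).comp t ((hasDerivAt_id t).div_const 2)).congr_deriv ?_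
  simp; ring

theorem hasDerivAt_sin_half (t : ℝ) :
    HasDerivAt (fun θ : ℝ => Real.sin (θ / 2)) (1 / 2 * Real.cos (t / 2)) t := by
  refine ((Real.hasDerivAt_sin _).comp t ((hasDerivAt_id t).div_const 2)).congr_deriv ?_
  simp; ring

theorem hasDerivAt_cosh_half (t : ℝ) :
    HasDerivAt (fun θ : ℝ => Real.cosh (θ / 2)) (1 / 2 * (1 * Real.sinh (t / 2))) t := by
  refine ((Real.hasDerivAt_cosh _).comp t ((hasDerivAt_id t).div_const 2)).congr_deriv ?_
  simp; ring

theorem hasDerivAt_sinh_half (t : ℝ) :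
    HasDerivAt (fun θ : ℝ => Real.sinh (θ / 2)) (1 / 2 * Real.cosh (t / 2)) t := by
  refine ((Real.hasDerivAt_sinh _).comp t ((hasDerivAt_id t).div_const 2)).congr_deriv ?_
  simp; ring

theorem mix_one_zero (ε : ℝ) (k : Fin 3) (v : Octonion) (X : H3) : mix ε k v 1 0 X = X := by
  simp [mix, hmAt_dg_od]

theorem flow_eq_mix {ε : ℝ} (hε : ε = 1 ∨ ε = -1) (k : Fin 3) {v : Octonion}
    (hv : ip v v = 1) {c s : ℝ → ℝ} (hc : ∀ t, HasDerivAt c (1 / 2 * (ε * s t)) t)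
    (hs : ∀ t, HasDerivAt s (1 / 2 * c t) t) (hc₀ : c 0 = 1) (hs₀ : s 0 = 0) (X : H3) (t : ℝ) :
    flow ((1 / 2 : ℝ) • (lower k (star v) + ε • upper k (star v))) (.ofAdd t) X =
      mix ε k v (c t) (s t) X := by
  rw [eq_flow (fun t => hasDerivAt_mix hε k hv (hc t) (hs t) X) t, hc₀, hs₀, mix_one_zero]

theorem flow_eq_of_hasDerivAt {D : Module.End ℝ H3} {f : ℝ → H3} {X : H3} (h₀ : f 0 = X)
    (hf : ∀ t, HasDerivAt f (D (f t)) t) (t : ℝ) : flow D (.ofAdd t) X = f t := by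
  rw [eq_flow hf t, h₀]

theorem flow_tz (k : Fin 3) (X : H3) (t : ℝ) :
    flow (diagMap (Pi.single (k + 1) (1 / 2) - Pi.single (k + 2) (1 / 2))) (.ofAdd t) X =
      hmAt k (dg k X) (Real.exp t * dg (k + 1) X) (Real.exp (-t) * dg (k + 2) X) (od k X)
        (Real.exp (-t / 2) • od (k + 1) X) (Real.exp (t / 2) • od (k + 2) X) := by
  have h₁ (t : ℝ) : HasDerivAt (fun t => Real.exp (-t)) (-Real.exp (-t)) t := by
    simpa using (hasDerivAt_neg t).exp
  have h₂ (t : ℝ) : HasDerivAt (fun t : ℝ => Real.exp (-t / 2)) (Real.exp (-t / 2) * (-1 / 2)) t :=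
    ((hasDerivAt_neg t).div_const 2).exp
  have h₃ (t : ℝ) : HasDerivAt (fun t : ℝ => Real.exp (t / 2)) (Real.exp (t / 2) * (1 / 2)) t :=
    ((hasDerivAt_id t).div_const 2).exp
  refine flow_eq_of_hasDerivAt (f := fun t => hmAt k (dg k X) (Real.exp t * dg (k + 1) X)
    (Real.exp (-t) * dg (k + 2) X) (od k X)
    (Real.exp (-t / 2) • od (k + 1) X) (Real.exp (t / 2) • od (k + 2) X)) ?_ (fun t => ?_) t
  · simp [hmAt_dg_od]
  · apply hasDerivAt_hmAt <;>
      simp only [dg_diagMap, od_diagMap, dg_hmAt, dg_one_hmAt, dg_two_hmAt, od_hmAt, od_one_hmAt,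
        od_two_hmAt, Pi.sub_apply, Pi.single_apply, fin3_add_one_ne, fin3_add_two_ne,
        fin3_ne_add_two, fin3_add_two_ne_add_one, fin3_add_one_ne_add_two,
        (fin3_add_one_ne k).symm, if_true, if_false, fin3_add_one_add_one, fin3_add_one_add_two,
        fin3_add_two_add_one, fin3_add_two_add_two, map_smul, smul_eq_mul]
    · simpa using hasDerivAt_const t _
    · exact ((Real.hasDerivAt_exp t).mul_const _).congr_deriv (by ring)
    · exact ((h₁ t).mul_const _).congr_deriv (by ring)
    · intro w
      simpa using hasDerivAt_const t _
    · intro w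
      exact ((h₂ t).mul_const _).congr_deriv (by ring)
    · intro w
      exact ((h₃ t).mul_const _).congr_deriv (by ring)

/-- For a unit octonion `a`, the two-sided multiplication in one slot and the one-sided
multiplications by the conjugate in the others form a triality triple; the orbit is checked against
the three blocks of the bracket. -/
theorem flow_xy (k : Fin 3) (p : Fin 7) (X : H3) (t : ℝ) :
    let a := Real.cos (t / 2) • 1 - Real.sin (t / 2) • unit p
    flow ((1 / 4 : ℝ) • wedge k (unit p) 1) (.ofAdd t) X =
      hmAt k (dg k X) (dg (k + 1) X) (dg (k + 2) X) (a * od k X * a)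
        (star a * od (k + 1) X) (od (k + 2) X * star a) := by
  intro a
  have hD := wedge_mem_so8 k (unit p) 1
  refine flow_eq_of_hasDerivAt (f := fun t => hmAt k (dg k X) (dg (k + 1) X) (dg (k + 2) X)
    ((Real.cos (t / 2) • 1 - Real.sin (t / 2) • unit p) * od k X *
      (Real.cos (t / 2) • 1 - Real.sin (t / 2) • unit p))
    (star (Real.cos (t / 2) • 1 - Real.sin (t / 2) • unit p) * od (k + 1) X)
    (od (k + 2) X * star (Real.cos (t / 2) • 1 - Real.sin (t / 2) • unit p))) ?_ (fun t => ?_) t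
  · simp [hmAt_dg_od]
  · have hc := hasDerivAt_cos_half t
    have hs := hasDerivAt_sin_half t
    set c := fun θ : ℝ => Real.cos (θ / 2)
    set s := fun θ : ℝ => Real.sin (θ / 2)
    have h₁ (x : Octonion) : ip (unit p) x • (1 : Octonion) - re x • unit p =
        -((1 / 2 : ℝ) • (unit p * x + x * unit p)) := by
      fin_cases p <;> apply ext_coords <;> simp [unit, ip_eq, re_apply] <;> ring
    have h₂ (x : Octonion) : unit p * (unit p * x * unit p) = - (x * unit p) := by
      rw [flexible, unit_mul_unit_mul]
    apply hasDerivAt_hmAt <;>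
      simp only [dg_of_mem_so8 hD, od_of_mem_so8 hD, dg_hmAt, dg_one_hmAt, dg_two_hmAt, od_hmAt,
        od_one_hmAt, od_two_hmAt, map_smul, LinearMap.smul_apply, block_wedge, block_wedge_one,
        block_wedge_two, ip_one_left, smul_zero]
    · exact hasDerivAt_const t _
    · exact hasDerivAt_const t _
    · exact hasDerivAt_const t _
    · intro w
      have h₃ (x : Octonion) : (4 * ip (unit p) x) • (1 : Octonion) - (4 * re x) • unit p
          = -((2 : ℝ) • (unit p * x + x * unit p)) := by
        have := congrArg ((4 : ℝ) • ·) (h₁ x)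
        simp only [smul_sub, smul_smul, smul_neg] at this
        rw [this]; module
      simp only [h₃]
      simp only [add_mul, sub_mul, mul_sub, mul_add, smul_mul_assoc, mul_smul_comm, one_mul,
        mul_one, map_sub, map_add, map_smul, map_neg, smul_eq_mul, smul_sub, smul_add,
        unit_mul_unit_mul, mul_unit_mul_unit, h₂, ← flexible (unit p) (od k X), smul_neg, mul_neg]
      refine ((((hc.mul (hc.mul_const (ip w (od k X))))).sub
        (hc.mul (hs.mul_const (ip w (unit p * od k X))))).sub
        ((hs.mul (hc.mul_const (ip w (od k X * unit p)))).sub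
        (hs.mul (hs.mul_const (ip w (unit p * od k X * unit p)))))).congr_deriv ?_
      simp only [c, s]
      ring
    · intro w
      simp only [star_sub, star_smul', star_one, one_mul, star_unit, add_mul, sub_mul, mul_sub,
        mul_add, smul_mul_assoc, mul_smul_comm, smul_neg, sub_neg_eq_add, neg_mul, map_add,
        map_smul, smul_eq_mul, unit_mul_unit_mul, map_neg, mul_neg, map_sub, neg_neg]
      refine ((hc.mul_const (ip w (od (k + 1) X))).add
        (hs.mul_const (ip w (unit p * od (k + 1) X)))).congr_deriv ?_
      ring
    · intro w
      simp only [star_sub, star_smul', star_one, mul_one, star_unit, add_mul, sub_mul, mul_sub,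
        mul_add, smul_mul_assoc, mul_smul_comm, smul_neg, sub_neg_eq_add, neg_mul, map_add,
        map_smul, smul_eq_mul, mul_unit_mul_unit, map_neg, mul_neg, map_sub, neg_neg]
      refine ((hc.mul_const (ip w (od (k + 2) X))).add
        (hs.mul_const (ip w (od (k + 2) X * unit p)))).congr_deriv ?_
      ring

/-- For an imaginary unit vector this is a reflection followed by conjugation. In a nested flip the
two conjugations cancel, and two reflections compose to a plane rotation through twice the angle
between their axes. -/
theorem mul_mul_star_of_re_eq_zero {u : Octonion} (hu : star u = -u) (w : Octonion) :
    u * w * star u = ip u u • star w + (2 * ip u w) • u := by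
  have h₁ : u * w = (2 * re (u * w)) • 1 - star w * star u := by
    rw [← add_star_self, star_mul]; abel
  have h₂ : re (u * w) = - ip u w := by
    rw [re_mul_eq_ip, ← ip_star_star, star_star, hu, map_neg, LinearMap.neg_apply]
  have h₃ := mul_mul_star_cancel u (star w)
  rw [hu, mul_neg, neg_eq_iff_eq_neg] at h₃
  rw [h₁, h₂, hu]
  simp only [mul_neg, sub_neg_eq_add, add_mul, neg_mul, smul_mul_assoc, one_mul, h₃]
  module

theorem flow_im (k : Fin 3) {p q : Fin 7} (hpq : p ≠ q) (X : H3) (t : ℝ) :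
    let u := Real.cos (t / 2) • unit p + Real.sin (t / 2) • unit q
    flow ((1 / 4 : ℝ) • wedge k (unit p) (unit q)) (.ofAdd t) X =
      hmAt k (dg k X) (dg (k + 1) X) (dg (k + 2) X)
        (u * (-unit p * od k X * star (-unit p)) * star u)
        (u * (-unit p * od (k + 1) X)) (od (k + 2) X * star (-unit p) * star u) := by
  intro u
  have hD := wedge_mem_so8 k (unit p) (unit q)
  have hpp : ip (unit p) (unit p) = 1 := by simp [ip_unit]
  have hqq : ip (unit q) (unit q) = 1 := by simp [ip_unit]
  have hpq' : ip (unit p) (unit q) = 0 := by simp [ip_unit, hpq]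
  have hqp' : ip (unit q) (unit p) = 0 := by simp [ip_unit, hpq.symm]
  have hl (x : Octonion) : unit q * (unit p * x) = -(unit p * (unit q * x)) := by
    have := star_mul_mul_add (unit p) (unit q) x
    simp only [star_unit, hpq', neg_mul, mul_zero, zero_smul] at this
    exact neg_injective (eq_neg_of_add_eq_zero_right this)
  have hr (x : Octonion) : x * unit q * unit p = -(x * unit p * unit q) := by
    have := mul_mul_star_add (unit p) (unit q) x
    simp only [star_unit, hpq', mul_neg, mul_zero, zero_smul] at this
    exact neg_injective (eq_neg_of_add_eq_zero_right this)
  have hu (t : ℝ) : star (Real.cos (t / 2) • unit p + Real.sin (t / 2) • unit q) =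
      -(Real.cos (t / 2) • unit p + Real.sin (t / 2) • unit q) := by
    simp [star_unit]; abel
  have hcs (t : ℝ) : Real.cos (t / 2) * Real.cos (t / 2) + Real.sin (t / 2) * Real.sin (t / 2)
      = 1 := by rw [← sq, ← sq]; exact Real.cos_sq_add_sin_sq _
  -- The product of two reflections, written without octonion products, so that its derivative
  -- involves only inner products.
  have hx (t : ℝ) : (Real.cos (t / 2) • unit p + Real.sin (t / 2) • unit q) *
      (-unit p * od k X * star (-unit p)) *
        star (Real.cos (t / 2) • unit p + Real.sin (t / 2) • unit q) =
      od k X - (2 * ip (unit p) (od k X)) • unit p +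
        (2 * (Real.cos (t / 2) * ip (unit p) (od k X) - Real.sin (t / 2) * ip (unit q) (od k X))) •
          (Real.cos (t / 2) • unit p + Real.sin (t / 2) • unit q) := by
    have h₁ : -unit p * od k X * star (-unit p) =
        star (od k X) + (2 * ip (unit p) (od k X)) • unit p := by
      rw [mul_mul_star_of_re_eq_zero (by simp [star_unit])]
      simp [hpp]
    have h₂ (r : Fin 7) : ip (unit r) (star (od k X)) = - ip (unit r) (od k X) := by
      rw [← ip_star_star, star_star, star_unit, map_neg, LinearMap.neg_apply]
    rw [mul_mul_star_of_re_eq_zero (hu t), h₁]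
    simp only [map_add, map_smul, LinearMap.add_apply, LinearMap.smul_apply, smul_eq_mul, hpp, hqq,
      hpq', hqp', h₂, star_add, star_star, star_smul', star_unit, mul_one, mul_zero, add_zero,
      zero_add, hcs]
    module
  refine flow_eq_of_hasDerivAt (f := fun t => hmAt k (dg k X) (dg (k + 1) X) (dg (k + 2) X)
    ((Real.cos (t / 2) • unit p + Real.sin (t / 2) • unit q) *
      (-unit p * od k X * star (-unit p)) *
        star (Real.cos (t / 2) • unit p + Real.sin (t / 2) • unit q))
    ((Real.cos (t / 2) • unit p + Real.sin (t / 2) • unit q) * (-unit p * od (k + 1) X))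
    (od (k + 2) X * star (-unit p) *
      star (Real.cos (t / 2) • unit p + Real.sin (t / 2) • unit q))) ?_ (fun t => ?_) t
  · simp only [hx]
    simp [star_unit, unit_mul_unit_mul, mul_unit_mul_unit, hmAt_dg_od]
  · have hc := hasDerivAt_cos_half t
    have hs := hasDerivAt_sin_half t
    simp only [hx]
    simp only [star_neg, star_unit, neg_neg, hu, star_add, star_smul']
    generalize -unit p * od (k + 1) X = y
    generalize od (k + 2) X * unit p = z
    apply hasDerivAt_hmAt <;>
      simp only [LinearMap.smul_apply, map_smul, dg_of_mem_so8 hD, od_of_mem_so8 hD, dg_hmAt,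
        dg_one_hmAt, dg_two_hmAt, od_hmAt, od_one_hmAt, od_two_hmAt, block_wedge, block_wedge_one,
        block_wedge_two, smul_zero]
    · exact hasDerivAt_const t _
    · exact hasDerivAt_const t _
    · exact hasDerivAt_const t _
    · intro w
      simp only [map_add, map_sub, map_smul, smul_eq_mul, hpp, hqq, hpq', hqp', mul_one, mul_zero,
        zero_add, add_zero]
      generalize ip (unit p) (od k X) = α
      generalize ip (unit q) (od k X) = β
      refine ((hasDerivAt_const t _).add ((((hc.mul_const α).sub (hs.mul_const β)).const_mul 2).mul
        ((hc.mul_const (ip w (unit p))).add (hs.mul_const (ip w (unit q)))))).congr_deriv ?_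
      simp only [Pi.add_apply, Pi.sub_apply]
      linear_combination (-β * ip w (unit p) - α * ip w (unit q)) * hcs t
    · intro w
      simp only [star_unit, neg_mul, add_mul, mul_add, smul_mul_assoc, mul_smul_comm, hl,
        unit_mul_unit_mul, map_add, map_sub, map_neg, map_smul, smul_eq_mul, mul_neg, neg_neg]
      refine ((hc.mul_const (ip w (unit p * y))).add
        (hs.mul_const (ip w (unit q * y)))).congr_deriv ?_
      ring
    · intro w
      simp only [star_unit, mul_neg, neg_mul, add_mul, mul_add, smul_mul_assoc, mul_smul_comm, hr,
        mul_unit_mul_unit, map_add, map_sub, map_neg, map_smul, smul_eq_mul, neg_neg]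
      refine ((hc.mul_const (ip w (z * unit p))).add
        (hs.mul_const (ip w (z * unit q)))).neg.congr_deriv ?_
      ring

theorem ip_cos_sin {a b : Octonion} (ha : ip a a = 1) (hb : ip b b = 1) (hab : ip a b = 0)
    (θ : ℝ) : ip (Real.cos θ • a + Real.sin θ • b) (Real.cos θ • a + Real.sin θ • b) = 1 := by
  simp only [map_add, map_smul, LinearMap.add_apply, LinearMap.smul_apply, smul_eq_mul, ha, hb,
    ip_comm b a, hab]
  linear_combination Real.cos_sq_add_sin_sq θ

theorem act_diag_of_star_eq {k : Fin 3} {a : Octonion} (X : H3) (ha : ip a a = 1)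
    (h : star a = -a) : act (embed (k + 1) !![a, 0; 0, a]) X.1 =
      (hmAt k (dg k X) (dg (k + 1) X) (dg (k + 2) X) (a * od k X * star a)
        (a * od (k + 1) X) (od (k + 2) X * star a)).1 := by
  have := act_diag (k := k) (a := a) (d := a) (X := X) (by
    rw [star_mul, star_mul, star_star, h, mul_neg, mul_neg, flexible, mul_neg])
  simpa [ha] using this

/-- The basis transformations are the flows of their generators. -/
theorem transform_eq_flow (τ : Fin 3) (a : SL2Label) (θ : ℝ) (X : H3) :
    transform τ a θ X.1 = (flow (gen τ a) (.ofAdd θ) X).1 := by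
  obtain ⟨k, rfl⟩ : ∃ k, τ = k + 1 := ⟨τ + 2, by rw [fin3_add_two_add_one]⟩
  have hcs := Real.cos_sq_add_sin_sq (θ / 2)
  rcases a with (p | ⟨p, q, h⟩) | (p | _) | (_ | p | _) <;>
    simp only [transform, sl2Matrices, gen, List.foldr, fin3_add_one_add_two,
      fin3_add_one_add_one]
  · rw [flow_xy]
    set a := Real.cos (θ / 2) • 1 - Real.sin (θ / 2) • unit p with ha
    have h₁ : Real.cos (θ / 2) • 1 + Real.sin (θ / 2) • unit p = star a := by
      simp [ha, star_unit]
    have h₂ : ip a a = 1 := by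
      have := ip_cos_sin (a := 1) (b := -unit p) (by simp [ip_one_left]) (by simp [ip_unit])
        (by simp [ip_one_left, re_unit]) (θ / 2)
      rwa [smul_neg, ← sub_eq_add_neg] at this
    rw [h₁, act_diag (by rw [star_mul, star_mul, star_star, flexible])]
    simp [h₂]
  · rw [flow_im k h.ne, act_diag_of_star_eq X (by simp [ip_unit]) (by simp [star_unit]),
      act_diag_of_star_eq _ (ip_cos_sin (by simp [ip_unit]) (by simp [ip_unit])
        (by simp [ip_unit, h.ne]) _) (by simp [star_unit]; abel)]
    simp
  · have h := act_mix (ε := -1) (.inr rfl) k (v := -unit p) (by simp [ip_unit])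
      (Real.cos (θ / 2)) (Real.sin (θ / 2)) X
    rw [← flow_eq_mix (c := fun θ => Real.cos (θ / 2)) (s := fun θ => Real.sin (θ / 2)) (.inr rfl)
      k (by simp [ip_unit]) hasDerivAt_cos_half hasDerivAt_sin_half (by simp) (by simp)] at h
    simpa [star_unit] using h
  · have h := act_mix (ε := -1) (.inr rfl) k (v := 1) (by simp [ip_one_left])
      (Real.cos (θ / 2)) (Real.sin (θ / 2)) X
    rw [← flow_eq_mix (c := fun θ => Real.cos (θ / 2)) (s := fun θ => Real.sin (θ / 2)) (.inr rfl)
      k (by simp [ip_one_left]) hasDerivAt_cos_half hasDerivAt_sin_half (by simp) (by simp)] at h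
    simpa using h
  · have h := act_mix (ε := 1) (.inl rfl) k (v := 1) (by simp [ip_one_left])
      (Real.cosh (θ / 2)) (Real.sinh (θ / 2)) X
    rw [← flow_eq_mix (c := fun θ => Real.cosh (θ / 2)) (s := fun θ => Real.sinh (θ / 2))
      (.inl rfl) k (by simp [ip_one_left]) hasDerivAt_cosh_half hasDerivAt_sinh_half (by simp)
      (by simp)] at h
    simpa using h
  · have h := act_mix (ε := 1) (.inl rfl) k (v := unit p) (by simp [ip_unit])
      (Real.cosh (θ / 2)) (Real.sinh (θ / 2)) X
    rw [← flow_eq_mix (c := fun θ => Real.cosh (θ / 2)) (s := fun θ => Real.sinh (θ / 2))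
      (.inl rfl) k (by simp [ip_unit]) hasDerivAt_cosh_half hasDerivAt_sinh_half (by simp)
      (by simp)] at h
    simpa [star_unit] using h
  · have h₁ : Real.exp (θ / 2) * Real.exp (-θ / 2) = 1 := by
      rw [← Real.exp_add]; ring_nf; simp
    have h₂ : Real.exp (θ / 2) * Real.exp (θ / 2) = Real.exp θ := by
      rw [← Real.exp_add]; ring_nf
    have h₃ : Real.exp (-θ / 2) * Real.exp (-θ / 2) = Real.exp (-θ) := by
      rw [← Real.exp_add]; ring_nf
    rw [flow_tz, act_diag]
    · simp [ip_one_left, smul_mul_assoc, mul_smul_comm, smul_smul, h₂, h₃, h₁,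
        mul_comm (Real.exp (-θ / 2))]
    · simp [smul_mul_assoc, mul_smul_comm, smul_smul, h₁, mul_comm (Real.exp (-θ / 2))]

/-! ### Generators and transformations identified with vectors and flows -/

theorem gen_mem_e6 (τ : Fin 3) (a : SL2Label) : gen τ a ∈ e6 := by
  rcases a with (p | ⟨p, q, h⟩) | (p | _) | (_ | p | _)
  · exact e6.smul_mem _ (wedge_mem_so8 ..).1
  · exact e6.smul_mem _ (wedge_mem_so8 ..).1
  · exact e6.smul_mem _ (e6.add_mem (lower_mem_e6 _ _) (e6.smul_mem _ (upper_mem_e6 _ _)))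
  · exact e6.smul_mem _ (e6.add_mem (lower_mem_e6 _ _) (e6.smul_mem _ (upper_mem_e6 _ _)))
  · exact e6.smul_mem _ (e6.add_mem (lower_mem_e6 _ _) (e6.smul_mem _ (upper_mem_e6 _ _)))
  · exact e6.smul_mem _ (e6.add_mem (lower_mem_e6 _ _) (e6.smul_mem _ (upper_mem_e6 _ _)))
  · refine diagMap_mem_e6 ?_
    simp

theorem hasDerivAt_entry {f : ℝ → Mat3} {f' : Mat3} {t : ℝ} (h : HasDerivAt f f' t)
    (i j : Fin 3) (w : Octonion) :
    HasDerivAt (fun s => ip w (f s i j)) (ip w (f' i j)) t :=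
  hasDerivAt_linearMap_comp (ip w ∘ₗ Matrix.entryLinearMap ℝ Octonion i j) h

theorem isGenerator_iff {τ : Fin 3} {a : SL2Label} {D : Module.End ℝ H3} :
    IsGenerator τ a D ↔ D = gen τ a := by
  have h₁ : IsGenerator τ a (gen τ a) := fun X => by
    simp only [transform_eq_flow]
    exact hasDerivAt_linearMap_comp H3Submodule.subtype (hasDerivAt_flow_zero (gen τ a) X)
  refine ⟨fun h => LinearMap.ext fun X => Subtype.ext (Matrix.ext fun i j => ext_ip fun w => ?_),
    fun h => h ▸ h₁⟩
  rw [ip_comm, ip_comm _ w]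
  exact (hasDerivAt_entry (h X) i j w).unique (hasDerivAt_entry (h₁ X) i j w)

theorem isTransform_iff {τ : Fin 3} {a : SL2Label} {g : H3 ≃ₗ[ℝ] H3} :
    IsTransform τ a g ↔ ∃ θ : ℝ, g = flow (gen τ a) (.ofAdd θ) := by
  refine exists_congr fun θ => ?_
  simp only [transform_eq_flow]
  exact ⟨fun h => LinearEquiv.ext fun X => Subtype.ext (h X), fun h X => by rw [h]⟩

/-- Over the three types each diagonal entry is scaled once by exp β and once by exp (−β), and each
off-diagonal entry once by exp (β/2) and once by exp (−β/2). -/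
theorem tz_relation (β : ℝ) (X : H3) :
    transform 0 (.inr (.inr .tz)) β
      (transform 1 (.inr (.inr .tz)) β (transform 2 (.inr (.inr .tz)) β X)) = X := by
  have h (k : Fin 3) (X : H3) : flow (gen (k + 1) (.inr (.inr .tz))) (.ofAdd β) X =
      hmAt k (dg k X) (Real.exp β * dg (k + 1) X) (Real.exp (-β) * dg (k + 2) X) (od k X)
        (Real.exp (-β / 2) • od (k + 1) X) (Real.exp (β / 2) • od (k + 2) X) := by
    simp only [gen, fin3_add_one_add_one]
    exact flow_tz k X β
  have h₀ := h 2
  have h₁ := h 0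
  have h₂ := h 1
  have e₁ : Real.exp (β / 2) * Real.exp (-β / 2) = 1 := by
    rw [← Real.exp_add]; ring_nf; simp
  have e₂ : Real.exp (-β / 2) * Real.exp (β / 2) = 1 := by rw [mul_comm, e₁]
  have e₃ : Real.exp β * Real.exp (-β) = 1 := by rw [← Real.exp_add]; simp
  have e₄ : Real.exp (-β) * Real.exp β = 1 := by rw [mul_comm, e₃]
  have f₁ (r : ℝ) : Real.exp β * (Real.exp (-β) * r) = r := by rw [← mul_assoc, e₃, one_mul]
  have f₂ (r : ℝ) : Real.exp (-β) * (Real.exp β * r) = r := by rw [← mul_assoc, e₄, one_mul]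
  simp only [Fin.isValue, zero_add, Fin.reduceAdd] at h₀ h₁ h₂
  rw [transform_eq_flow, transform_eq_flow, transform_eq_flow, h₂, h₁, h₀]
  refine congrArg Subtype.val (H3_ext (fun i => ?_) fun i => ?_) <;> fin_cases i <;>
    simp [hmAt, smul_smul, e₁, e₂, f₁, f₂]

/-! ### Bases and dimensions -/

theorem gen_zx (τ : Fin 3) : gen τ (.inr (.inl .zx)) = (-1 / 2 : ℝ) • rot (τ + 2) 1 := by
  simp only [gen, rot, LinearMap.sub_apply]; module

theorem gen_yz (τ : Fin 3) (p : Fin 7) :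
    gen τ (.inr (.inl (.yz p))) = (-1 / 2 : ℝ) • rot (τ + 2) (unit p) := by
  simp only [gen, rot, LinearMap.sub_apply]; module

theorem gen_tx (τ : Fin 3) : gen τ (.inr (.inr .tx)) = (1 / 2 : ℝ) • boost (τ + 2) 1 := by
  simp only [gen, boost, LinearMap.add_apply]; module

theorem gen_ty (τ : Fin 3) (p : Fin 7) :
    gen τ (.inr (.inr (.ty p))) = (-1 / 2 : ℝ) • boost (τ + 2) (unit p) := by
  simp only [gen, boost, LinearMap.add_apply, map_neg]; module

theorem map_mem_of_e {L : Octonion →ₗ[ℝ] Module.End ℝ H3} {S : Submodule ℝ (Module.End ℝ H3)}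
    (h₀ : L 1 ∈ S) (h : ∀ p, L (unit p) ∈ S) (v : Octonion) : L v ∈ S := by
  rw [← sum_ip_e v, map_sum]
  refine S.sum_mem fun a _ => ?_
  rw [map_smul]
  refine S.smul_mem _ ?_
  induction a using Fin.cases with
  | zero => exact h₀
  | succ p => rw [e_succ]; exact h p

section span
variable {S : Submodule ℝ (Module.End ℝ H3)} {τ : Fin 3}

theorem rot_mem_of_gen (h : ∀ b, gen τ (.inr (.inl b)) ∈ S) (v : Octonion) :
    rot (τ + 2) v ∈ S := by
  refine map_mem_of_e ?_ (fun p => ?_) v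
  · have := h .zx
    rw [gen_zx] at this
    exact (S.smul_mem_iff (by norm_num)).1 this
  · have := h (.yz p)
    rw [gen_yz] at this
    exact (S.smul_mem_iff (by norm_num)).1 this

theorem boost_mem_of_gen (h₁ : gen τ (.inr (.inr .tx)) ∈ S)
    (h₂ : ∀ p, gen τ (.inr (.inr (.ty p))) ∈ S) (v : Octonion) : boost (τ + 2) v ∈ S := by
  refine map_mem_of_e ?_ (fun p => ?_) v
  · rw [gen_tx] at h₁
    exact (S.smul_mem_iff (by norm_num)).1 h₁
  · have := h₂ p
    rw [gen_ty] at this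
    exact (S.smul_mem_iff (by norm_num)).1 this

theorem wedge_swap (k : Fin 3) (a b : Octonion) : wedge k b a = - wedge k a b := by
  rw [wedge, wedge, lie_skew]

/-- The space `so8` does not depend on a type, yet brackets of any one type span it. This is
triality at the level of Lie algebras. -/
theorem so8_le_of_gen (h : ∀ a, gen τ (.inl a) ∈ S) : so8 ≤ S := by
  have h₁ (p : Fin 7) : wedge (τ + 2) (unit p) 1 ∈ S :=
    (S.smul_mem_iff (by norm_num)).1 (h (.xy p))
  have h₂ (p q : Fin 7) : wedge (τ + 2) (unit p) (unit q) ∈ S := by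
    rcases lt_trichotomy p q with hpq | rfl | hpq
    · exact (S.smul_mem_iff (by norm_num)).1 (h (.im p q hpq))
    · rw [wedge, lie_self]; exact S.zero_mem
    · rw [wedge_swap]
      exact S.neg_mem ((S.smul_mem_iff (by norm_num)).1 (h (.im q p hpq)))
  intro D hD
  rw [so8_eq_sum_wedge hD (τ + 2)]
  refine S.sum_mem fun a _ => S.sum_mem fun b _ => S.smul_mem _ ?_
  induction a using Fin.cases with
  | zero =>
    induction b using Fin.cases with
    | zero => rw [wedge, lie_self]; exact S.zero_mem
    | succ q => rw [wedge_swap, e_succ]; exact S.neg_mem (h₁ q)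
  | succ p =>
    rw [e_succ]
    induction b using Fin.cases with
    | zero => exact h₁ p
    | succ q => rw [e_succ]; exact h₂ p q

/-- Two of the three differences of consecutive diagonal units already span the traceless diagonal
matrices, whichever one is dropped. -/
theorem diagMap_mem_of_gen {ρ : Fin 3} (h : ∀ τ, τ ≠ ρ → gen τ (.inr (.inr .tz)) ∈ S)
    {m : Fin 3 → ℝ} (hm : ∑ i, m i = 0) : diagMap m ∈ S := by
  have h₀ := h (ρ + 1) (fin3_add_one_ne ρ)
  have h₁ := h (ρ + 2) (fin3_add_two_ne ρ)
  have key : m = (2 * m (ρ + 1)) • (Pi.single (ρ + 1) (1 / 2) - Pi.single (ρ + 1 + 1) (1 / 2)) +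
      (2 * (m (ρ + 1) + m (ρ + 2))) •
        (Pi.single (ρ + 2) (1 / 2) - Pi.single (ρ + 2 + 1) (1 / 2) : Fin 3 → ℝ) := by
    rw [Fin.sum_univ_three] at hm
    funext i
    fin_cases ρ <;> fin_cases i <;> simp at hm ⊢ <;> linarith
  rw [key, map_add, map_smul, map_smul]
  exact S.add_mem (S.smul_mem _ h₀) (S.smul_mem _ h₁)

end span

theorem so8_le_f4 : so8 ≤ f4.toSubmodule := fun D hD =>
  mem_f4_iff.2 ⟨hD.1, fun X => by simp [trace_eq, dg_of_mem_so8 hD]⟩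

theorem so8Span_eq (τ : Fin 3) : so8Span τ = so8 := by
  refine le_antisymm (Submodule.span_le.2 ?_)
    (so8_le_of_gen (τ := τ) fun a => Submodule.subset_span ⟨a, isGenerator_iff.2 rfl⟩)
  rintro D ⟨a, ha⟩
  rw [isGenerator_iff.1 ha]
  cases a <;> exact so8.smul_mem _ (wedge_mem_so8 ..)

/-- Traceless diagonal matrices. -/
def traceless : (Fin 2 → ℝ) →ₗ[ℝ] (Fin 3 → ℝ) where
  toFun m := ![m 0, m 1, -m 0 - m 1]
  map_add' m m' := by ext i; fin_cases i <;> simp; ring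
  map_smul' r m := by ext i; fin_cases i <;> simp; ring

/-- The pairs of basis elements of the octonions. -/
abbrev Pairs : Type := {p : Fin 8 × Fin 8 // p.1 < p.2}

/-- Coordinates for the boosts. -/
def boostMap : ((Fin 3 → Octonion) × (Fin 2 → ℝ)) →ₗ[ℝ] Module.End ℝ H3 :=
  LinearMap.coprod (∑ i, boost i ∘ₗ LinearMap.proj i) (diagMap ∘ₗ traceless)

/-- Coordinates for the rotations. -/
def rotMap : ((Fin 3 → Octonion) × (Pairs → ℝ)) →ₗ[ℝ] Module.End ℝ H3 :=
  LinearMap.coprod (∑ i, rot i ∘ₗ LinearMap.proj i)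
    (∑ p : Pairs, (LinearMap.proj p).smulRight (wedge 0 (e p.1.1) (e p.1.2)))

theorem boostMap_apply (u : Fin 3 → Octonion) (m : Fin 2 → ℝ) :
    boostMap (u, m) = ∑ i, boost i (u i) + diagMap (traceless m) := by
  simp [boostMap]

theorem rotMap_apply (u : Fin 3 → Octonion) (c : Pairs → ℝ) :
    rotMap (u, c) = ∑ i, rot i (u i) + ∑ p : Pairs, c p • wedge 0 (e p.1.1) (e p.1.2) := by
  simp [rotMap]

theorem eq_zero_of_sum_wedge {c : Pairs → ℝ}
    (h : ∑ p : Pairs, c p • wedge 0 (e p.1.1) (e p.1.2) = 0) : c = 0 := by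
  funext ⟨⟨a, b⟩, hab⟩
  have h₁ := congrArg (fun D => ip (block 0 D (e a)) (e b)) h
  simp only [map_sum, map_smul, LinearMap.sum_apply, LinearMap.smul_apply, block_wedge, map_sub,
    LinearMap.sub_apply, ip_e, smul_eq_mul, map_zero, LinearMap.zero_apply] at h₁
  rw [Finset.sum_eq_single ⟨(a, b), hab⟩] at h₁
  · simpa [hab.ne] using h₁
  · rintro ⟨⟨a', b'⟩, h'⟩ - hne
    have h₂ : ¬ (a' = a ∧ b' = b) := fun ⟨h₃, h₄⟩ => hne (by subst h₃ h₄; rfl)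
    have h₃ : ¬ (b' = a ∧ a' = b) := fun ⟨h₃, h₄⟩ => by
      subst h₃ h₄
      exact lt_asymm hab h'
    by_cases h₄ : a' = a <;> by_cases h₅ : b' = b <;> by_cases h₆ : b' = a <;>
      by_cases h₇ : a' = b <;> simp_all
  · simp

/-- Evaluation at the idempotents kills the brackets and returns `u i + v i` and `u i - v i` off the
diagonal and multiples of `m` on it. The brackets are then separated by their matrix in block 0. -/
theorem coprod_injective : Function.Injective (LinearMap.coprod boostMap rotMap) := by
  rw [← LinearMap.ker_eq_bot, LinearMap.ker_eq_bot']
  rintro ⟨⟨u, m⟩, v, c⟩ h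
  rw [LinearMap.coprod_apply, boostMap_apply, rotMap_apply] at h
  have hW : ∑ p : Pairs, c p • wedge 0 (e p.1.1) (e p.1.2) ∈ so8 :=
    so8.sum_mem fun p _ => so8.smul_mem _ (wedge_mem_so8 ..)
  set W := ∑ p : Pairs, c p • wedge 0 (e p.1.1) (e p.1.2) with hWdef
  have h₁ (j : Fin 3) := congrArg (fun D : Module.End ℝ H3 => D (idem j)) h
  simp only [LinearMap.add_apply, hW.2, add_zero, LinearMap.sum_apply, boost_apply, rot_apply,
    LinearMap.zero_apply] at h₁
  have h₂ (i j : Fin 3) := congrArg (od i) (h₁ j)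
  have h₃ (i j : Fin 3) := congrArg (dg i) (h₁ j)
  simp only [map_add, map_sub, map_sum, od_upper, od_lower, od_diagMap, dg_upper, dg_lower,
    dg_diagMap, dg_idem, od_idem, Fin.sum_univ_three, map_zero] at h₂ h₃
  have hu (i : Fin 3) : u i + v i = 0 := by
    have := h₂ i (i + 2)
    fin_cases i <;> simpa using this
  have hw (i : Fin 3) : u i - v i = 0 := by
    have := h₂ i (i + 1)
    fin_cases i <;> simpa [sub_eq_add_neg] using this
  have hu₀ : u = 0 := funext fun i => by
    have h₄ : (2 : ℝ) • u i = 0 := by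
      rw [two_smul]
      calc u i + u i = (u i + v i) + (u i - v i) := by abel
        _ = 0 := by rw [hu, hw, add_zero]
    simpa using h₄
  have hv₀ : v = 0 := funext fun i => by simpa [hu₀] using hu i
  have hm₀ : m = 0 := funext fun i => by
    have h₄ := h₃ 0 0
    have h₅ := h₃ 1 1
    fin_cases i
    · simpa [traceless] using h₄
    · simpa [traceless] using h₅
  have hc : c = 0 := eq_zero_of_sum_wedge (by simpa [hu₀, hv₀, hm₀] using h)
  simp [hu₀, hv₀, hm₀, hc]

theorem boostMap_injective : Function.Injective boostMap := fun x y h => by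
  have := @coprod_injective (x, 0) (y, 0) (by simpa using h)
  simpa using this

theorem rotMap_injective : Function.Injective rotMap := fun x y h => by
  have := @coprod_injective (0, x) (0, y) (by simpa using h)
  simpa using this

theorem finrank_octonion : Module.finrank ℝ Octonion = 8 := by
  rw [Module.finrank_eq_card_basis basis]; rfl

theorem finrank_octonion_pi : Module.finrank ℝ (Fin 3 → Octonion) = 24 := by
  rw [Module.finrank_pi_fintype]
  simp [finrank_octonion]

theorem card_pairs : Fintype.card Pairs = 28 := by decide

theorem finrank_range_boostMap : Module.finrank ℝ (LinearMap.range boostMap) = 26 := by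
  rw [LinearMap.finrank_range_of_inj boostMap_injective]
  simp [finrank_octonion_pi]

theorem finrank_range_rotMap : Module.finrank ℝ (LinearMap.range rotMap) = 52 := by
  rw [LinearMap.finrank_range_of_inj rotMap_injective]
  simp [finrank_octonion_pi, card_pairs]

theorem boost_mem_range (i : Fin 3) (v : Octonion) : boost i v ∈ LinearMap.range boostMap := by
  refine ⟨(Pi.single i v, 0), ?_⟩
  rw [boostMap_apply, map_zero, map_zero, add_zero,
    Finset.sum_eq_single i (fun j _ hj => by simp [hj]) (by simp), Pi.single_eq_same]

theorem rot_mem_range (i : Fin 3) (v : Octonion) : rot i v ∈ LinearMap.range rotMap := by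
  refine ⟨(Pi.single i v, 0), ?_⟩
  rw [rotMap_apply]
  simp only [Pi.zero_apply, zero_smul, Finset.sum_const_zero, add_zero]
  rw [Finset.sum_eq_single i (fun j _ hj => by simp [hj]) (by simp), Pi.single_eq_same]

theorem diagMap_mem_range {m : Fin 3 → ℝ} (hm : ∑ i, m i = 0) :
    diagMap m ∈ LinearMap.range boostMap := by
  refine ⟨(0, ![m 0, m 1]), ?_⟩
  rw [boostMap_apply]
  rw [Fin.sum_univ_three] at hm
  have : traceless ![m 0, m 1] = m := by
    funext i
    fin_cases i <;> simp [traceless]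
    linarith
  simp [this]

theorem so8_le_range : so8 ≤ LinearMap.range rotMap := by
  have h₁ (a b : Fin 8) (hab : a < b) : wedge 0 (e a) (e b) ∈ LinearMap.range rotMap := by
    refine ⟨(0, Pi.single ⟨(a, b), hab⟩ 1), ?_⟩
    rw [rotMap_apply, Finset.sum_eq_single (⟨(a, b), hab⟩ : Pairs)
      (fun j _ hj => by simp [hj]) (by simp)]
    simp
  intro D hD
  rw [so8_eq_sum_wedge hD 0]
  refine Submodule.sum_mem _ fun a _ => Submodule.sum_mem _ fun b _ => Submodule.smul_mem _ _ ?_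
  rcases lt_trichotomy a b with hab | rfl | hab
  · exact h₁ a b hab
  · rw [wedge, lie_self]; exact zero_mem _
  · rw [wedge_swap]; exact neg_mem (h₁ b a hab)

/-- The decomposition of `sub_mem_so8`, with each pair of shears rewritten as half sums and half
differences. -/
theorem exists_boost_add_rot {D : Module.End ℝ H3} (hD : D ∈ e6) :
    ∃ (u v : Fin 3 → Octonion) (m : Fin 3 → ℝ) (W : Module.End ℝ H3), ∑ i, m i = 0 ∧ W ∈ so8 ∧
      D = ∑ i, boost i (u i) + diagMap m + (∑ i, rot i (v i) + W) := by
  refine ⟨fun i => (1 / 2 : ℝ) • (od i (D (idem (i + 2))) + od i (D (idem (i + 1)))),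
    fun i => (1 / 2 : ℝ) • (od i (D (idem (i + 2))) - od i (D (idem (i + 1)))),
    fun i => 1 / 2 * dg i (D (idem i)), _, ?_, sub_mem_so8 hD, ?_⟩
  · rw [← Finset.mul_sum, sum_dg_map_idem hD, mul_zero]
  · simp only [Fin.sum_univ_three, boost, rot, LinearMap.add_apply, LinearMap.sub_apply, map_smul,
      map_add, map_sub]
    module

theorem e6_le {S : Submodule ℝ (Module.End ℝ H3)} (h₁ : ∀ i v, boost i v ∈ S)
    (h₂ : ∀ i v, rot i v ∈ S) (h₃ : so8 ≤ S)
    (h₄ : ∀ m : Fin 3 → ℝ, ∑ i, m i = 0 → diagMap m ∈ S) : e6.toSubmodule ≤ S := by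
  intro D hD
  obtain ⟨u, v, m, W, hm, hW, rfl⟩ := exists_boost_add_rot hD
  exact S.add_mem (S.add_mem (S.sum_mem fun i _ => h₁ _ _) (h₄ _ hm))
    (S.add_mem (S.sum_mem fun i _ => h₂ _ _) (h₃ hW))

/-- Rotations and `so8` lie in `f4`, so the boost part does too. Its image of `off i (u i)` has
trace a positive multiple of the squared norm of `u i`, and its image of `idem i` has trace `2 * m
i`; both vanish. -/
theorem f4_le {S : Submodule ℝ (Module.End ℝ H3)} (h₁ : ∀ i v, rot i v ∈ S) (h₂ : so8 ≤ S) :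
    f4.toSubmodule ≤ S := by
  intro D hD
  obtain ⟨u, v, m, W, hm, hW, rfl⟩ := exists_boost_add_rot (mem_f4_iff.1 hD).1
  have h₃ : ∑ i, rot i (v i) + W ∈ f4 :=
    f4.add_mem (sum_mem fun i _ => rot_mem_f4 i _) (so8_le_f4 hW)
  have h₄ : ∑ i, boost i (u i) + diagMap m ∈ f4 := by
    have := f4.sub_mem hD h₃
    rwa [add_sub_cancel_right] at this
  have h₅ := (mem_f4_iff.1 h₄).2
  have h₆ (i : Fin 3) : u i = 0 := by
    have := h₅ (off i (u i))
    rw [trace_eq] at this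
    simp only [LinearMap.add_apply, LinearMap.sum_apply, Fin.sum_univ_three, boost_apply, map_add,
      dg_upper, dg_lower, dg_diagMap, od_off, dg_off] at this
    rw [← ip_self_eq_zero]
    fin_cases i <;> simp at this ⊢ <;> linarith
  have h₇ : m = 0 := funext fun i => by
    have := h₅ (idem i)
    rw [trace_eq] at this
    simp only [LinearMap.add_apply, LinearMap.sum_apply, Fin.sum_univ_three, boost_apply, map_add,
      dg_upper, dg_lower, dg_diagMap, od_idem, dg_idem] at this
    fin_cases i <;> simpa using this
  simp only [h₆, h₇, map_zero, Finset.sum_const_zero, zero_add]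
  exact S.add_mem (S.sum_mem fun i _ => h₁ _ _) (h₂ hW)

theorem range_boostMap_le : LinearMap.range boostMap ≤ e6.toSubmodule := by
  rintro _ ⟨⟨u, m⟩, rfl⟩
  rw [boostMap_apply]
  refine e6.add_mem (sum_mem fun i _ => boost_mem_e6 i _) (diagMap_mem_e6 ?_)
  simp [Fin.sum_univ_three, traceless]

theorem range_rotMap : LinearMap.range rotMap = f4.toSubmodule := by
  refine le_antisymm ?_ (f4_le rot_mem_range so8_le_range)
  rintro _ ⟨⟨u, c⟩, rfl⟩
  rw [rotMap_apply]
  exact f4.add_mem (sum_mem fun i _ => rot_mem_f4 i _)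
    (sum_mem fun p _ => f4.smul_mem _ (wedge_mem_f4 _ _ _))

theorem f4_le_e6 : f4.toSubmodule ≤ e6.toSubmodule := fun _ h => (mem_f4_iff.1 h).1

theorem range_coprod : LinearMap.range (LinearMap.coprod boostMap rotMap) = e6.toSubmodule := by
  rw [LinearMap.range_coprod]
  refine le_antisymm (sup_le range_boostMap_le (range_rotMap.trans_le f4_le_e6)) (e6_le ?_ ?_ ?_ ?_)
  · exact fun i v => Submodule.mem_sup_left (boost_mem_range i v)
  · exact fun i v => Submodule.mem_sup_right (rot_mem_range i v)
  · exact so8_le_range.trans le_sup_right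
  · exact fun m hm => Submodule.mem_sup_left (diagMap_mem_range hm)

theorem finrank_e6 : Module.finrank ℝ e6 = 78 := by
  change Module.finrank ℝ e6.toSubmodule = 78
  rw [← range_coprod, LinearMap.finrank_range_of_inj coprod_injective]
  simp [finrank_octonion_pi, card_pairs]

theorem finrank_f4 : Module.finrank ℝ f4 = 52 := by
  change Module.finrank ℝ f4.toSubmodule = 52
  rw [← range_rotMap, finrank_range_rotMap]

theorem gen_mem_rotationSpan {τ : Fin 3} {a : SL2Label} (ha : IsRotation a) :
    gen τ a ∈ rotationSpan :=
  Submodule.subset_span ⟨τ, a, ha, isGenerator_iff.2 rfl⟩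

theorem gen_mem_boostSpan {τ : Fin 3} {a : SL2Label} (ha : ¬ IsRotation a) :
    gen τ a ∈ boostSpan :=
  Submodule.subset_span ⟨τ, a, ha, isGenerator_iff.2 rfl⟩

theorem rotationSpan_eq : rotationSpan = f4.toSubmodule := by
  refine le_antisymm (Submodule.span_le.2 ?_) (f4_le (fun i v => ?_)
    (so8_le_of_gen (τ := 0) fun a => gen_mem_rotationSpan trivial))
  · rintro D ⟨τ, a, ha, h⟩
    rw [isGenerator_iff.1 h]
    rcases a with (p | ⟨p, q, h⟩) | (p | _) | a
    · exact f4.smul_mem _ (wedge_mem_f4 _ _ _)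
    · exact f4.smul_mem _ (wedge_mem_f4 _ _ _)
    · rw [gen_yz]; exact f4.smul_mem _ (rot_mem_f4 _ _)
    · rw [gen_zx]; exact f4.smul_mem _ (rot_mem_f4 _ _)
    · exact ha.elim
  · have := rot_mem_of_gen (τ := i + 1) (fun b => gen_mem_rotationSpan (a := .inr (.inl b)) trivial) v
    rwa [fin3_add_one_add_two] at this

theorem boostSpan_eq : boostSpan = LinearMap.range boostMap := by
  refine le_antisymm (Submodule.span_le.2 ?_) ?_
  · rintro D ⟨τ, a, ha, h⟩
    rw [isGenerator_iff.1 h]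
    rcases a with a | a | (_ | p | _)
    · exact (ha trivial).elim
    · exact (ha trivial).elim
    · rw [gen_tx]; exact Submodule.smul_mem _ _ (boost_mem_range ..)
    · rw [gen_ty]; exact Submodule.smul_mem _ _ (boost_mem_range ..)
    · refine diagMap_mem_range ?_
      simp
  · rintro _ ⟨⟨u, m⟩, rfl⟩
    rw [boostMap_apply]
    refine add_mem (sum_mem fun i _ => ?_) (diagMap_mem_of_gen (ρ := 0)
      (fun τ _ => gen_mem_boostSpan id) (by simp [Fin.sum_univ_three, traceless]))
    have := boost_mem_of_gen (τ := i + 1) (gen_mem_boostSpan id)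
      (fun p => gen_mem_boostSpan id) (u i)
    rwa [fin3_add_one_add_two] at this

theorem finrank_boostSpan : Module.finrank ℝ boostSpan = 26 := by
  rw [boostSpan_eq, finrank_range_boostMap]

theorem finrank_rotationSpan : Module.finrank ℝ rotationSpan = 52 := by
  rw [rotationSpan_eq, ← range_rotMap, finrank_range_rotMap]

/-! ### Counting labels, and the basis of 78 generators -/

instance : DecidablePred IsRotation
  | .inl _ => isTrue trivial
  | .inr (.inl _) => isTrue trivial
  | .inr (.inr _) => isFalse id

theorem card_SL2Label : Nat.card SL2Label = 45 := by
  rw [Nat.card_eq_fintype_card]; decide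

theorem card_Label : Nat.card Label = 79 := by
  rw [Nat.card_eq_fintype_card]; decide

theorem card_Label_ne (ρ : Fin 3) : Nat.card {x : Label // x ≠ tzLabel ρ} = 78 := by
  rw [Nat.card_eq_fintype_card]
  revert ρ; decide

theorem card_boost_Label (ρ : Fin 3) :
    Nat.card {x : Label // x ≠ tzLabel ρ ∧ ¬ IsRotation x.toSL2} = 26 := by
  rw [Nat.card_eq_fintype_card]
  revert ρ; decide

theorem card_rotation_Label (ρ : Fin 3) :
    Nat.card {x : Label // x ≠ tzLabel ρ ∧ IsRotation x.toSL2} = 52 := by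
  rw [Nat.card_eq_fintype_card]
  revert ρ; decide

/-- The remaining generators span, and their number is the dimension, so independence is automatic.
-/
theorem exists_basis (σ ρ : Fin 3) : ∃ B : Module.Basis {x : Label // x ≠ tzLabel ρ} ℝ e6,
    ∀ x, IsGenerator (x.1.type σ) x.1.toSL2 (B x : Module.End ℝ H3) := by
  let b (x : {x : Label // x ≠ tzLabel ρ}) : e6 :=
    ⟨gen (x.1.type σ) x.1.toSL2, gen_mem_e6 _ _⟩
  let S := (Submodule.span ℝ (Set.range b)).map e6.toSubmodule.subtype
  have hb (x : Label) (hx : x ≠ tzLabel ρ) : gen (x.type σ) x.toSL2 ∈ S :=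
    ⟨b ⟨x, hx⟩, Submodule.subset_span ⟨_, rfl⟩, rfl⟩
  have hS : e6.toSubmodule ≤ S := by
    refine e6_le (fun i v => ?_) (fun i v => ?_) ?_ fun m hm => ?_
    · have := boost_mem_of_gen (S := S) (τ := i + 1)
        (hb (.inr (.inr (i + 1, .tx))) (by simp [tzLabel]))
        (fun p => hb (.inr (.inr (i + 1, .ty p))) (by simp [tzLabel])) v
      rwa [fin3_add_one_add_two] at this
    · have := rot_mem_of_gen (S := S) (τ := i + 1)
        (fun b => hb (.inr (.inl (i + 1, b))) (by simp [tzLabel])) v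
      rwa [fin3_add_one_add_two] at this
    · exact so8_le_of_gen (τ := σ) fun a => hb (.inl a) (by simp [tzLabel])
    · exact diagMap_mem_of_gen (ρ := ρ)
        (fun τ hτ => hb (.inr (.inr (τ, .tz))) (by simpa [tzLabel] using hτ)) hm
  have hspan : ⊤ ≤ Submodule.span ℝ (Set.range b) := by
    rintro ⟨D, hD⟩ -
    obtain ⟨D', hD', rfl⟩ := hS hD
    exact hD'
  have hcard : Fintype.card {x : Label // x ≠ tzLabel ρ} = Module.finrank ℝ e6 := by
    rw [finrank_e6, ← Nat.card_eq_fintype_card, card_Label_ne]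
  refine ⟨basisOfTopLeSpanOfCardEqFinrank b hspan hcard, fun x => ?_⟩
  rw [coe_basisOfTopLeSpanOfCardEqFinrank]
  exact isGenerator_iff.2 rfl

/-! ### The Killing form -/

/-- A positive definite symmetric bilinear form on a finite-dimensional space. -/
structure IsInner {W : Type*} [AddCommGroup W] [Module ℝ W] (β : LinearMap.BilinForm ℝ W) :
    Prop where
  comm : ∀ x y, β x y = β y x
  nonneg : ∀ x, 0 ≤ β x x
  eq_zero : ∀ x, β x x = 0 → x = 0

namespace IsInner

variable {W : Type*} [AddCommGroup W] [Module ℝ W] {β : LinearMap.BilinForm ℝ W}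

theorem pos (h : IsInner β) {x : W} (hx : x ≠ 0) : 0 < β x x :=
  (h.nonneg x).lt_of_ne fun h₀ => hx (h.eq_zero x h₀.symm)

theorem exists_basis [FiniteDimensional ℝ W] (h : IsInner β) :
    ∃ v : Module.Basis (Fin (Module.finrank ℝ W)) ℝ W, (∀ i j, i ≠ j → β (v i) (v j) = 0) ∧
      ∀ i, 0 < β (v i) (v i) := by
  obtain ⟨v, hv⟩ := LinearMap.BilinForm.exists_orthogonal_basis (B := β) ⟨fun x y => h.comm x y⟩
  exact ⟨v, fun i j hij => hv hij, fun i => h.pos (v.ne_zero i)⟩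

variable {n : ℕ} {v : Module.Basis (Fin n) ℝ W}

theorem repr_eq (hv : ∀ i j, i ≠ j → β (v i) (v j) = 0) (hp : ∀ i, 0 < β (v i) (v i)) (x : W)
    (i : Fin n) : v.repr x i = β x (v i) / β (v i) (v i) := by
  rw [eq_div_iff (hp i).ne']
  conv_rhs => rw [← v.sum_repr x]
  rw [map_sum, LinearMap.sum_apply, Finset.sum_eq_single i]
  · simp
  · intro j _ hj
    simp [hv j i hj]
  · simp

theorem trace_mul (hv : ∀ i j, i ≠ j → β (v i) (v j) = 0) (hp : ∀ i, 0 < β (v i) (v i)) {s : ℝ}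
    {S : Module.End ℝ W} (hS : ∀ x y, β (S x) y = s * β x (S y)) (T : Module.End ℝ W) :
    LinearMap.trace ℝ W (S * T) = s * ∑ i, β (T (v i)) (S (v i)) / β (v i) (v i) := by
  rw [LinearMap.trace_eq_matrix_trace ℝ v, Matrix.trace, Finset.mul_sum]
  refine Finset.sum_congr rfl fun i _ => ?_
  rw [Matrix.diag_apply, LinearMap.toMatrix_apply, repr_eq hv hp, Module.End.mul_apply, hS,
    mul_div_assoc]

/-- For a symmetric or skew map, S² is s times the product of the adjoint of S with S, whose trace
is the sum of squared lengths of the images of an orthonormal basis. The basis here is only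
orthogonal, hence the denominators. -/
theorem trace_mul_self_pos [FiniteDimensional ℝ W] (h : IsInner β) {s : ℝ} (hs : s * s = 1)
    {S : Module.End ℝ W} (hS : ∀ x y, β (S x) y = s * β x (S y)) (h₀ : S ≠ 0) :
    0 < s * LinearMap.trace ℝ W (S * S) := by
  obtain ⟨v, hv, hp⟩ := h.exists_basis
  rw [trace_mul hv hp hS, ← mul_assoc, hs, one_mul]
  obtain ⟨i, hi⟩ : ∃ i, S (v i) ≠ 0 := by
    by_contra! h₁
    exact h₀ (v.ext fun i => by simp [h₁])
  exact Finset.sum_pos' (fun j _ => div_nonneg (h.nonneg _) (hp j).le)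
    ⟨i, Finset.mem_univ _, div_pos (h.pos hi) (hp i)⟩

theorem trace_mul_eq_zero [FiniteDimensional ℝ W] (h : IsInner β) {S T : Module.End ℝ W}
    (hS : ∀ x y, β (S x) y = 1 * β x (S y)) (hT : ∀ x y, β (T x) y = -1 * β x (T y)) :
    LinearMap.trace ℝ W (S * T) = 0 := by
  obtain ⟨v, hv, hp⟩ := h.exists_basis
  have h₁ := trace_mul hv hp hS T
  have h₂ := trace_mul hv hp hT S
  rw [LinearMap.trace_mul_comm] at h₂
  simp only [h.comm (S _)] at h₂
  linarith

/-- The inner product of endomorphisms. -/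
theorem exists_end [FiniteDimensional ℝ W] (h : IsInner β) :
    ∃ γ : LinearMap.BilinForm ℝ (Module.End ℝ W), IsInner γ ∧
      ∀ (s : ℝ) (D : Module.End ℝ W), (∀ x y, β (D x) y = s * β x (D y)) →
        ∀ A B, γ ⁅D, A⁆ B = s * γ A ⁅D, B⁆ := by
  obtain ⟨v, hv, hp⟩ := h.exists_basis
  -- The Hilbert-Schmidt form, written with an orthogonal, not normalized, basis.
  let γ : LinearMap.BilinForm ℝ (Module.End ℝ W) :=
    ∑ i, (β (v i) (v i))⁻¹ • β.compl₁₂ (LinearMap.applyₗ (v i)) (LinearMap.applyₗ (v i))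
  have hγ (A B : Module.End ℝ W) :
      γ A B = ∑ i, (β (v i) (v i))⁻¹ * β (A (v i)) (B (v i)) := by
    simp [γ, LinearMap.sum_apply]
  refine ⟨γ, ⟨fun A B => ?_, fun A => ?_, fun A hA => ?_⟩, fun s D hD A B => ?_⟩
  · simp only [hγ, h.comm]
  · rw [hγ]
    exact Finset.sum_nonneg fun i _ => mul_nonneg (inv_nonneg.2 (hp i).le) (h.nonneg _)
  · rw [hγ, Finset.sum_eq_zero_iff_of_nonneg fun i _ =>
      mul_nonneg (inv_nonneg.2 (hp i).le) (h.nonneg _)] at hA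
    refine v.ext fun i => h.eq_zero _ ?_
    exact (mul_eq_zero.1 (hA i (Finset.mem_univ i))).resolve_left (inv_ne_zero (hp i).ne')
  · have h₁ (i) : D (v i) = ∑ j, (β (D (v i)) (v j) / β (v j) (v j)) • v j := by
      conv_lhs => rw [← v.sum_repr (D (v i))]
      simp only [repr_eq hv hp]
    have h₂ (A B : Module.End ℝ W) : ∑ i, (β (v i) (v i))⁻¹ * β (A (D (v i))) (B (v i)) =
        ∑ i, ∑ j, (β (v i) (v i))⁻¹ * (β (v j) (v j))⁻¹ * β (D (v i)) (v j)
          * β (A (v j)) (B (v i)) := by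
      refine Finset.sum_congr rfl fun i _ => ?_
      have h₃ : A (D (v i)) = ∑ j, (β (D (v i)) (v j) / β (v j) (v j)) • A (v j) := by
        conv_lhs => rw [h₁ i, map_sum]
        simp only [map_smul]
      rw [h₃]
      simp only [map_sum, map_smul, LinearMap.sum_apply, LinearMap.smul_apply, smul_eq_mul,
        Finset.mul_sum]
      exact Finset.sum_congr rfl fun j _ => by ring
    -- Right multiplication by `D` has the same adjoint behaviour as left multiplication: expand `D
    -- (v i)` in the basis and exchange the two summation indices.
    have h₃ : ∑ i, (β (v i) (v i))⁻¹ * β (A (D (v i))) (B (v i)) =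
        s * ∑ i, (β (v i) (v i))⁻¹ * β (A (v i)) (B (D (v i))) := by
      have h₄ := h₂ B A
      simp only [h.comm (B _)] at h₄
      rw [h₂ A B, h₄, Finset.sum_comm, Finset.mul_sum]
      refine Finset.sum_congr rfl fun i _ => ?_
      rw [Finset.mul_sum]
      refine Finset.sum_congr rfl fun j _ => ?_
      rw [hD, h.comm (v j) (D _)]
      ring
    simp only [hγ, LieRing.of_associative_ring_bracket, LinearMap.sub_apply, Module.End.mul_apply,
      map_sub, mul_sub, Finset.sum_sub_distrib, hD, h₃]
    simp only [Finset.mul_sum]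
    congr 1
    exact Finset.sum_congr rfl fun i _ => by ring

end IsInner

section

variable {W : Type*} [AddCommGroup W] [Module ℝ W] [FiniteDimensional ℝ W]
  {β : LinearMap.BilinForm ℝ W} {L : LieSubalgebra ℝ (Module.End ℝ W)}

theorem IsInner.exists_lie (h : IsInner β) (L : LieSubalgebra ℝ (Module.End ℝ W)) :
    ∃ γ : LinearMap.BilinForm ℝ L, IsInner γ ∧
      ∀ (s : ℝ) (D : L), (∀ x y, β (D.1 x) y = s * β x (D.1 y)) →
        ∀ A B, γ (LieAlgebra.ad ℝ L D A) B = s * γ A (LieAlgebra.ad ℝ L D B) := by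
  obtain ⟨γ, hγ, hs⟩ := h.exists_end
  exact ⟨γ.restrict L.toSubmodule, ⟨fun x y => hγ.comm _ _, fun x => hγ.nonneg _,
    fun x hx => Subtype.ext (hγ.eq_zero _ hx)⟩, fun s D hD A B => hs s D.1 hD A.1 B.1⟩

/-- The Hilbert-Schmidt form restricts to `L`, and ad D inherits the symmetry or skewness of D; the
Killing form is tr(ad D ²), nonzero as soon as ad D is. -/
theorem killingForm_pos (h : IsInner β) {s : ℝ} (hs : s * s = 1) {D : L}
    (hD : ∀ x y, β (D.1 x) y = s * β x (D.1 y)) (h₀ : ∃ A : L, ⁅D, A⁆ ≠ 0) :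
    0 < s * killingForm ℝ L D D := by
  obtain ⟨γ, hγ, hs'⟩ := h.exists_lie L
  rw [killingForm_apply_apply]
  obtain ⟨A, hA⟩ := h₀
  exact hγ.trace_mul_self_pos hs (hs' s D hD) fun h₁ => hA (LinearMap.congr_fun h₁ A)

theorem killingForm_eq_zero (h : IsInner β) {S K : L}
    (hS : ∀ x y, β (S.1 x) y = 1 * β x (S.1 y)) (hK : ∀ x y, β (K.1 x) y = -1 * β x (K.1 y)) :
    killingForm ℝ L S K = 0 := by
  obtain ⟨γ, hγ, hs'⟩ := h.exists_lie L
  rw [killingForm_apply_apply]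
  exact hγ.trace_mul_eq_zero (hs' _ _ hS) (hs' _ _ hK)

end

/-! ### Non-degeneracy of the Killing form of a complexification -/

theorem exists_eq_tmul_add {L : Type} [AddCommGroup L] [Module ℝ L] (z : ℂ ⊗[ℝ] L) :
    ∃ x y : L, z = (1 : ℂ) ⊗ₜ[ℝ] x + Complex.I ⊗ₜ[ℝ] y := by
  induction z with
  | zero => exact ⟨0, 0, by simp⟩
  | tmul c x =>
    refine ⟨c.re • x, c.im • x, ?_⟩
    rw [TensorProduct.tmul_smul, TensorProduct.tmul_smul, TensorProduct.smul_tmul',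
      TensorProduct.smul_tmul', ← TensorProduct.add_tmul]
    congr 1
    simp
  | add z w hz hw =>
    obtain ⟨x, y, rfl⟩ := hz
    obtain ⟨x', y', rfl⟩ := hw
    exact ⟨x + x', y + y', by simp only [TensorProduct.tmul_add]; abel⟩

theorem isKilling_complex {L : Type} [LieRing L] [LieAlgebra ℝ L] [FiniteDimensional ℝ L]
    (h : ∀ x : L, (∀ y, killingForm ℝ L x y = 0) → x = 0) :
    LieAlgebra.IsKilling ℂ (ℂ ⊗[ℝ] L) where
  killingCompl_top_eq_bot := by
    rw [LieSubmodule.eq_bot_iff]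
    intro z hz
    rw [LieIdeal.mem_killingCompl] at hz
    obtain ⟨x, y, rfl⟩ := exists_eq_tmul_add z
    have h₁ (w : L) : killingForm ℝ L w x = 0 ∧ killingForm ℝ L w y = 0 := by
      have := hz (1 ⊗ₜ w) trivial
      rw [killingForm, LieModule.traceForm_baseChange] at this
      simp only [map_add, LinearMap.BilinForm.baseChange_tmul, one_mul] at this
      have h₁ := congrArg Complex.re this
      have h₂ := congrArg Complex.im this
      simp at h₁ h₂
      exact ⟨h₁, h₂⟩
    have hx : x = 0 := h x fun w => by
      rw [killingForm, LieModule.traceForm_comm]; exact (h₁ w).1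
    have hy : y = 0 := h y fun w => by
      rw [killingForm, LieModule.traceForm_comm]; exact (h₁ w).2
    simp [hx, hy]

/-! ### The Killing forms of `e6` and `f4` -/

/-- The trace form `tr (X ∘ Y)`. -/
def jordanForm : LinearMap.BilinForm ℝ H3 := jordan.compr₂ trace

theorem jordanForm_apply (X Y : H3) : jordanForm X Y = trace (jordan X Y) := rfl

theorem isInner_jordanForm : IsInner jordanForm where
  comm X Y := by rw [jordanForm_apply, jordan_comm]; rfl
  nonneg X := by
    rw [jordanForm_apply, trace_jordan]
    exact Finset.sum_nonneg fun i _ => add_nonneg (mul_self_nonneg _)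
      (mul_nonneg zero_le_two (ip_self_nonneg _))
  eq_zero X hX := trace_jordan_self_eq_zero hX

theorem jordanForm_skew {D : Module.End ℝ H3} (hD : D ∈ f4) (X Y : H3) :
    jordanForm (D X) Y = -1 * jordanForm X (D Y) := by
  have h := trace_eq_zero_of_mem_f4 hD (jordan X Y)
  rw [hD, map_add] at h
  simp only [jordanForm_apply]
  linarith

/-- The two shears of an index are adjoint to each other, so their sum is symmetric and their
difference skew. -/
theorem jordanForm_upper (i : Fin 3) (v : Octonion) (X Y : H3) :
    jordanForm (upper i v X) Y = jordanForm X (lower i v Y) := by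
  have h₁ (x y : Octonion) : ip (star (v * x)) y = ip x (star (y * v)) := by
    rw [ip_star_left, ip_star_right, re_mul_cycle, re_mul_cycle]
  simp only [jordanForm_apply, trace_jordan]
  fin_cases i <;> simp [dg_upper, od_upper, dg_lower, od_lower, Fin.sum_univ_three, -star_mul, h₁,
    ip_comm _ v] <;> ring

theorem jordanForm_symm {D : Module.End ℝ H3} (hD : D ∈ boostSpan) (X Y : H3) :
    jordanForm (D X) Y = 1 * jordanForm X (D Y) := by
  rw [boostSpan_eq] at hD
  obtain ⟨⟨u, m⟩, rfl⟩ := hD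
  have h₁ (i : Fin 3) (v : Octonion) (X Y : H3) :
      jordanForm (lower i v X) Y = jordanForm X (upper i v Y) := by
    rw [isInner_jordanForm.comm, ← jordanForm_upper, isInner_jordanForm.comm]
  have h₂ (m : Fin 3 → ℝ) (X Y : H3) : jordanForm (diagMap m X) Y = jordanForm X (diagMap m Y) := by
    simp only [jordanForm_apply, trace_jordan, dg_diagMap, od_diagMap, map_smul,
      LinearMap.smul_apply, smul_eq_mul]
    exact Finset.sum_congr rfl fun i _ => by ring
  simp only [boostMap_apply, Fin.sum_univ_three, LinearMap.add_apply, map_add, boost_apply, h₁, h₂,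
    jordanForm_upper]
  ring

/-- The element that fails to commute can be taken among the rotations, so one argument shows that
both `e6` and `f4` have trivial centre. -/
theorem lie_rot_ne_zero {D : Module.End ℝ H3} (hD : D ∈ e6) (h₀ : D ≠ 0) :
    ∃ i v, ⁅D, rot i v⁆ ≠ 0 := by
  by_contra! h
  refine h₀ (eq_zero_of_commute_rot hD fun i v X => ?_)
  have := LinearMap.congr_fun (h i v) X
  rw [LieRing.of_associative_ring_bracket] at this
  exact sub_eq_zero.1 this

theorem exists_lie_ne_zero {L : LieSubalgebra ℝ (Module.End ℝ H3)} (hL : L ≤ e6) (hf : f4 ≤ L)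
    {D : L} (h₀ : D ≠ 0) : ∃ A : L, ⁅D, A⁆ ≠ 0 := by
  obtain ⟨i, v, h⟩ := lie_rot_ne_zero (hL D.2) fun h => h₀ (Subtype.ext h)
  exact ⟨⟨rot i v, hf (rot_mem_f4 _ _)⟩, fun h' => h (congrArg Subtype.val h')⟩

theorem killingForm_pos_of_mem_boostSpan (D : e6) (h₀ : D ≠ 0)
    (hD : (D : Module.End ℝ H3) ∈ boostSpan) : 0 < killingForm ℝ e6 D D := by
  have := killingForm_pos isInner_jordanForm (one_mul 1) (jordanForm_symm hD)
    (exists_lie_ne_zero le_rfl f4_le_e6 h₀)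
  rwa [one_mul] at this

theorem killingForm_neg_of_mem_f4 {L : LieSubalgebra ℝ (Module.End ℝ H3)} (hL : L ≤ e6)
    (hf : f4 ≤ L) {D : L} (h₀ : D ≠ 0) (hD : D.1 ∈ f4) : killingForm ℝ L D D < 0 := by
  have := killingForm_pos isInner_jordanForm (s := -1) (by norm_num) (jordanForm_skew hD)
    (exists_lie_ne_zero hL hf h₀)
  linarith

theorem killingForm_neg_of_mem_rotationSpan (D : e6) (h₀ : D ≠ 0)
    (hD : (D : Module.End ℝ H3) ∈ rotationSpan) : killingForm ℝ e6 D D < 0 := by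
  rw [rotationSpan_eq] at hD
  exact killingForm_neg_of_mem_f4 le_rfl f4_le_e6 h₀ hD

theorem boostSpan_le : boostSpan ≤ e6.toSubmodule := boostSpan_eq.trans_le range_boostMap_le

/-- Boosts and rotations are orthogonal, being symmetric and skew, and the form is definite on each.
-/
theorem eq_zero_of_killingForm_e6 (D : e6) (h : ∀ A, killingForm ℝ e6 D A = 0) : D = 0 := by
  have hD : D.1 ∈ LinearMap.range (LinearMap.coprod boostMap rotMap) := by
    rw [range_coprod]; exact D.2
  obtain ⟨⟨x, y⟩, hxy⟩ := hD
  rw [LinearMap.coprod_apply] at hxy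
  have hx : boostMap x ∈ boostSpan := by rw [boostSpan_eq]; exact ⟨x, rfl⟩
  have hy : rotMap y ∈ f4 := by
    rw [← LieSubalgebra.mem_toSubmodule, ← range_rotMap]; exact ⟨y, rfl⟩
  let S : e6 := ⟨boostMap x, boostSpan_le hx⟩
  let K : e6 := ⟨rotMap y, f4_le_e6 hy⟩
  have hSK : D = S + K := Subtype.ext hxy.symm
  have h₁ : killingForm ℝ e6 S K = 0 :=
    killingForm_eq_zero isInner_jordanForm (jordanForm_symm hx) (jordanForm_skew hy)
  have h₂ : killingForm ℝ e6 K S = 0 := by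
    rw [killingForm, LieModule.traceForm_comm]; exact h₁
  have hS : S = 0 := by
    by_contra h₀
    have h₃ := killingForm_pos_of_mem_boostSpan S h₀ hx
    have h₄ := h S
    rw [hSK, map_add, LinearMap.add_apply, h₂] at h₄
    linarith
  have hK : K = 0 := by
    by_contra h₀
    have h₃ := killingForm_neg_of_mem_f4 le_rfl f4_le_e6 h₀ hy
    have h₄ := h K
    rw [hSK, map_add, LinearMap.add_apply, h₁] at h₄
    linarith
  rw [hSK, hS, hK, add_zero]

theorem killingForm_f4_neg (D : f4) (h₀ : D ≠ 0) : killingForm ℝ f4 D D < 0 :=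
  killingForm_neg_of_mem_f4 f4_le_e6 le_rfl h₀ D.2

theorem eq_zero_of_killingForm_f4 (D : f4) (h : ∀ A, killingForm ℝ f4 D A = 0) : D = 0 := by
  by_contra h₀
  exact (killingForm_f4_neg D h₀).ne (h D)

instance : LieAlgebra.IsKilling ℂ (ℂ ⊗[ℝ] e6) := isKilling_complex eq_zero_of_killingForm_e6

instance : LieAlgebra.IsKilling ℂ (ℂ ⊗[ℝ] f4) := isKilling_complex eq_zero_of_killingForm_f4

theorem finrank_comap_e6 {S : Submodule ℝ (Module.End ℝ H3)} (hS : S ≤ e6.toSubmodule) :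
    Module.finrank ℝ (S.comap e6.toSubmodule.subtype) = Module.finrank ℝ S :=
  (Submodule.comapSubtypeEquivOfLe hS).finrank_eq

/-- The definite subspaces give lower bounds for both indices, and these already add up to the
dimension 78. -/
theorem signature_e6 : sigPos (killingQuadratic e6) = 26 ∧ sigNeg (killingQuadratic e6) = 52 := by
  have hr : rotationSpan ≤ e6.toSubmodule := rotationSpan_eq.trans_le f4_le_e6
  have h₁ : 26 ≤ sigPos (killingQuadratic e6) := by
    rw [← finrank_boostSpan, ← finrank_comap_e6 boostSpan_le]
    exact le_sigPos_of_posDef _ fun D hD =>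
      killingForm_pos_of_mem_boostSpan D.1 (fun h => hD (Subtype.ext h)) D.2
  have h₂ : 52 ≤ sigNeg (killingQuadratic e6) := by
    rw [← finrank_rotationSpan, ← finrank_comap_e6 hr]
    exact le_sigNeg_of_negDef _ fun D hD => neg_pos.2 <|
      killingForm_neg_of_mem_rotationSpan D.1 (fun h => hD (Subtype.ext h)) D.2
  have h₃ := QuadraticForm.sigPos_add_sigNeg_add_radical (Q := killingQuadratic e6)
  rw [finrank_e6] at h₃
  omega

section recognition

open LieAlgebra LieAlgebra.IsKilling LieModule

/-! ### Recognition of the Cartan matrix of a complex Lie algebra -/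

/-- A basis of a complex Lie algebra that consists of commuting elements and of simultaneous
eigenvectors for these with integral and nonzero weights. -/
structure WeightBasis (κ R L : Type) [LieRing L] [LieAlgebra ℂ L] where
  basis : Module.Basis (κ ⊕ R) ℂ L
  wt : R → κ → ℤ
  lie_h_h : ∀ k l, ⁅basis (.inl k), basis (.inl l)⁆ = 0
  lie_h_x : ∀ k r, ⁅basis (.inl k), basis (.inr r)⁆ = (wt r k : ℂ) • basis (.inr r)
  wt_ne_zero : ∀ r, wt r ≠ 0

namespace WeightBasis

set_option linter.unusedSectionVars false

variable {κ R L : Type} [Fintype κ] [Fintype R] [DecidableEq κ] [DecidableEq R] [LieRing L]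
  [LieAlgebra ℂ L] (b : WeightBasis κ R L)

/-- The coordinates of the span of the commuting elements. -/
def coeff (k : κ) : L →ₗ[ℂ] ℂ := b.basis.coord (.inl k)

theorem eq_sum {y : L} (hy : ∀ r, b.basis.repr y (.inr r) = 0) :
    y = ∑ k, b.coeff k y • b.basis (.inl k) := by
  conv_lhs => rw [← b.basis.sum_repr y, Fintype.sum_sum_type]
  simp [hy, coeff]

theorem lie_eq_zero {y z : L} (hy : ∀ r, b.basis.repr y (.inr r) = 0)
    (hz : ∀ r, b.basis.repr z (.inr r) = 0) : ⁅y, z⁆ = 0 := by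
  rw [b.eq_sum hy, b.eq_sum hz]
  simp only [sum_lie, lie_sum, smul_lie, lie_smul, b.lie_h_h,
    smul_zero, Finset.sum_const_zero]

/-- The span of the commuting elements. -/
def cartan : LieSubalgebra ℂ L where
  carrier := {y | ∀ r, b.basis.repr y (.inr r) = 0}
  add_mem' {y z} hy hz r := by simp [hy r, hz r]
  zero_mem' r := by simp
  smul_mem' c y hy r := by simp [hy r]
  lie_mem' {y z} hy hz r := by rw [b.lie_eq_zero hy hz]; simp

theorem inl_mem (k : κ) : b.basis (.inl k) ∈ b.cartan := fun r => by simp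

/-- The commuting basis elements. -/
def h (k : κ) : b.cartan := ⟨b.basis (.inl k), b.inl_mem k⟩

/-- The roots. -/
def root (r : R) : b.cartan →ₗ[ℂ] ℂ :=
  ∑ k, (b.wt r k : ℂ) • (b.coeff k ∘ₗ b.cartan.toSubmodule.subtype)

theorem root_apply (r : R) (y : b.cartan) : b.root r y = ∑ k, (b.wt r k : ℂ) * b.coeff k y := by
  simp [root]
  rfl

theorem root_h (r : R) (k : κ) : b.root r (b.h k) = b.wt r k := by
  rw [root_apply, Finset.sum_eq_single k]
  · simp [h, coeff]
  · intro l _ hl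
    simp [h, coeff, hl.symm]
  · simp

theorem eq_sum_h (y : b.cartan) : y = ∑ k, b.coeff k y • b.h k := by
  apply Subtype.ext
  conv_lhs => rw [b.eq_sum y.2]
  simp [h]

theorem lie_inr (y : b.cartan) (r : R) :
    ⁅(y : L), b.basis (.inr r)⁆ = b.root r y • b.basis (.inr r) := by
  rw [b.eq_sum y.2, sum_lie, root_apply, Finset.sum_smul]
  refine Finset.sum_congr rfl fun k _ => ?_
  rw [smul_lie, b.lie_h_x, smul_smul, mul_comm]

theorem lie_inl (y : b.cartan) (k : κ) : ⁅(y : L), b.basis (.inl k)⁆ = 0 :=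
  b.lie_eq_zero y.2 (b.inl_mem k)

theorem repr_lie (y : b.cartan) (z : L) (r : R) :
    b.basis.repr ⁅(y : L), z⁆ (.inr r) = b.root r y * b.basis.repr z (.inr r) := by
  conv_lhs => rw [← b.basis.sum_repr z, Fintype.sum_sum_type]
  simp only [lie_add, lie_sum, lie_smul, lie_inl, lie_inr, smul_zero, Finset.sum_const_zero,
    zero_add, map_sum, map_smul, Module.Basis.repr_self, Finsupp.coe_finsetSum, Finset.sum_apply,
    Finsupp.smul_apply, smul_eq_mul, Finsupp.single_apply]
  simp [mul_comm]

theorem root_ne_zero (r : R) : b.root r ≠ 0 := fun h₀ => b.wt_ne_zero r <| funext fun k => by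
  have := b.root_h r k
  rw [h₀, LinearMap.zero_apply] at this
  exact_mod_cast this.symm

/-- It is abelian, and self-normalizing because a component along a root vector is multiplied by a
nonzero weight of some commuting basis element. -/
instance : b.cartan.IsCartanSubalgebra where
  nilpotent := by
    have : IsLieAbelian b.cartan := ⟨fun y z => Subtype.ext (b.lie_eq_zero y.2 z.2)⟩
    infer_instance
  self_normalizing := by
    refine le_antisymm (fun z hz r => ?_) b.cartan.le_normalizer
    obtain ⟨k, hk⟩ := Function.ne_iff.1 (b.wt_ne_zero r)
    have h₁ := (b.cartan.mem_normalizer_iff' z).1 hz _ (b.inl_mem k) r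
    have h₂ := b.repr_lie (b.h k) z r
    rw [root_h] at h₂
    rw [h] at h₂
    rw [h₂] at h₁
    exact (mul_eq_zero.1 h₁).resolve_left (by exact_mod_cast hk)

theorem inr_mem_rootSpace (r : R) : b.basis (.inr r) ∈ rootSpace b.cartan (b.root r) :=
  (mem_genWeightSpace _ _ _).mpr fun y => ⟨1, by simp [b.lie_inr]⟩

variable [FiniteDimensional ℂ L]

/-- The roots as weights. -/
def weight (r : R) : b.cartan.root := by
  refine ⟨⟨b.root r, fun h₀ => ?_⟩, ?_⟩
  · have : b.basis (.inr r) ∈ genWeightSpace L (b.root r) := b.inr_mem_rootSpace r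
    rw [h₀, LieSubmodule.mem_bot] at this
    exact b.basis.ne_zero _ this
  · simpa [Weight.IsNonZero, Weight.IsZero] using b.root_ne_zero r

variable [IsKilling ℂ L]

/-- A weight vector with a nonzero component along some root vector shares its weight; one without
such a component lies in the Cartan subalgebra and has weight zero. -/
theorem weight_surjective (β : b.cartan.root) : ∃ r, β = b.weight r := by
  have h₀ := β.1.genWeightSpace_ne_bot
  rw [ne_eq, LieSubmodule.eq_bot_iff] at h₀
  push Not at h₀
  obtain ⟨v, hv, hv₀⟩ := h₀
  have h₁ (y : b.cartan) : ⁅(y : L), v⁆ = β.1 y • v := lie_eq_smul_of_mem_rootSpace hv y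
  by_cases h₂ : ∃ r, b.basis.repr v (.inr r) ≠ 0
  · obtain ⟨r, hr⟩ := h₂
    refine ⟨r, Subtype.ext (Weight.ext fun y => ?_)⟩
    have := b.repr_lie y v r
    rw [h₁, map_smul, Finsupp.smul_apply, smul_eq_mul] at this
    exact mul_right_cancel₀ hr this
  · push Not at h₂
    refine absurd ?_ (b.cartan.isNonZero_coe_root β)
    refine funext fun y => ?_
    have := h₁ y
    rw [b.lie_eq_zero y.2 h₂] at this
    exact (smul_eq_zero.1 this.symm).resolve_right hv₀

theorem traceForm_apply (y z : b.cartan) :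
    traceForm ℂ b.cartan L y z = ∑ r, b.root r y * b.root r z := by
  rw [traceForm_apply_apply, LinearMap.trace_eq_matrix_trace ℂ b.basis, Matrix.trace,
    Fintype.sum_sum_type]
  simp only [Matrix.diag_apply, LinearMap.toMatrix_apply, LinearMap.comp_apply,
    toEnd_apply_apply, LieSubalgebra.coe_bracket_of_module, lie_inl, lie_inr, lie_smul, lie_zero,
    map_smul, map_zero, Finsupp.zero_apply, Finset.sum_const_zero, zero_add, Finsupp.smul_apply,
    Module.Basis.repr_self, Finsupp.single_eq_same, smul_eq_mul, mul_one]
  exact Finset.sum_congr rfl fun r _ => mul_comm _ _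

/-- The hypothesis `hc` says that the commuting basis elements are orthogonal for the Killing form
with squares `c k`, so roots are dualized coordinate by coordinate. -/
theorem cartanEquivDual_symm_root {c : κ → ℤ}
    (hc : ∀ k l, ∑ r, b.wt r k * b.wt r l = if k = l then c k else 0) (hc₀ : ∀ k, c k ≠ 0)
    (r : R) :
    (cartanEquivDual b.cartan).symm (b.root r) = ∑ k, ((b.wt r k : ℂ) / c k) • b.h k := by
  rw [LinearEquiv.symm_apply_eq]
  ext y
  change _ = traceForm ℂ b.cartan L _ _
  rw [traceForm_apply]
  simp only [map_sum, map_smul, root_h, smul_eq_mul]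
  rw [b.eq_sum_h y]
  simp only [map_sum, map_smul, root_h, smul_eq_mul, Finset.sum_mul_sum]
  rw [Finset.sum_comm]
  refine Finset.sum_congr rfl fun k _ => ?_
  have h₁ (l : κ) : (∑ s, (b.wt s k : ℂ) * b.wt s l) = if k = l then (c k : ℂ) else 0 := by
    have := congrArg (Int.cast : ℤ → ℂ) (hc k l)
    push_cast at this
    exact this
  have h₂ : (c k : ℂ) ≠ 0 := by exact_mod_cast hc₀ k
  have h₃ : ∑ l, (b.wt r k : ℂ) / c k * b.coeff l y * ∑ s, (b.wt s k : ℂ) * b.wt s l =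
      b.coeff k y * b.wt r k := by
    simp only [h₁, mul_ite, mul_zero, Finset.sum_ite_eq, Finset.mem_univ, if_true]
    field_simp
  rw [← h₃, Finset.sum_comm]
  refine Finset.sum_congr rfl fun l _ => ?_
  rw [Finset.mul_sum]
  exact Finset.sum_congr rfl fun s _ => by ring

/-- This is the usual quotient 2(s, r)/(r, r) with denominators cleared: `g k` is `N / c k`, so the
form on the dual is integral up to the factor `N`. -/
theorem root_coroot {c : κ → ℤ}
    (hc : ∀ k l, ∑ r, b.wt r k * b.wt r l = if k = l then c k else 0) (hc₀ : ∀ k, c k ≠ 0)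
    (r s : R) {g : κ → ℤ} {N : ℤ} (hg : ∀ k, c k * g k = N) (hN : N ≠ 0) :
    b.root s (coroot (b.weight r).1) * ∑ k, (g k * b.wt r k * b.wt r k : ℂ) =
      2 * ∑ k, (g k * b.wt s k * b.wt r k : ℂ) := by
  have h₁ (k : κ) : (1 : ℂ) / c k = g k / N := by
    have h₂ : (c k : ℂ) ≠ 0 := by exact_mod_cast hc₀ k
    have h₃ : (N : ℂ) ≠ 0 := by exact_mod_cast hN
    have h₄ : (c k : ℂ) * g k = N := by exact_mod_cast hg k
    rw [div_eq_div_iff h₂ h₃, ← h₄]; ring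
  have h₃ (s : R) : b.root s ((cartanEquivDual b.cartan).symm (b.root r)) =
      (∑ k, (g k * b.wt s k * b.wt r k : ℂ)) / N := by
    rw [b.cartanEquivDual_symm_root hc hc₀]
    simp only [map_sum, map_smul, root_h, smul_eq_mul, Finset.sum_div]
    refine Finset.sum_congr rfl fun k _ => ?_
    rw [div_eq_mul_one_div, h₁]; ring
  have h₄ : b.root r ((cartanEquivDual b.cartan).symm (b.root r)) ≠ 0 :=
    root_apply_cartanEquivDual_symm_ne_zero (b.cartan.isNonZero_coe_root (b.weight r))
  have h₅ : coroot (b.weight r).1 = 2 • (b.root r ((cartanEquivDual b.cartan).symm (b.root r)))⁻¹ •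
      (cartanEquivDual b.cartan).symm (b.root r) := rfl
  rw [h₅, map_nsmul, map_smul]
  rw [h₃ r] at h₄ ⊢
  rw [h₃ s]
  have h₆ : (N : ℂ) ≠ 0 := by exact_mod_cast hN
  have h₇ : (∑ k, (g k * b.wt r k * b.wt r k : ℂ)) ≠ 0 := fun h₀ => h₄ (by rw [h₀, zero_div])
  rw [nsmul_eq_mul, smul_eq_mul]
  generalize (∑ k, (g k * b.wt r k * b.wt r k : ℂ)) = P at *
  generalize (∑ k, (g k * b.wt s k * b.wt r k : ℂ)) = Q at *
  field_simp
  push_cast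
  ring

/-- Recognition of the Cartan matrix from the weights. -/
theorem isOfType {c : κ → ℤ}
    (hc : ∀ k l, ∑ r, b.wt r k * b.wt r l = if k = l then c k else 0) (hc₀ : ∀ k, c k ≠ 0)
    {ι : Type} [Fintype ι] [DecidableEq ι] {g : κ → ℤ} {N : ℤ}
    (hg : ∀ k, c k * g k = N) (hN : N ≠ 0) {s : ι → R} {M : ι → κ → ℤ} {d : ℤ} (hd : d ≠ 0)
    (hM : ∀ i j, ∑ k, M i k * b.wt (s j) k = if i = j then d else 0) {n : R → ι → ℤ}
    (hn : ∀ r k, b.wt r k = ∑ i, n r i * b.wt (s i) k)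
    (hpos : ∀ r, (∀ i, 0 ≤ n r i) ∨ ∀ i, n r i ≤ 0) {A : Matrix ι ι ℤ}
    (hA₀ : ∀ j, ∑ k, g k * b.wt (s j) k * b.wt (s j) k ≠ 0)
    (hA : ∀ i j, 2 * ∑ k, g k * b.wt (s i) k * b.wt (s j) k =
      A i j * ∑ k, g k * b.wt (s j) k * b.wt (s j) k) : IsOfType A L := by
  have hli : LinearIndependent ℂ fun i => b.root (s i) := by
    rw [Fintype.linearIndependent_iff]
    intro t ht i
    have h₁ (k : κ) : ∑ j, t j * (b.wt (s j) k : ℂ) = 0 := by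
      have := LinearMap.congr_fun ht (b.h k)
      simpa [root_h] using this
    -- The rows of `M` are `d` times a dual basis to the simple roots, so pairing with row `i`
    -- isolates `t i`.
    have h₂ : ∑ k, (M i k : ℂ) * ∑ j, t j * (b.wt (s j) k : ℂ) = 0 := by simp [h₁]
    have h₃ (j : ι) : ∑ k, (M i k : ℂ) * b.wt (s j) k = if i = j then (d : ℂ) else 0 := by
      have := congrArg (Int.cast : ℤ → ℂ) (hM i j)
      push_cast at this
      exact this
    have h₄ : ∑ k, (M i k : ℂ) * ∑ j, t j * (b.wt (s j) k : ℂ) = t i * d := by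
      simp only [Finset.mul_sum]
      rw [Finset.sum_comm]
      calc _ = ∑ j, t j * ∑ k, (M i k : ℂ) * b.wt (s j) k := by
            refine Finset.sum_congr rfl fun j _ => ?_
            rw [Finset.mul_sum]
            exact Finset.sum_congr rfl fun k _ => by ring
        _ = _ := by simp [h₃]
    rw [h₂] at h₄
    exact (mul_eq_zero.1 h₄.symm).resolve_right (by exact_mod_cast hd)
  have hinj : Function.Injective fun i => b.weight (s i) := fun i j hij =>
    hli.injective (LinearMap.ext fun y => by
      have := congrArg (fun β : b.cartan.root => β.1 y) hij
      exact this)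
  have hroot (r : R) : b.root r = ∑ i, n r i • b.root (s i) := by
    ext y
    rw [b.eq_sum_h y]
    simp only [map_sum, map_smul, root_h, LinearMap.sum_apply, LinearMap.smul_apply, hn r,
      smul_eq_mul, zsmul_eq_mul]
    push_cast
    simp only [Finset.mul_sum]
  have hcl (m : ι → ℤ) (hm : ∀ i, 0 ≤ m i) : ∑ i, m i • b.root (s i) ∈
      AddSubmonoid.closure ((rootSystem b.cartan).root '' Set.range fun i => b.weight (s i)) := by
    refine sum_mem fun i _ => ?_
    obtain ⟨p, hp⟩ := Int.eq_ofNat_of_zero_le (hm i)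
    rw [hp, natCast_zsmul]
    refine nsmul_mem (AddSubmonoid.subset_closure ?_) p
    exact ⟨b.weight (s i), ⟨i, rfl⟩, rfl⟩
  have hli' : LinearIndepOn ℂ (rootSystem b.cartan).root (Set.range fun i => b.weight (s i)) :=
    (linearIndependent_equiv (Equiv.ofInjective _ hinj)).1 hli
  let base : (rootSystem b.cartan).Base := .mk' _ (Set.range fun i => b.weight (s i))
    hli'
    (fun β => by
      obtain ⟨r, rfl⟩ := b.weight_surjective β
      change b.root r ∈ _ ∨ -b.root r ∈ _
      rcases hpos r with h₁ | h₁
      · left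
        rw [hroot]
        exact hcl _ h₁
      · right
        rw [hroot, ← Finset.sum_neg_distrib]
        simp only [← neg_smul]
        exact hcl _ fun i => neg_nonneg.2 (h₁ i))
  refine ⟨inferInstance, b.cartan, inferInstance, base,
    (Equiv.ofInjective _ hinj).trans (Set.Finite.subtypeEquivToFinset _), fun i j => ?_⟩
  apply FaithfulSMul.algebraMap_injective ℤ ℂ
  rw [RootPairing.Base.algebraMap_cartanMatrixIn_apply, rootSystem_pairing_apply]
  change b.root (s i) (coroot (b.weight (s j)).1) = _
  have h₁ := b.root_coroot hc hc₀ (s j) (s i) hg hN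
  have h₂ := congrArg (Int.cast : ℤ → ℂ) (hA i j)
  push_cast at h₂
  rw [h₂] at h₁
  refine mul_right_cancel₀ ?_ h₁
  have := hA₀ j
  exact_mod_cast this

end WeightBasis

end recognition

/-! ### Root vectors -/

/-- A basis of root vectors of the complexification of a real Lie algebra `L`, given by its real
and imaginary parts `p` and `q`; the Cartan subalgebra is spanned by the elements `h k`, which
are multiplied by the imaginary unit if they are compact. -/
structure RootVectors (κ R : Type) {A : Type} [LieRing A] [LieAlgebra ℝ A]
    (L : LieSubalgebra ℝ A) where
  h : κ → A
  p : R → A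
  q : R → A
  h_mem : ∀ k, h k ∈ L
  p_mem : ∀ r, p r ∈ L
  q_mem : ∀ r, q r ∈ L
  compact : κ → Bool
  wt : R → κ → ℤ
  lie_h_h : ∀ k l, ⁅h k, h l⁆ = 0
  lie_compact : ∀ k, compact k = true → ∀ r,
    ⁅h k, p r⁆ = (wt r k : ℝ) • q r ∧ ⁅h k, q r⁆ = -(wt r k : ℝ) • p r
  lie_split : ∀ k, compact k = false → ∀ r,
    ⁅h k, p r⁆ = (wt r k : ℝ) • p r ∧ ⁅h k, q r⁆ = (wt r k : ℝ) • q r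
  bar : ∀ r, ∃ r' : R, ∃ s : ℝ, s * s = 1 ∧ p r' = s • p r ∧ q r' = -s • q r
  le_span : L.toSubmodule ≤ Submodule.span ℝ (Set.range h ∪ Set.range p ∪ Set.range q)
  wt_ne_zero : ∀ r, wt r ≠ 0

namespace RootVectors

variable {κ R : Type} {A : Type} [LieRing A] [LieAlgebra ℝ A] {L : LieSubalgebra ℝ A}
  (v : RootVectors κ R L)

/-- The elements of the Cartan subalgebra and the root vectors. -/
def vec : κ ⊕ R → ℂ ⊗[ℝ] L
  | .inl k => (if v.compact k then Complex.I else 1) ⊗ₜ ⟨v.h k, v.h_mem k⟩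
  | .inr r => 1 ⊗ₜ ⟨v.p r, v.p_mem r⟩ + Complex.I ⊗ₜ ⟨v.q r, v.q_mem r⟩

theorem lie_inl_inl (k l : κ) : ⁅v.vec (.inl k), v.vec (.inl l)⁆ = 0 := by
  have h₁ : ⁅(⟨v.h k, v.h_mem k⟩ : L), (⟨v.h l, v.h_mem l⟩ : L)⁆ = 0 :=
    Subtype.ext (v.lie_h_h k l)
  rw [vec, vec, LieAlgebra.ExtendScalars.bracket_tmul, h₁, TensorProduct.tmul_zero]

/-- A compact element rotates the pair p, q. Multiplied by the imaginary unit it has p + i q as an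
eigenvector with real eigenvalue. -/
theorem lie_inl_inr (k : κ) (r : R) :
    ⁅v.vec (.inl k), v.vec (.inr r)⁆ = (v.wt r k : ℂ) • v.vec (.inr r) := by
  have h₀ (x : L) (c : ℂ) (w : ℤ) : c ⊗ₜ[ℝ] ((w : ℝ) • x) = ((w : ℂ) * c) ⊗ₜ[ℝ] x := by
    rw [TensorProduct.tmul_smul, TensorProduct.smul_tmul']
    simp
  rw [vec, vec, lie_add, LieAlgebra.ExtendScalars.bracket_tmul,
    LieAlgebra.ExtendScalars.bracket_tmul, smul_add, TensorProduct.smul_tmul',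
    TensorProduct.smul_tmul']
  cases hk : v.compact k with
  | true =>
    have h₁ : ⁅(⟨v.h k, v.h_mem k⟩ : L), (⟨v.p r, v.p_mem r⟩ : L)⁆ =
        (v.wt r k : ℝ) • ⟨v.q r, v.q_mem r⟩ := Subtype.ext (v.lie_compact k hk r).1
    have h₂ : ⁅(⟨v.h k, v.h_mem k⟩ : L), (⟨v.q r, v.q_mem r⟩ : L)⁆ =
        ((-v.wt r k : ℤ) : ℝ) • ⟨v.p r, v.p_mem r⟩ :=
      Subtype.ext ((v.lie_compact k hk r).2.trans (by push_cast; rfl))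
    rw [h₁, h₂, h₀, h₀, add_comm]
    simp
  | false =>
    have h₁ : ⁅(⟨v.h k, v.h_mem k⟩ : L), (⟨v.p r, v.p_mem r⟩ : L)⁆ =
        (v.wt r k : ℝ) • ⟨v.p r, v.p_mem r⟩ := Subtype.ext (v.lie_split k hk r).1
    have h₂ : ⁅(⟨v.h k, v.h_mem k⟩ : L), (⟨v.q r, v.q_mem r⟩ : L)⁆ =
        (v.wt r k : ℝ) • ⟨v.q r, v.q_mem r⟩ := Subtype.ext (v.lie_split k hk r).2
    rw [h₁, h₂, h₀, h₀]
    simp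

/-- By `bar` the complex conjugate of a root vector is again one up to sign, so the real and
imaginary parts lie in the complex span. -/
theorem span_vec : ⊤ ≤ Submodule.span ℂ (Set.range v.vec) := by
  set S := Submodule.span ℂ (Set.range v.vec)
  have hv (j) : v.vec j ∈ S := Submodule.subset_span ⟨j, rfl⟩
  have hI (x : L) (h : Complex.I ⊗ₜ[ℝ] x ∈ S) : (1 : ℂ) ⊗ₜ[ℝ] x ∈ S := by
    have := S.smul_mem (-Complex.I) h
    rw [TensorProduct.smul_tmul'] at this
    simpa using this
  have hpq (r : R) : (1 : ℂ) ⊗ₜ[ℝ] (⟨v.p r, v.p_mem r⟩ : L) ∈ S ∧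
      (1 : ℂ) ⊗ₜ[ℝ] (⟨v.q r, v.q_mem r⟩ : L) ∈ S := by
    obtain ⟨r', s, hs, hp, hq⟩ := v.bar r
    have hp' : (⟨v.p r', v.p_mem r'⟩ : L) = s • ⟨v.p r, v.p_mem r⟩ := Subtype.ext hp
    have hq' : (⟨v.q r', v.q_mem r'⟩ : L) = -s • ⟨v.q r, v.q_mem r⟩ := Subtype.ext hq
    have h₁ := hv (.inr r)
    have h₂ := S.smul_mem (s : ℂ) (hv (.inr r'))
    have hs' : (s * s : ℂ) = 1 := by exact_mod_cast hs
    rw [vec] at h₁ h₂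
    rw [hp', hq', TensorProduct.tmul_smul, TensorProduct.tmul_smul, TensorProduct.smul_tmul',
      TensorProduct.smul_tmul', smul_add, TensorProduct.smul_tmul', TensorProduct.smul_tmul'] at h₂
    have e₁ : (s : ℂ) • s • (1 : ℂ) = 1 := by
      rw [Complex.real_smul, mul_one, smul_eq_mul, hs']
    have e₂ : (s : ℂ) • -s • Complex.I = -Complex.I := by
      rw [neg_smul, smul_neg, Complex.real_smul, smul_eq_mul, ← mul_assoc, hs', one_mul]
    rw [e₁, e₂, TensorProduct.neg_tmul] at h₂
    constructor
    · have := S.smul_mem (1 / 2 : ℂ) (S.add_mem h₁ h₂)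
      convert! this using 1
      module
    · refine hI _ ?_
      have := S.smul_mem (1 / 2 : ℂ) (S.sub_mem h₁ h₂)
      convert! this using 1
      module
  have hmem (x : A) (hx : x ∈ Submodule.span ℝ (Set.range v.h ∪ Set.range v.p ∪ Set.range v.q)) :
      ∃ hL : x ∈ L, (1 : ℂ) ⊗ₜ[ℝ] (⟨x, hL⟩ : L) ∈ S := by
    induction hx using Submodule.span_induction with
    | mem x hx =>
      obtain (⟨k, rfl⟩ | ⟨r, rfl⟩) | ⟨r, rfl⟩ := hx
      · refine ⟨v.h_mem k, ?_⟩
        have h₁ := hv (.inl k)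
        rw [vec] at h₁
        split_ifs at h₁
        · exact hI _ h₁
        · exact h₁
      · exact ⟨v.p_mem r, (hpq r).1⟩
      · exact ⟨v.q_mem r, (hpq r).2⟩
    | zero => exact ⟨zero_mem _, by
        convert! S.zero_mem
        exact TensorProduct.tmul_zero _ _⟩
    | add x y _ _ hx hy =>
      obtain ⟨h₁, hx⟩ := hx
      obtain ⟨h₂, hy⟩ := hy
      refine ⟨add_mem h₁ h₂, ?_⟩
      have := S.add_mem hx hy
      rwa [← TensorProduct.tmul_add] at this
    | smul c x _ hx =>
      obtain ⟨h₁, hx⟩ := hx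
      refine ⟨L.smul_mem c h₁, ?_⟩
      have := S.smul_mem (c : ℂ) hx
      rw [TensorProduct.smul_tmul', Complex.coe_smul, ← TensorProduct.smul_tmul',
        ← TensorProduct.tmul_smul] at this
      exact this
  rintro z -
  obtain ⟨x, y, rfl⟩ := exists_eq_tmul_add z
  obtain ⟨_, hx⟩ := hmem _ (v.le_span x.2)
  obtain ⟨_, hy⟩ := hmem _ (v.le_span y.2)
  refine S.add_mem hx ?_
  have := S.smul_mem Complex.I hy
  rw [TensorProduct.smul_tmul'] at this
  simpa using this

/-- The basis of root vectors of the complexification. -/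
def weightBasis [Fintype κ] [Fintype R] [FiniteDimensional ℝ L]
    (hc : Fintype.card κ + Fintype.card R = Module.finrank ℝ L) :
    WeightBasis κ R (ℂ ⊗[ℝ] L) where
  basis := basisOfTopLeSpanOfCardEqFinrank v.vec v.span_vec
    (by rw [Fintype.card_sum, hc, Module.finrank_baseChange])
  wt := v.wt
  lie_h_h k l := by simpa using v.lie_inl_inl k l
  lie_h_x k r := by simpa using v.lie_inl_inr k r
  wt_ne_zero := v.wt_ne_zero

end RootVectors

/-! ### The root vectors of `e6` and `f4` -/

/-- Triality solved for the third block by skewness. It makes the shears equivariant under `so8`. -/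
theorem block_star_mul {D : Module.End ℝ H3} (hD : D ∈ so8) (i : Fin 3) (x y : Octonion) :
    block (i + 2) D (star (x * y)) =
      star (block i D x * y) + star (x * block (i + 1) D y) := by
  refine ext_ip fun z => ?_
  have h₁ := block_triality hD i x y z
  have h₂ := block_skew hD (i + 2) (star (x * y)) z
  have h₃ (x y z : Octonion) : ip (star (x * y)) z = re (x * (y * z)) := by
    rw [ip_star_left, re_mul_cycle]
  rw [h₃ x y] at h₂
  rw [map_add, LinearMap.add_apply, h₃, h₃]
  linarith

theorem lie_upper {D : Module.End ℝ H3} (hD : D ∈ so8) (i : Fin 3) (v : Octonion) :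
    ⁅D, upper i v⁆ = upper i (block i D v) := by
  ext1 X
  rw [LieRing.of_associative_ring_bracket, LinearMap.sub_apply, Module.End.mul_apply,
    Module.End.mul_apply]
  refine H3_ext (fun j => ?_) fun j => ?_
  · rw [map_sub, dg_of_mem_so8 hD, dg_upper, dg_upper, od_of_mem_so8 hD]
    split_ifs
    · linarith [block_skew hD i v (od i X)]
    · simp
  · rw [map_sub, od_of_mem_so8 hD, od_upper, od_upper, od_upper, od_of_mem_so8 hD,
      dg_of_mem_so8 hD]
    by_cases h₁ : j = i
    · subst h₁; simp
    · by_cases h₂ : j = i + 2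
      · subst h₂
        simp only [h₁, if_false, if_true, block_star_mul hD]
        abel
      · simp [h₁, h₂]

theorem lie_lower {D : Module.End ℝ H3} (hD : D ∈ so8) (i : Fin 3) (v : Octonion) :
    ⁅D, lower i v⁆ = lower i (block i D v) := by
  ext1 X
  rw [LieRing.of_associative_ring_bracket, LinearMap.sub_apply, Module.End.mul_apply,
    Module.End.mul_apply]
  refine H3_ext (fun j => ?_) fun j => ?_
  · rw [map_sub, dg_of_mem_so8 hD, dg_lower, dg_lower, od_of_mem_so8 hD]
    split_ifs
    · linarith [block_skew hD i v (od i X)]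
    · simp
  · rw [map_sub, od_of_mem_so8 hD, od_lower, od_lower, od_lower, od_of_mem_so8 hD,
      dg_of_mem_so8 hD]
    by_cases h₁ : j = i
    · subst h₁; simp
    · by_cases h₂ : j = i + 1
      · subst h₂
        have h₃ := block_star_mul hD (i + 2) (od (i + 2) X) v
        rw [fin3_add_two_add_two, fin3_add_two_add_one] at h₃
        simp only [h₁, if_false, if_true, h₃]
        abel
      · simp [h₁, h₂]

theorem lie_rot {D : Module.End ℝ H3} (hD : D ∈ so8) (i : Fin 3) (v : Octonion) :
    ⁅D, rot i v⁆ = rot i (block i D v) := by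
  simp only [rot, LinearMap.sub_apply, lie_sub, lie_upper hD, lie_lower hD]

theorem lie_wedge {D : Module.End ℝ H3} (hD : D ∈ so8) (i : Fin 3) (v w : Octonion) :
    ⁅D, wedge i v w⁆ = wedge i (block i D v) w + wedge i v (block i D w) := by
  rw [wedge, leibniz_lie, lie_rot hD, lie_rot hD]
  rfl

/-- The weight of a matrix unit in row i + 1 and column i + 2 under a diagonal matrix. -/
theorem lie_diagMap_upper (m : Fin 3 → ℝ) (i : Fin 3) (v : Octonion) :
    ⁅diagMap m, upper i v⁆ = (m (i + 1) - m (i + 2)) • upper i v := by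
  ext1 X
  rw [LieRing.of_associative_ring_bracket, LinearMap.sub_apply, Module.End.mul_apply,
    Module.End.mul_apply, LinearMap.smul_apply]
  refine H3_ext (fun j => ?_) fun j => ?_
  · simp only [map_sub, map_smul, dg_diagMap, dg_upper, od_diagMap, smul_eq_mul]
    split_ifs with h
    · subst h; ring
    · ring
  · simp only [map_sub, map_smul, od_diagMap, od_upper, dg_diagMap]
    by_cases h₁ : j = i
    · subst h₁
      simp only [if_true]
      module
    · by_cases h₂ : j = i + 2
      · subst h₂
        simp only [h₁, if_false, if_true, fin3_add_one_add_one, fin3_add_one_add_two,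
          fin3_add_two_add_one, fin3_add_two_add_two, mul_smul_comm, star_smul']
        module
      · simp [h₁, h₂]

theorem lie_diagMap_lower (m : Fin 3 → ℝ) (i : Fin 3) (v : Octonion) :
    ⁅diagMap m, lower i v⁆ = (m (i + 2) - m (i + 1)) • lower i v := by
  ext1 X
  rw [LieRing.of_associative_ring_bracket, LinearMap.sub_apply, Module.End.mul_apply,
    Module.End.mul_apply, LinearMap.smul_apply]
  refine H3_ext (fun j => ?_) fun j => ?_
  · simp only [map_sub, map_smul, dg_diagMap, dg_lower, od_diagMap, smul_eq_mul]
    split_ifs with h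
    · subst h; ring
    · ring
  · simp only [map_sub, map_smul, od_diagMap, od_lower, dg_diagMap]
    by_cases h₁ : j = i
    · subst h₁
      simp only [if_true]
      module
    · by_cases h₂ : j = i + 1
      · subst h₂
        simp only [h₁, if_false, if_true, fin3_add_one_add_one, fin3_add_one_add_two,
          fin3_add_two_add_one, fin3_add_two_add_two, smul_mul_assoc, star_smul']
        module
      · simp [h₁, h₂]

theorem lie_diagMap_so8 (m : Fin 3 → ℝ) {D : Module.End ℝ H3} (hD : D ∈ so8) :
    ⁅diagMap m, D⁆ = 0 := by
  ext1 X
  rw [LieRing.of_associative_ring_bracket, LinearMap.sub_apply, Module.End.mul_apply,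
    Module.End.mul_apply]
  refine H3_ext (fun j => ?_) fun j => ?_
  · simp [dg_diagMap, dg_of_mem_so8 hD]
  · simp [od_diagMap, od_of_mem_so8 hD]

theorem lie_diagMap_diagMap (m m' : Fin 3 → ℝ) : ⁅diagMap m, diagMap m'⁆ = 0 := by
  ext1 X
  rw [LieRing.of_associative_ring_bracket, LinearMap.sub_apply, Module.End.mul_apply,
    Module.End.mul_apply]
  refine H3_ext (fun j => ?_) fun j => ?_
  · simp only [map_sub, dg_diagMap, LinearMap.zero_apply, map_zero]; ring
  · simp only [map_sub, od_diagMap, LinearMap.zero_apply, map_zero]; module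

/-! ### A maximal torus of SO(8) and its three eight-dimensional representations -/

/-- The real parts of a basis of isotropic vectors of the complexified octonions. -/
def isoRe (a : Fin 8) : Octonion := if a < 4 then e a else e a.rev

/-- The imaginary parts of a basis of isotropic vectors of the complexified octonions. -/
def isoIm (a : Fin 8) : Octonion := if a < 4 then e a.rev else -e a

/-- A maximal torus of `SO(8)`. -/
def torus (k : Fin 4) : Module.End ℝ H3 :=
  (1 / 2 : ℝ) • wedge 2 (e (k.castAdd 4)) (e (k.castAdd 4 : Fin 8).rev)

/-- The weights of the three eight-dimensional representations for the isotropic vectors with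
index less than 4. -/
def octWeightAux : Fin 3 → Fin 4 → Fin 4 → ℤ :=
  ![!![-1, 1, 1, 1; -1, 1, -1, -1; -1, -1, 1, -1; -1, -1, -1, 1],
    !![-1, -1, -1, -1; 1, 1, -1, -1; 1, -1, 1, -1; 1, -1, -1, 1],
    !![2, 0, 0, 0; 0, 2, 0, 0; 0, 0, 2, 0; 0, 0, 0, 2]]

/-- The weights of the three eight-dimensional representations. -/
def octWeight (i : Fin 3) (a : Fin 8) (k : Fin 4) : ℤ :=
  if h : a.1 < 4 then octWeightAux i k ⟨a, h⟩ else -octWeightAux i k ⟨a.rev, by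
    rw [Fin.val_rev]; omega⟩

theorem torus_mem_so8 (k : Fin 4) : torus k ∈ so8 := so8.smul_mem _ (wedge_mem_so8 ..)

theorem isoRe_rev (a : Fin 8) : isoRe a.rev = isoRe a := by
  fin_cases a <;> rfl

theorem isoIm_rev (a : Fin 8) : isoIm a.rev = -isoIm a := by
  fin_cases a <;> first | rfl | exact (neg_neg _).symm

set_option maxHeartbeats 1000000 in
-- The basis is ordered so that `Fin.rev` pairs 1, i, j, k with their products with ℓ. The torus
-- planes are these four pairs, and the half-spin actions preserve each pair too, so one isotropic
-- basis serves all three slots.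
theorem half_spin_zero (k a : Fin 4) :
    star (e (k.castAdd 4 : Fin 8).rev) * (e (k.castAdd 4) * e (a.castAdd 4)) =
      (octWeightAux 0 k a : ℝ) • e (a.castAdd 4 : Fin 8).rev := by
  fin_cases k <;> fin_cases a <;> apply ext_coords <;> simp [e, octWeightAux, Fin.rev]

set_option maxHeartbeats 1000000 in
theorem half_spin_one (k a : Fin 4) :
    e (a.castAdd 4) * e (k.castAdd 4) * star (e (k.castAdd 4 : Fin 8).rev) =
      (octWeightAux 1 k a : ℝ) • e (a.castAdd 4 : Fin 8).rev := by
  fin_cases k <;> fin_cases a <;> apply ext_coords <;> simp [e, octWeightAux, Fin.rev]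

theorem rev_castAdd (a b : Fin 4) :
    ((a.castAdd 4 : Fin 8).rev = (b.castAdd 4 : Fin 8).rev ↔ a = b) ∧
      (a.castAdd 4 : Fin 8) ≠ (b.castAdd 4 : Fin 8).rev := by
  revert a b; decide

theorem ip_e_rev (k : Fin 4) : ip (e (k.castAdd 4 : Fin 8)) (e (k.castAdd 4 : Fin 8).rev) = 0 := by
  rw [ip_e, if_neg (rev_castAdd k k).2]

/-- The two vectors of the plane are orthogonal, so their Clifford products anticommute and the
difference in `block_wedge_one` is twice one term. -/
theorem block_torus_zero (k : Fin 4) (x : Octonion) : block 0 (torus k) x =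
    star (e (k.castAdd 4 : Fin 8).rev) * (e (k.castAdd 4) * x) := by
  have h₁ := block_wedge_one 2 (e (k.castAdd 4)) (e (k.castAdd 4 : Fin 8).rev) x
  change block 0 _ x = _ at h₁
  have h₂ := star_mul_mul_add (e (k.castAdd 4)) (e (k.castAdd 4 : Fin 8).rev) x
  rw [ip_e_rev, mul_zero, zero_smul, add_comm, add_eq_zero_iff_eq_neg] at h₂
  rw [torus, map_smul, LinearMap.smul_apply, h₁, h₂]
  module

theorem block_torus_one (k : Fin 4) (x : Octonion) : block 1 (torus k) x =
    x * e (k.castAdd 4) * star (e (k.castAdd 4 : Fin 8).rev) := by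
  have h₁ := block_wedge_two 2 (e (k.castAdd 4)) (e (k.castAdd 4 : Fin 8).rev) x
  change block 1 _ x = _ at h₁
  have h₂ := mul_mul_star_add (e (k.castAdd 4)) (e (k.castAdd 4 : Fin 8).rev) x
  rw [ip_e_rev, mul_zero, zero_smul, add_eq_zero_iff_eq_neg] at h₂
  rw [torus, map_smul, LinearMap.smul_apply, h₁, h₂]
  module

theorem block_torus_two (k : Fin 4) (x : Octonion) : block 2 (torus k) x =
    (2 * ip (e (k.castAdd 4)) x) • e (k.castAdd 4 : Fin 8).rev
      - (2 * ip (e (k.castAdd 4 : Fin 8).rev) x) • e (k.castAdd 4) := by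
  rw [torus, map_smul, LinearMap.smul_apply, block_wedge]
  module

theorem octWeightAux_two (k a : Fin 4) : octWeightAux 2 k a = if k = a then 2 else 0 := by
  revert k a; decide

theorem octWeightAux_mul_self {i : Fin 3} (hi : i ≠ 2) (k a : Fin 4) :
    octWeightAux i k a * octWeightAux i k a = 1 := by
  revert i k a; decide

theorem block_torus (i : Fin 3) (k a : Fin 4) :
    block i (torus k) (e (a.castAdd 4)) =
      (octWeightAux i k a : ℝ) • e (a.castAdd 4 : Fin 8).rev := by
  fin_cases i
  · exact (block_torus_zero _ _).trans (half_spin_zero _ _)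
  · exact (block_torus_one _ _).trans (half_spin_one _ _)
  · refine (block_torus_two _ _).trans ?_
    simp only [Fin.reduceFinMk, octWeightAux_two, ip_e, (rev_castAdd a k).2.symm, if_false,
      Fin.castAdd_inj, (Fin.castAdd_injective 4 4).eq_iff]
    split_ifs with h
    · subst h; simp
    · simp

/-- In the half-spin slots a torus element is a complex structure, a product of two anticommuting
units. The action on the reversed basis vectors thus follows from the action on the others. -/
theorem block_torus_block_torus {i : Fin 3} (hi : i ≠ 2) (k : Fin 4) (x : Octonion) :
    block i (torus k) (block i (torus k) x) = -x := by
  have h₁ (a : Fin 8) : ip (e a) (e a) = 1 := by simp [ip_e]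
  obtain rfl | rfl : i = 0 ∨ i = 1 := by revert i; decide
  · have h₂ (y : Octonion) : e (k.castAdd 4) * (star (e (k.castAdd 4 : Fin 8).rev) * y) =
        -(e (k.castAdd 4 : Fin 8).rev * (star (e (k.castAdd 4)) * y)) := by
      have := star_mul_mul_add (star (e (k.castAdd 4))) (star (e (k.castAdd 4 : Fin 8).rev)) y
      rwa [ip_star_star, ip_e_rev, mul_zero, zero_smul, star_star, star_star,
        add_eq_zero_iff_eq_neg] at this
    rw [block_torus_zero, block_torus_zero, h₂, mul_neg, star_mul_cancel, star_mul_cancel, h₁, h₁,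
      one_smul, one_smul]
  · have h₂ (y : Octonion) : y * star (e (k.castAdd 4 : Fin 8).rev) * e (k.castAdd 4) =
        -(y * star (e (k.castAdd 4)) * e (k.castAdd 4 : Fin 8).rev) := by
      have := mul_mul_star_add (star (e (k.castAdd 4))) (star (e (k.castAdd 4 : Fin 8).rev)) y
      rw [ip_star_star, ip_e_rev, mul_zero, zero_smul, star_star, star_star] at this
      rw [← add_eq_zero_iff_eq_neg, ← this, add_comm]
    rw [block_torus_one, block_torus_one, h₂, neg_mul, mul_mul_star_cancel, mul_mul_star_cancel,
      h₁, h₁, one_smul, one_smul]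

theorem block_torus_rev (i : Fin 3) (k a : Fin 4) :
    block i (torus k) (e (a.castAdd 4 : Fin 8).rev) =
      -(octWeightAux i k a : ℝ) • e (a.castAdd 4) := by
  by_cases hi : i = 2
  · subst hi
    rw [block_torus_two, octWeightAux_two]
    simp only [ip_e, (rev_castAdd k a).2, if_false, (rev_castAdd k a).1]
    split_ifs with h
    · subst h; simp
    · simp
  · have h₁ := block_torus_block_torus hi k (e (a.castAdd 4))
    rw [block_torus, map_smul] at h₁
    have h₂ : (octWeightAux i k a : ℝ) * octWeightAux i k a = 1 := by
      exact_mod_cast octWeightAux_mul_self hi k a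
    have h₃ := congrArg ((octWeightAux i k a : ℝ) • ·) h₁
    simp only [smul_smul, h₂, one_smul] at h₃
    rw [h₃, smul_neg, neg_smul]

/-- The isotropic vectors are weight vectors. -/
theorem block_torus_iso (i : Fin 3) (k : Fin 4) (a : Fin 8) :
    block i (torus k) (isoRe a) = (octWeight i a k : ℝ) • isoIm a ∧
      block i (torus k) (isoIm a) = -(octWeight i a k : ℝ) • isoRe a := by
  have h₁ (b : Fin 4) : isoRe (b.castAdd 4 : Fin 8) = e (b.castAdd 4) ∧
      isoIm (b.castAdd 4 : Fin 8) = e (b.castAdd 4 : Fin 8).rev ∧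
      octWeight i (b.castAdd 4 : Fin 8) k = octWeightAux i k b ∧
      octWeight i (b.castAdd 4 : Fin 8).rev k = -octWeightAux i k b := by
    refine ⟨by fin_cases b <;> rfl, by fin_cases b <;> rfl, ?_⟩
    revert i k b; decide
  have h₂ : (∃ b : Fin 4, a = b.castAdd 4) ∨ ∃ b : Fin 4, a = (b.castAdd 4 : Fin 8).rev := by
    revert a; decide
  rcases h₂ with ⟨b, rfl⟩ | ⟨b, rfl⟩
  · obtain ⟨h₃, h₄, h₅, -⟩ := h₁ b
    rw [h₃, h₄, h₅]
    exact ⟨block_torus i k b, block_torus_rev i k b⟩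
  · obtain ⟨h₃, h₄, -, h₅⟩ := h₁ b
    rw [isoRe_rev, isoIm_rev, h₃, h₄, h₅, map_neg, block_torus, block_torus_rev]
    push_cast
    constructor <;> module

/-- The real part of the wedge product of two isotropic vectors. -/
def isoWedgeRe (a b : Fin 8) : Module.End ℝ H3 :=
  wedge 2 (isoRe a) (isoRe b) - wedge 2 (isoIm a) (isoIm b)

/-- The imaginary part of the wedge product of two isotropic vectors. -/
def isoWedgeIm (a b : Fin 8) : Module.End ℝ H3 :=
  wedge 2 (isoRe a) (isoIm b) + wedge 2 (isoIm a) (isoRe b)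

theorem wedge_self (k : Fin 3) (a : Octonion) : wedge k a a = 0 := lie_self _

theorem wedge_neg_left (k : Fin 3) (a b : Octonion) : wedge k (-a) b = -wedge k a b := by
  simp [wedge]

theorem wedge_neg_right (k : Fin 3) (a b : Octonion) : wedge k a (-b) = -wedge k a b := by
  simp [wedge]

theorem wedge_smul_left (k : Fin 3) (r : ℝ) (a b : Octonion) :
    wedge k (r • a) b = r • wedge k a b := by
  simp [wedge]

theorem wedge_smul_right (k : Fin 3) (r : ℝ) (a b : Octonion) :
    wedge k a (r • b) = r • wedge k a b := by
  simp [wedge]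

theorem isoWedgeRe_mem_so8 (a b : Fin 8) : isoWedgeRe a b ∈ so8 :=
  so8.sub_mem (wedge_mem_so8 ..) (wedge_mem_so8 ..)

theorem isoWedgeIm_mem_so8 (a b : Fin 8) : isoWedgeIm a b ∈ so8 :=
  so8.add_mem (wedge_mem_so8 ..) (wedge_mem_so8 ..)

theorem isoWedgeRe_swap (a b : Fin 8) : isoWedgeRe b a = -isoWedgeRe a b := by
  rw [isoWedgeRe, isoWedgeRe, wedge_swap 2 (isoRe a), wedge_swap 2 (isoIm a)]
  abel

theorem isoWedgeIm_swap (a b : Fin 8) : isoWedgeIm b a = -isoWedgeIm a b := by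
  rw [isoWedgeIm, isoWedgeIm, wedge_swap 2 (isoRe a), wedge_swap 2 (isoIm a)]
  abel

theorem lie_torus_isoWedge (k : Fin 4) (a b : Fin 8) :
    ⁅torus k, isoWedgeRe a b⁆ =
      ((octWeight 2 a k + octWeight 2 b k : ℤ) : ℝ) • isoWedgeIm a b ∧
    ⁅torus k, isoWedgeIm a b⁆ =
      -((octWeight 2 a k + octWeight 2 b k : ℤ) : ℝ) • isoWedgeRe a b := by
  have h := torus_mem_so8 k
  simp only [isoWedgeRe, isoWedgeIm, lie_sub, lie_add, lie_wedge h, (block_torus_iso 2 k a).1,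
    (block_torus_iso 2 k a).2, (block_torus_iso 2 k b).1, (block_torus_iso 2 k b).2,
    wedge_smul_left, wedge_smul_right]
  push_cast
  constructor <;> module

theorem lie_torus_torus (k l : Fin 4) : ⁅torus k, torus l⁆ = 0 := by
  conv_lhs => rw [torus.eq_1 l]
  rw [lie_smul, lie_wedge (torus_mem_so8 k), block_torus, block_torus_rev, wedge_smul_left,
    wedge_smul_right, wedge_self, wedge_self]
  simp

theorem so8_le_of_isoWedge {S : Submodule ℝ (Module.End ℝ H3)} (h₁ : ∀ k, torus k ∈ S)
    (h₂ : ∀ a b : Fin 8, a < b → a.rev ≠ b → isoWedgeRe a b ∈ S ∧ isoWedgeIm a b ∈ S) :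
    so8 ≤ S := by
  have h₃ (a b : Fin 8) : isoWedgeRe a b ∈ S ∧ isoWedgeIm a b ∈ S := by
    by_cases hab : a.rev = b
    · subst hab
      have e₁ : isoWedgeRe a a.rev = 0 := by
        rw [isoWedgeRe, isoRe_rev, isoIm_rev, wedge_neg_right, wedge_self, wedge_self]; simp
      -- A vector wedged with its own conjugate has weight zero and gives a multiple of a torus
      -- element.
      have e₂ : isoWedgeIm a a.rev = (-2 : ℝ) • wedge 2 (isoRe a) (isoIm a) := by
        rw [isoWedgeIm, isoRe_rev, isoIm_rev, wedge_neg_right, wedge_swap 2 (isoRe a)]; module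
      rw [e₁, e₂]
      refine ⟨S.zero_mem, S.smul_mem _ ?_⟩
      have e₃ : ∃ k : Fin 4, ∃ r : ℝ, wedge 2 (isoRe a) (isoIm a) = r • torus k := by
        have h₂ : ∀ a : Fin 8, (∃ b : Fin 4, a = b.castAdd 4) ∨
            ∃ b : Fin 4, a = (b.castAdd 4 : Fin 8).rev := by decide
        have e₄ (b : Fin 4) : isoRe (b.castAdd 4 : Fin 8) = e (b.castAdd 4) ∧
            isoIm (b.castAdd 4 : Fin 8) = e (b.castAdd 4 : Fin 8).rev :=
          ⟨by fin_cases b <;> rfl, by fin_cases b <;> rfl⟩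
        rcases h₂ a with ⟨b, rfl⟩ | ⟨b, rfl⟩
        · refine ⟨b, 2, ?_⟩
          rw [(e₄ b).1, (e₄ b).2, torus, smul_smul]
          norm_num
        · refine ⟨b, -2, ?_⟩
          rw [isoRe_rev, isoIm_rev, (e₄ b).1, (e₄ b).2, torus, smul_smul, wedge_neg_right]
          norm_num
      obtain ⟨k, r, hk⟩ := e₃
      rw [hk]
      exact S.smul_mem _ (h₁ k)
    · rcases lt_trichotomy a b with h | rfl | h
      · exact h₂ a b h hab
      · have e₁ : isoWedgeRe a a = 0 := by rw [isoWedgeRe, wedge_self, wedge_self, sub_zero]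
        have e₂ : isoWedgeIm a a = 0 := by rw [isoWedgeIm, wedge_swap 2 (isoRe a)]; simp
        rw [e₁, e₂]
        exact ⟨S.zero_mem, S.zero_mem⟩
      · rw [isoWedgeRe_swap, isoWedgeIm_swap, S.neg_mem_iff, S.neg_mem_iff]
        exact h₂ b a h fun h' => hab (by rw [← h', Fin.rev_rev])
  have h₄ (a b : Fin 8) : wedge 2 (isoRe a) (isoRe b) ∈ S ∧ wedge 2 (isoIm a) (isoIm b) ∈ S ∧
      wedge 2 (isoIm a) (isoRe b) ∈ S := by
    -- Reversing the second index conjugates the second vector, so half sums and half differences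
    -- with the unreversed pair separate the real wedges.
    have e₁ : isoWedgeRe a b.rev = wedge 2 (isoRe a) (isoRe b) + wedge 2 (isoIm a) (isoIm b) := by
      rw [isoWedgeRe, isoRe_rev, isoIm_rev, wedge_neg_right, sub_neg_eq_add]
    have e₂ : isoWedgeIm a b.rev = -wedge 2 (isoRe a) (isoIm b) + wedge 2 (isoIm a) (isoRe b) := by
      rw [isoWedgeIm, isoRe_rev, isoIm_rev, wedge_neg_right]
    have e₃ := (h₃ a b.rev).1
    have e₄ := (h₃ a b.rev).2
    rw [e₁] at e₃
    rw [e₂] at e₄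
    have e₅ := (h₃ a b).1
    have e₆ := (h₃ a b).2
    rw [isoWedgeRe] at e₅
    rw [isoWedgeIm] at e₆
    refine ⟨?_, ?_, ?_⟩
    · convert! S.smul_mem (1 / 2 : ℝ) (S.add_mem e₃ e₅) using 1; module
    · convert! S.smul_mem (1 / 2 : ℝ) (S.sub_mem e₃ e₅) using 1; module
    · convert! S.smul_mem (1 / 2 : ℝ) (S.add_mem e₄ e₆) using 1; module
  have h₅ (a : Fin 8) : e a = isoRe a ∨ e a = -isoIm a := by
    by_cases h : a < 4
    · exact .inl (if_pos h).symm
    · exact .inr (by rw [isoIm, if_neg h, neg_neg])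
  have h₆ (a b : Fin 8) : wedge 2 (e a) (e b) ∈ S := by
    rcases h₅ a with ha | ha <;> rcases h₅ b with hb | hb <;> rw [ha, hb] <;>
      simp only [wedge_neg_left, wedge_neg_right, S.neg_mem_iff, (h₄ a b).1, (h₄ a b).2.1,
        (h₄ a b).2.2]
    rw [wedge_swap, S.neg_mem_iff]
    exact (h₄ b a).2.2
  intro D hD
  rw [so8_eq_sum_wedge hD 2]
  exact S.sum_mem fun a _ => S.sum_mem fun b _ => S.smul_mem _ (h₆ a b)

theorem mem_of_iso {S : Submodule ℝ (Module.End ℝ H3)} (f : Octonion →ₗ[ℝ] Module.End ℝ H3)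
    (h : ∀ a, f (isoRe a) ∈ S ∧ f (isoIm a) ∈ S) (v : Octonion) : f v ∈ S := by
  rw [← sum_ip_e v, map_sum]
  refine S.sum_mem fun a _ => ?_
  rw [map_smul]
  refine S.smul_mem _ ?_
  by_cases ha : a < 4
  · have := (h a).1
    rwa [isoRe, if_pos ha] at this
  · have := (h a).2
    rwa [isoIm, if_neg ha, map_neg, S.neg_mem_iff] at this

/-- The pairs of isotropic basis vectors whose wedge products are root vectors. -/
abbrev RootPair : Type := {p : Fin 8 × Fin 8 // p.1 < p.2 ∧ p.1.rev ≠ p.2}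

/-- The opposite pair. -/
def RootPair.rev (r : RootPair) : RootPair :=
  ⟨(r.1.2.rev, r.1.1.rev), Fin.rev_lt_rev.2 r.2.1, fun h => r.2.2 <| by
    have h' : r.1.2.rev.rev = r.1.1.rev := h
    rw [← h', Fin.rev_rev]⟩

/-- Reversing both indices conjugates the wedge; restoring the increasing order costs the sign −1.
-/
theorem isoWedge_rev (r : RootPair) :
    isoWedgeRe r.rev.1.1 r.rev.1.2 = (-1 : ℝ) • isoWedgeRe r.1.1 r.1.2 ∧
    isoWedgeIm r.rev.1.1 r.rev.1.2 = -(-1 : ℝ) • isoWedgeIm r.1.1 r.1.2 := by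
  simp only [RootPair.rev, isoWedgeRe, isoWedgeIm, isoRe_rev, isoIm_rev, wedge_neg_left,
    wedge_neg_right]
  rw [wedge_swap 2 (isoRe r.1.1), wedge_swap 2 (isoIm r.1.1), wedge_swap 2 (isoIm r.1.1),
    wedge_swap 2 (isoRe r.1.1)]
  constructor <;> module

theorem lie_torus_of_lie {f : Octonion →ₗ[ℝ] Module.End ℝ H3} {i : Fin 3}
    (hf : ∀ D ∈ so8, ∀ v, ⁅D, f v⁆ = f (block i D v)) (k : Fin 4) (a : Fin 8) :
    ⁅torus k, f (isoRe a)⁆ = (octWeight i a k : ℝ) • f (isoIm a) ∧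
      ⁅torus k, f (isoIm a)⁆ = -(octWeight i a k : ℝ) • f (isoRe a) := by
  simp only [hf _ (torus_mem_so8 k), (block_torus_iso i k a).1, (block_torus_iso i k a).2, map_smul,
    and_self]

theorem octWeight_ne_zero (i : Fin 3) (a : Fin 8) : ∃ k, octWeight i a k ≠ 0 := by
  revert i a; decide

theorem RootPair.exists_ne_zero (r : RootPair) :
    ∃ k, octWeight 2 r.1.1 k + octWeight 2 r.1.2 k ≠ 0 := by
  revert r; decide +kernel

/-! ### The root system of 𝔣₄ -/

/-- The roots of `f4`. -/
abbrev RootF4 : Type := RootPair ⊕ Fin 3 × Fin 8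

/-- The weights of the root vectors of `f4`. -/
def weightF4 : RootF4 → Fin 4 → ℤ
  | .inl r, k => octWeight 2 r.1.1 k + octWeight 2 r.1.2 k
  | .inr (i, a), k => octWeight i a k

/-- The root vectors of `f4`. -/
def rootVectorsF4 : RootVectors (Fin 4) RootF4 f4 where
  h := torus
  p := Sum.elim (fun r => isoWedgeRe r.1.1 r.1.2) fun r => rot r.1 (isoRe r.2)
  q := Sum.elim (fun r => isoWedgeIm r.1.1 r.1.2) fun r => rot r.1 (isoIm r.2)
  h_mem k := so8_le_f4 (torus_mem_so8 k)
  p_mem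
    | .inl _ => so8_le_f4 (isoWedgeRe_mem_so8 _ _)
    | .inr _ => rot_mem_f4 _ _
  q_mem
    | .inl _ => so8_le_f4 (isoWedgeIm_mem_so8 _ _)
    | .inr _ => rot_mem_f4 _ _
  compact _ := true
  wt := weightF4
  lie_h_h := lie_torus_torus
  lie_compact
    | k, _, .inl r => lie_torus_isoWedge k r.1.1 r.1.2
    | k, _, .inr r => lie_torus_of_lie (fun _ hD v => lie_rot hD r.1 v) k r.2
  lie_split _ h := nomatch h
  bar
    | .inl r => ⟨.inl r.rev, -1, by norm_num, isoWedge_rev r⟩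
    | .inr r => ⟨.inr (r.1, r.2.rev), 1, by norm_num, by simp [isoRe_rev], by simp [isoIm_rev]⟩
  le_span := by
    refine f4_le (fun i v => mem_of_iso (rot i) (fun a => ?_) v)
      (so8_le_of_isoWedge (fun k => ?_) fun a b h₁ h₂ => ?_)
    · exact ⟨Submodule.subset_span (.inl (.inr ⟨.inr (i, a), rfl⟩)),
        Submodule.subset_span (.inr ⟨.inr (i, a), rfl⟩)⟩
    · exact Submodule.subset_span (.inl (.inl ⟨k, rfl⟩))
    · exact ⟨Submodule.subset_span (.inl (.inr ⟨.inl ⟨(a, b), h₁, h₂⟩, rfl⟩)),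
        Submodule.subset_span (.inr ⟨.inl ⟨(a, b), h₁, h₂⟩, rfl⟩)⟩
  wt_ne_zero r h := by
    rcases r with r | ⟨i, a⟩
    · obtain ⟨k, hk⟩ := r.exists_ne_zero
      exact hk (congrFun h k)
    · obtain ⟨k, hk⟩ := octWeight_ne_zero i a
      exact hk (congrFun h k)

/-- The simple roots of `f4`. -/
def simpleF4 : Fin 4 → RootF4 :=
  ![.inl ⟨(1, 5), by decide⟩, .inl ⟨(2, 4), by decide⟩, .inr (2, 3), .inr (1, 7)]

/-- The fundamental coweights of `f4`. -/
def coweightF4 : Matrix (Fin 4) (Fin 4) ℤ :=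
  !![1, 1, 0, 0; 2, 1, 1, 0; 3, 1, 1, 1; 2, 0, 0, 0]

/-- The weights are twice the standard F₄ roots. For each torus element the squares sum to 72 = 48 +
8 + 16 over the brackets, the vector slot and the two half-spin slots, so the form on roots is
proportional to the standard one. With coordinates ε₀, …, ε₃, the simple roots are, before doubling,
ε₁ − ε₂, ε₂ − ε₃, ε₃ and (ε₀ − ε₁ − ε₂ − ε₃)/2. -/
theorem isRealForm_f4 : IsRealForm CartanMatrix.F₄ f4 := by
  refine (rootVectorsF4.weightBasis ?_).isOfType (c := fun _ => 72) (g := fun _ => 1) (N := 72)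
    (s := simpleF4) (M := coweightF4) (d := 2)
    -- The coefficient of a simple root is the pairing with its coweight. That the integer division
    -- loses nothing is part of the check that the roots are recovered.
    (n := fun r i => (∑ k, coweightF4 i k * weightF4 r k) / 2) ?_ ?_ ?_ ?_ ?_ ?_ ?_ ?_ ?_ ?_
  · rw [finrank_f4]; decide +kernel
  · change ∀ k l, ∑ r, weightF4 r k * weightF4 r l = if k = l then 72 else 0
    decide +kernel
  · decide
  · decide
  · decide
  · decide
  · change ∀ i j, ∑ k, coweightF4 i k * weightF4 (simpleF4 j) k = if i = j then 2 else 0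
    decide +kernel
  · change ∀ r k, weightF4 r k =
      ∑ i, (∑ k, coweightF4 i k * weightF4 r k) / 2 * weightF4 (simpleF4 i) k
    decide +kernel
  · decide +kernel
  · change ∀ j, ∑ k, 1 * weightF4 (simpleF4 j) k * weightF4 (simpleF4 j) k ≠ 0
    decide +kernel
  · change ∀ i j, 2 * ∑ k, 1 * weightF4 (simpleF4 i) k * weightF4 (simpleF4 j) k =
      CartanMatrix.F₄ i j * ∑ k, 1 * weightF4 (simpleF4 j) k * weightF4 (simpleF4 j) k
    decide +kernel

/-! ### The root system of 𝔢₆ -/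

/-- The roots of `e6`. -/
abbrev RootE6 : Type := RootPair ⊕ Fin 3 × Fin 8 ⊕ Fin 3 × Fin 8

/-- The diagonal matrices in the Cartan subalgebra of `e6`. -/
def splitVector : Fin 2 → Fin 3 → ℝ := ![![1, -1, 0], ![1, 1, -2]]

/-- The weights of the diagonal matrices. -/
def splitWeight (i : Fin 3) : Fin 2 → ℤ := ![![-1, 3], ![-1, -3], ![2, 0]] i

/-- The weights of the root vectors of `e6`. -/
def weightE6 : RootE6 → Fin 4 ⊕ Fin 2 → ℤ
  | .inl r, .inl k => octWeight 2 r.1.1 k + octWeight 2 r.1.2 k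
  | .inl _, .inr _ => 0
  | .inr (.inl r), .inl k => octWeight r.1 r.2 k
  | .inr (.inl r), .inr j => splitWeight r.1 j
  | .inr (.inr r), .inl k => octWeight r.1 r.2 k
  | .inr (.inr r), .inr j => -splitWeight r.1 j

theorem splitWeight_eq (i : Fin 3) (j : Fin 2) :
    (splitWeight i j : ℝ) = splitVector j (i + 1) - splitVector j (i + 2) := by
  fin_cases i <;> fin_cases j <;> simp [splitWeight, splitVector] <;> norm_num

theorem sum_splitVector (j : Fin 2) : ∑ i, splitVector j i = 0 := by
  fin_cases j <;> simp [splitVector, Fin.sum_univ_three]; norm_num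

theorem lie_split_upper (j : Fin 2) (i : Fin 3) (v : Octonion) :
    ⁅diagMap (splitVector j), upper i v⁆ = (splitWeight i j : ℝ) • upper i v := by
  rw [lie_diagMap_upper, splitWeight_eq]

theorem lie_split_lower (j : Fin 2) (i : Fin 3) (v : Octonion) :
    ⁅diagMap (splitVector j), lower i v⁆ = ((-splitWeight i j : ℤ) : ℝ) • lower i v := by
  rw [lie_diagMap_lower, Int.cast_neg, splitWeight_eq, neg_sub]

theorem e6_le_of_rootVectors {S : Submodule ℝ (Module.End ℝ H3)} (h₁ : ∀ k, torus k ∈ S)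
    (h₂ : ∀ a b : Fin 8, a < b → a.rev ≠ b → isoWedgeRe a b ∈ S ∧ isoWedgeIm a b ∈ S)
    (h₃ : ∀ i a, upper i (isoRe a) ∈ S ∧ upper i (isoIm a) ∈ S)
    (h₄ : ∀ i a, lower i (isoRe a) ∈ S ∧ lower i (isoIm a) ∈ S)
    (h₅ : ∀ j, diagMap (splitVector j) ∈ S) : e6.toSubmodule ≤ S := by
  have hu (i : Fin 3) (v : Octonion) : upper i v ∈ S := mem_of_iso _ (h₃ i) v
  have hl (i : Fin 3) (v : Octonion) : lower i v ∈ S := mem_of_iso _ (h₄ i) v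
  refine e6_le (fun i v => S.add_mem (hu i v) (hl i v)) (fun i v => S.sub_mem (hu i v) (hl i v))
    (so8_le_of_isoWedge h₁ h₂) fun m hm => ?_
  have h₆ : m = ((m 0 - m 1) / 2) • splitVector 0 + ((m 0 + m 1) / 2) • splitVector 1 := by
    rw [Fin.sum_univ_three] at hm
    ext i
    fin_cases i <;> simp [splitVector] <;> linarith
  rw [h₆, map_add, map_smul, map_smul]
  exact S.add_mem (S.smul_mem _ (h₅ 0)) (S.smul_mem _ (h₅ 1))

/-- The root vectors of `e6`. -/
def rootVectorsE6 : RootVectors (Fin 4 ⊕ Fin 2) RootE6 e6 where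
  h := Sum.elim torus fun j => diagMap (splitVector j)
  p := Sum.elim (fun r => isoWedgeRe r.1.1 r.1.2)
    (Sum.elim (fun r => upper r.1 (isoRe r.2)) fun r => lower r.1 (isoRe r.2))
  q := Sum.elim (fun r => isoWedgeIm r.1.1 r.1.2)
    (Sum.elim (fun r => upper r.1 (isoIm r.2)) fun r => lower r.1 (isoIm r.2))
  h_mem
    | .inl k => (torus_mem_so8 k).1
    | .inr j => diagMap_mem_e6 (sum_splitVector j)
  p_mem
    | .inl _ => (isoWedgeRe_mem_so8 _ _).1
    | .inr (.inl _) => upper_mem_e6 _ _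
    | .inr (.inr _) => lower_mem_e6 _ _
  q_mem
    | .inl _ => (isoWedgeIm_mem_so8 _ _).1
    | .inr (.inl _) => upper_mem_e6 _ _
    | .inr (.inr _) => lower_mem_e6 _ _
  compact := Sum.isLeft
  wt := weightE6
  lie_h_h
    | .inl k, .inl l => lie_torus_torus k l
    | .inl k, .inr j => by
      rw [← lie_skew]; exact neg_eq_zero.2 (lie_diagMap_so8 _ (torus_mem_so8 k))
    | .inr j, .inl k => lie_diagMap_so8 _ (torus_mem_so8 k)
    | .inr j, .inr j' => lie_diagMap_diagMap _ _
  lie_compact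
    | .inl k, _, .inl r => lie_torus_isoWedge k r.1.1 r.1.2
    | .inl k, _, .inr (.inl r) => lie_torus_of_lie (fun _ hD v => lie_upper hD r.1 v) k r.2
    | .inl k, _, .inr (.inr r) => lie_torus_of_lie (fun _ hD v => lie_lower hD r.1 v) k r.2
    | .inr _, h, _ => nomatch h
  lie_split
    | .inl _, h, _ => nomatch h
    | .inr j, _, .inl r => by
      refine ⟨(lie_diagMap_so8 _ (isoWedgeRe_mem_so8 _ _)).trans ?_,
        (lie_diagMap_so8 _ (isoWedgeIm_mem_so8 _ _)).trans ?_⟩ <;> simp [weightE6]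
    | .inr j, _, .inr (.inl r) => ⟨lie_split_upper j r.1 _, lie_split_upper j r.1 _⟩
    | .inr j, _, .inr (.inr r) => ⟨lie_split_lower j r.1 _, lie_split_lower j r.1 _⟩
  bar
    | .inl r => ⟨.inl r.rev, -1, by norm_num, isoWedge_rev r⟩
    | .inr (.inl r) =>
      ⟨.inr (.inl (r.1, r.2.rev)), 1, by norm_num, by simp [isoRe_rev], by simp [isoIm_rev]⟩
    | .inr (.inr r) =>
      ⟨.inr (.inr (r.1, r.2.rev)), 1, by norm_num, by simp [isoRe_rev], by simp [isoIm_rev]⟩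
  le_span := e6_le_of_rootVectors (fun k => Submodule.subset_span (.inl (.inl ⟨.inl k, rfl⟩)))
    (fun a b h₁ h₂ => ⟨Submodule.subset_span (.inl (.inr ⟨.inl ⟨(a, b), h₁, h₂⟩, rfl⟩)),
      Submodule.subset_span (.inr ⟨.inl ⟨(a, b), h₁, h₂⟩, rfl⟩)⟩)
    (fun i a => ⟨Submodule.subset_span (.inl (.inr ⟨.inr (.inl (i, a)), rfl⟩)),
      Submodule.subset_span (.inr ⟨.inr (.inl (i, a)), rfl⟩)⟩)
    (fun i a => ⟨Submodule.subset_span (.inl (.inr ⟨.inr (.inr (i, a)), rfl⟩)),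
      Submodule.subset_span (.inr ⟨.inr (.inr (i, a)), rfl⟩)⟩)
    fun j => Submodule.subset_span (.inl (.inl ⟨.inr j, rfl⟩))
  wt_ne_zero r h := by
    rcases r with r | ⟨i, a⟩ | ⟨i, a⟩
    · obtain ⟨k, hk⟩ := r.exists_ne_zero
      exact hk (congrFun h (.inl k))
    · obtain ⟨k, hk⟩ := octWeight_ne_zero i a
      exact hk (congrFun h (.inl k))
    · obtain ⟨k, hk⟩ := octWeight_ne_zero i a
      exact hk (congrFun h (.inl k))

/-- The simple roots of `e6`. -/
def simpleE6 : Fin 6 → RootE6 :=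
  ![.inr (.inr (0, 0)), .inl ⟨(0, 6), by decide⟩, .inl ⟨(2, 3), by decide⟩,
    .inl ⟨(1, 5), by decide⟩, .inl ⟨(2, 4), by decide⟩, .inr (.inr (1, 3))]

/-- Multiples of the fundamental coweights of `e6`. -/
def coweightE6 (i : Fin 6) : Fin 4 ⊕ Fin 2 → ℤ :=
  Sum.elim (!![0, 0, 0, 0; 6, 0, 0, 0; 3, 3, 3, 3; 6, 6, 0, 0; 3, 3, 3, -3; 0, 0, 0, 0] i)
    (!![6, -2; 6, 0; 9, -1; 12, 0; 9, 1; 6, 2] i)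

/-- The Killing form on the Cartan subalgebra of `e6`. -/
def gramE6 : Fin 4 ⊕ Fin 2 → ℤ := Sum.elim (fun _ => 96) ![96, 288]

/-- The inverse of the Killing form on the Cartan subalgebra of `e6`, up to a factor. -/
def dualGramE6 : Fin 4 ⊕ Fin 2 → ℤ := Sum.elim (fun _ => 3) ![3, 1]

/-- The diagonal vectors in `splitVector` are chosen orthogonal, so the Gram matrix is diagonal with
entries 96 and 288; the factors 3 and 1 bring them to the common value 288. The coweights are scaled
by 12 to be integral. -/
theorem isRealForm_e6 : IsRealForm CartanMatrix.E₆ e6 := by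
  refine (rootVectorsE6.weightBasis ?_).isOfType (c := gramE6) (g := dualGramE6) (N := 288)
    (s := simpleE6) (M := coweightE6) (d := 12)
    (n := fun r i => (∑ k, coweightE6 i k * weightE6 r k) / 12) ?_ ?_ ?_ ?_ ?_ ?_ ?_ ?_ ?_ ?_
  · rw [finrank_e6]; decide +kernel
  · change ∀ k l, ∑ r, weightE6 r k * weightE6 r l = if k = l then gramE6 k else 0
    decide +kernel
  · decide
  · decide
  · decide
  · decide
  · change ∀ i j, ∑ k, coweightE6 i k * weightE6 (simpleE6 j) k = if i = j then 12 else 0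
    decide +kernel
  · change ∀ r k, weightE6 r k =
      ∑ i, (∑ k, coweightE6 i k * weightE6 r k) / 12 * weightE6 (simpleE6 i) k
    decide +kernel
  · decide +kernel
  · change ∀ j, ∑ k, dualGramE6 k * weightE6 (simpleE6 j) k * weightE6 (simpleE6 j) k ≠ 0
    decide +kernel
  · change ∀ i j, 2 * ∑ k, dualGramE6 k * weightE6 (simpleE6 i) k * weightE6 (simpleE6 j) k =
      CartanMatrix.E₆ i j * ∑ k, dualGramE6 k * weightE6 (simpleE6 j) k * weightE6 (simpleE6 j) k
    decide +kernel

theorem isE6Neg26_e6 : IsE6Neg26 e6 := ⟨isRealForm_e6, signature_e6⟩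

theorem isCompactF4_f4 : IsCompactF4 f4 := ⟨isRealForm_f4, killingForm_f4_neg⟩

/-! ### The stabilizer of the diagonal idempotents in `F4` -/

theorem jordanForm_map {g : H3 ≃ₗ[ℝ] H3} (hg : g ∈ F4) (X Y : H3) :
    jordanForm (g X) (g Y) = jordanForm X Y := by
  rw [jordanForm_apply, ← hg, trace_eq_of_mem_F4 hg]
  rfl

theorem jordanForm_idem (i : Fin 3) (X : H3) : jordanForm (idem i) X = dg i X := by
  rw [jordanForm_apply, trace_jordan]
  simp

theorem jordanForm_off (i : Fin 3) (v : Octonion) (X : H3) :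
    jordanForm (off i v) X = 2 * ip v (od i X) := by
  rw [jordanForm_apply, trace_jordan, Finset.sum_eq_single i]
  · simp
  · intro j _ hj; simp [hj]
  · simp

/-- The automorphisms that fix the three diagonal idempotents. -/
def idemStab : Subgroup (H3 ≃ₗ[ℝ] H3) where
  carrier := {g | g ∈ F4 ∧ ∀ i, g (idem i) = idem i}
  mul_mem' {g h} hg hh := ⟨F4.mul_mem hg.1 hh.1, fun i => by
    rw [LinearEquiv.mul_apply, hh.2, hg.2]⟩
  one_mem' := ⟨F4.one_mem, fun _ => rfl⟩
  inv_mem' {g} hg := ⟨F4.inv_mem hg.1, fun i => by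
    conv_lhs => rw [← hg.2 i]
    rw [← LinearEquiv.mul_apply, inv_mul_cancel]; rfl⟩

/-- The slots are the Peirce spaces of the frame: slot `i` consists of the matrices orthogonal to
all idempotents whose product with `idem i` vanishes. -/
theorem map_off_of_mem_idemStab {g : H3 ≃ₗ[ℝ] H3} (hg : g ∈ idemStab) (i : Fin 3) (v : Octonion) :
    g (off i v) = off i (od i (g (off i v))) := by
  have h₁ (j : Fin 3) : dg j (g (off i v)) = 0 := by
    rw [← jordanForm_idem, ← hg.2 j, jordanForm_map hg.1, jordanForm_idem, dg_off]
  have h₂ : jordan (idem i) (g (off i v)) = 0 := by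
    conv_lhs => rw [← hg.2 i]
    rw [← hg.1]
    have : jordan (idem i) (off i v) = 0 := by
      refine H3_ext (fun j => ?_) fun j => ?_
      · simp [dg_jordan]
      · fin_cases i <;> fin_cases j <;> simp [od_jordan]
    rw [this, map_zero]
  refine H3_ext (fun j => by simp [h₁]) fun j => ?_
  rw [od_off]
  split_ifs with hj
  · rw [hj]
  · have h₃ := congrArg (od j) h₂
    rw [od_jordan] at h₃
    fin_cases i <;> fin_cases j <;> simp_all

theorem dg_map_of_mem_F4 {g : H3 ≃ₗ[ℝ] H3} (hg : g ∈ F4) {i : Fin 3} (hi : g (idem i) = idem i)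
    (X : H3) : dg i (g X) = dg i X := by
  rw [← jordanForm_idem, ← jordanForm_idem]
  conv_lhs => rw [← hi]
  exact jordanForm_map hg _ _

theorem ip_of_map_off {g : H3 ≃ₗ[ℝ] H3} (hg : g ∈ F4) {i : Fin 3} {v w v' w' : Octonion}
    (hv : g (off i v) = off i v') (hw : g (off i w) = off i w') : ip v' w' = ip v w := by
  have h := jordanForm_map hg (off i v) (off i w)
  rw [hv, hw, jordanForm_off, jordanForm_off, od_off, od_off, if_pos rfl, if_pos rfl] at h
  linarith

theorem flow_so8_mem {D : Module.End ℝ H3} (hD : D ∈ so8) (t : Multiplicative ℝ) :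
    flow D t ∈ idemStab := by
  refine ⟨flow_mem_F4 (so8_le_f4 hD) t, fun i => ?_⟩
  exact flow_eq_of_hasDerivAt (f := fun _ => idem i) (D := D) rfl
    (fun s => by
      rw [hD.2 i, hasDerivAt_iff_coordEquiv, map_zero]; exact hasDerivAt_const _ _) t.toAdd

theorem gen_so8_mem (τ : Fin 3) (a : SO8Label) : gen τ (.inl a) ∈ so8 := by
  rw [← so8Span_eq τ]
  exact Submodule.subset_span ⟨a, isGenerator_iff.2 rfl⟩

theorem so8Group_le (τ : Fin 3) : so8Group τ ≤ idemStab := by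
  refine (Subgroup.closure_le _).2 ?_
  rintro g ⟨a, ha⟩
  obtain ⟨θ, rfl⟩ := isTransform_iff.1 ha
  exact flow_so8_mem (gen_so8_mem τ a) _

/-! ### Rotations in coordinate planes -/

/-- The rotation of the plane of two orthonormal octonions. -/
def planeRot (a b : Octonion) (t : ℝ) (x : Octonion) : Octonion :=
  x + ((Real.cos t - 1) * ip a x - Real.sin t * ip b x) • a
    + (Real.sin t * ip a x + (Real.cos t - 1) * ip b x) • b

theorem planeRot_swap (a b : Octonion) (t : ℝ) (x : Octonion) :
    planeRot b a (-t) x = planeRot a b t x := by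
  rw [planeRot, planeRot, Real.cos_neg, Real.sin_neg]
  module

/-- The factor 1/4 cancels the 4 in `block_wedge`, so the parameter is the actual angle in slot `k`.
-/
theorem flow_off (k : Fin 3) {a b : Octonion} (ha : ip a a = 1) (hb : ip b b = 1)
    (hab : ip a b = 0) (t : ℝ) (x : Octonion) :
    flow ((1 / 4 : ℝ) • wedge k a b) (.ofAdd t) (off k x) = off k (planeRot a b t x) := by
  have hD : (1 / 4 : ℝ) • wedge k a b ∈ so8 := so8.smul_mem _ (wedge_mem_so8 ..)
  have h₁ (y : Octonion) : off k y = hmAt k 0 0 0 y 0 0 :=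
    eq_hmAt (by simp) (by simp) (by simp) (by simp) (by simp [fin3_add_one_ne])
      (by simp [fin3_add_two_ne])
  refine flow_eq_of_hasDerivAt (f := fun t => off k (planeRot a b t x)) (by simp [planeRot])
    (fun t => ?_) t
  simp only [map_off_of_mem_so8 hD]
  simp only [h₁]
  refine hasDerivAt_hmAt ?_ ?_ ?_ (fun w => ?_) (fun w => ?_) fun w => ?_
  · simpa using hasDerivAt_const t (0 : ℝ)
  · simpa using hasDerivAt_const t (0 : ℝ)
  · simpa using hasDerivAt_const t (0 : ℝ)
  · have h₂ := ((((Real.hasDerivAt_cos t).sub_const 1).mul_const (ip a x)).sub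
      ((Real.hasDerivAt_sin t).mul_const (ip b x))).mul_const (ip w a)
    have h₃ := (((Real.hasDerivAt_sin t).mul_const (ip a x)).add
      (((Real.hasDerivAt_cos t).sub_const 1).mul_const (ip b x))).mul_const (ip w b)
    have h₄ := (h₂.add h₃).const_add (ip w x)
    convert! h₄ using 1
    · ext s
      simp only [planeRot, map_add, map_smul, smul_eq_mul, Pi.add_apply, Pi.sub_apply]
      ring
    · rw [od_hmAt, map_smul, LinearMap.smul_apply, block_wedge]
      simp only [planeRot, map_add, map_sub, map_smul, smul_eq_mul, ha, hb, hab, ip_comm b a]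
      ring
  · simpa using hasDerivAt_const t (0 : ℝ)
  · simpa using hasDerivAt_const t (0 : ℝ)

theorem exists_planeRot (k : Fin 3) {j l : Fin 8} (hjl : j ≠ l) (t : ℝ) :
    ∃ h ∈ so8Group (k + 1), ∀ x, h (off k x) = off k (planeRot (e j) (e l) t x) := by
  have hk : k + 1 + 2 = k := fin3_add_one_add_two k
  have key (j l : Fin 8) (hlt : l < j) (t : ℝ) :
      ∃ h ∈ so8Group (k + 1), ∀ x, h (off k x) = off k (planeRot (e j) (e l) t x) := by
    have h₁ (a : Fin 8) : ip (e a) (e a) = 1 := by simp [ip_e]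
    have h₂ : ip (e j) (e l) = 0 := by rw [ip_e, if_neg hlt.ne']
    have h₃ : ip (e l) (e j) = 0 := by rw [ip_e, if_neg hlt.ne]
    obtain ⟨p, rfl⟩ := Fin.exists_succ_eq.2 (Fin.ne_zero_of_lt hlt)
    refine Fin.cases (motive := fun l => l < p.succ → ip (e p.succ) (e l) = 0 →
      ip (e l) (e p.succ) = 0 → ∃ h ∈ so8Group (k + 1), ∀ x,
        h (off k x) = off k (planeRot (e p.succ) (e l) t x)) (fun _ h₂ _ => ?_)
      (fun q hq _ h₃ => ?_) l hlt h₂ h₃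
    · refine ⟨_, Subgroup.subset_closure ⟨.xy p, isTransform_iff.2 ⟨t, rfl⟩⟩, fun x => ?_⟩
      rw [← flow_off k (h₁ _) (h₁ _) h₂, e_succ, e_zero, gen, hk]
    · refine ⟨_, Subgroup.subset_closure ⟨.im q p (Fin.succ_lt_succ_iff.1 hq),
        isTransform_iff.2 ⟨-t, rfl⟩⟩, fun x => ?_⟩
      rw [← planeRot_swap, ← flow_off k (h₁ _) (h₁ _) h₃, e_succ, e_succ, gen, hk]
  rcases lt_or_gt_of_ne hjl with h | h
  · obtain ⟨g, hg, hx⟩ := key l j h (-t)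
    exact ⟨g, hg, fun x => by rw [hx, planeRot_swap]⟩
  · exact key j l h t

/-- A Givens rotation: the two coordinates form a complex number, and turning by minus its argument
puts it on the nonnegative real axis. -/
theorem exists_kill (k : Fin 3) {j l : Fin 8} (hjl : j ≠ l) (x : Octonion) :
    ∃ h ∈ so8Group (k + 1), (∀ i, i ≠ j → i ≠ l → h (off k (e i)) = off k (e i)) ∧
      ∃ y, h (off k x) = off k y ∧ ip (e l) y = 0 ∧ 0 ≤ ip (e j) y ∧
        ∀ i, i ≠ j → i ≠ l → ip (e i) y = ip (e i) x := by
  set z : ℂ := ⟨ip (e j) x, ip (e l) x⟩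
  obtain ⟨h, hh, hx⟩ := exists_planeRot k hjl (-z.arg)
  have h₁ : ‖z‖ * Real.cos z.arg = ip (e j) x := Complex.norm_mul_cos_arg z
  have h₂ : ‖z‖ * Real.sin z.arg = ip (e l) x := Complex.norm_mul_sin_arg z
  have h₃ := Real.cos_sq_add_sin_sq z.arg
  refine ⟨h, hh, fun i hj hl => ?_, _, hx x, ?_, ?_, fun i hj hl => ?_⟩
  · rw [hx, planeRot, ip_e, ip_e, if_neg hj.symm, if_neg hl.symm]
    simp
  · simp only [planeRot, map_add, map_smul, ip_e, hjl.symm, if_false, if_true, smul_eq_mul,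
      Real.cos_neg, Real.sin_neg, ← h₁, ← h₂]
    ring
  · simp only [planeRot, map_add, map_smul, ip_e, hjl, if_false, if_true, smul_eq_mul,
      Real.cos_neg, Real.sin_neg, ← h₁, ← h₂]
    have : 0 ≤ ‖z‖ * (Real.cos z.arg ^ 2 + Real.sin z.arg ^ 2) := by rw [h₃]; positivity
    linarith
  · simp only [planeRot, map_add, map_smul, ip_e, hj, hl, if_false, smul_eq_mul]
    ring

theorem exists_align_aux (k : Fin 3) (j : Fin 8) {x : Octonion} (hx : ∀ i > j, ip (e i) x = 0)
    (m : ℕ) (hm : m ≤ j) : ∃ h ∈ so8Group (k + 1), (∀ i > j, h (off k (e i)) = off k (e i)) ∧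
      ∃ y, h (off k x) = off k y ∧ (∀ i > j, ip (e i) y = 0) ∧
        (∀ i : Fin 8, i.1 < m → ip (e i) y = 0) ∧ (0 < m → 0 ≤ ip (e j) y) := by
  induction m with
  | zero => exact ⟨1, one_mem _, fun _ _ => rfl, x, rfl, hx, fun _ h => (Nat.not_lt_zero _ h).elim,
      fun h => (lt_irrefl _ h).elim⟩
  | succ m ih =>
    obtain ⟨h, hh, h₁, y, h₂, h₃, h₄, -⟩ := ih (by omega)
    let l : Fin 8 := ⟨m, by omega⟩
    have hlj : l < j := Fin.lt_def.2 (by simp only [l]; omega)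
    obtain ⟨h', hh', h₁', y', h₂', h₃', h₄', h₅'⟩ := exists_kill k hlj.ne' y
    refine ⟨h' * h, mul_mem hh' hh, fun i hi => ?_, y', ?_, fun i hi => ?_, fun i hi => ?_,
      fun _ => h₄'⟩
    · rw [LinearEquiv.mul_apply, h₁ i hi, h₁' i hi.ne' (hlj.trans hi).ne']
    · rw [LinearEquiv.mul_apply, h₂, h₂']
    · rw [h₅' i hi.ne' (hlj.trans hi).ne', h₃ i hi]
    · rcases (Nat.lt_succ_iff.1 hi).lt_or_eq with h₆ | h₆
      · rw [h₅' i (by rintro rfl; omega) (by rintro rfl; exact h₆.ne rfl), h₄ i h₆]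
      · rwa [show i = l from Fin.ext h₆]

/-- Rotations in coordinate planes turn a vector into a coordinate axis. -/
theorem exists_align (k : Fin 3) {j : Fin 8} (hj : j ≠ 0) {x : Octonion}
    (hx : ∀ i > j, ip (e i) x = 0) :
    ∃ h ∈ so8Group (k + 1), (∀ i > j, h (off k (e i)) = off k (e i)) ∧
      ∃ c : ℝ, 0 ≤ c ∧ h (off k x) = off k (c • e j) := by
  obtain ⟨h, hh, h₁, y, h₂, h₃, h₄, h₅⟩ := exists_align_aux k j hx j le_rfl
  refine ⟨h, hh, h₁, ip (e j) y, h₅ (Fin.pos_of_ne_zero hj), ?_⟩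
  rw [h₂]
  congr 1
  refine ext_e fun i => ?_
  rw [map_smul, ip_e, smul_eq_mul]
  rcases lt_trichotomy i j with h | rfl | h
  · rw [h₄ i h, if_neg h.ne, mul_zero]
  · simp
  · rw [h₃ i h, if_neg h.ne', mul_zero]

/-- Descending induction from the last unit: once the later units are fixed, the image of `e j` is
orthogonal to them and is turned back to `e j` by rotations in lower planes. The induction stops
before `e 0`, where no lower coordinate is left to correct the sign. -/
theorem exists_reduce (k : Fin 3) {g : H3 ≃ₗ[ℝ] H3} (hg : g ∈ idemStab) (n : ℕ) (hn : n ≤ 7) :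
    ∃ h ∈ so8Group (k + 1), ∀ i : Fin 8, 7 - n < i.1 → (h * g) (off k (e i)) = off k (e i) := by
  induction n with
  | zero => exact ⟨1, one_mem _, fun i hi => by omega⟩
  | succ n ih =>
    obtain ⟨h, hh, h₁⟩ := ih (by omega)
    let j : Fin 8 := ⟨7 - n, by omega⟩
    have hs : h * g ∈ idemStab := mul_mem (so8Group_le _ hh) hg
    have hj := map_off_of_mem_idemStab hs k (e j)
    set x := od k ((h * g) (off k (e j)))
    have hx (i : Fin 8) (hi : i > j) : ip (e i) x = 0 := by
      rw [ip_of_map_off hs.1 (h₁ i hi) hj, ip_e, if_neg hi.ne']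
    have hj₀ : j ≠ 0 := fun h => by
      have := congrArg Fin.val h
      simp only [j, Fin.val_zero] at this
      omega
    obtain ⟨h', hh', h₁', c, hc, h₂'⟩ := exists_align k hj₀ hx
    have hc₁ : c = 1 := by
      have h₂ : (h' * (h * g)) (off k (e j)) = off k (c • e j) := by
        rw [LinearEquiv.mul_apply, hj, h₂']
      have h₃ := ip_of_map_off (mul_mem (so8Group_le _ hh') hs).1 h₂ h₂
      simp only [map_smul, LinearMap.smul_apply, ip_e, if_true, smul_eq_mul, mul_one] at h₃
      nlinarith
    refine ⟨h' * h, mul_mem hh' hh, fun i hi => ?_⟩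
    rw [mul_assoc, LinearEquiv.mul_apply]
    rcases eq_or_ne i j with rfl | hij
    · rw [hj, h₂', hc₁, one_smul]
    · have hi' : i > j := by
        rw [gt_iff_lt, Fin.lt_def]
        have := Fin.val_ne_of_ne hij
        simp only [j] at this ⊢
        omega
      rw [h₁ i hi', h₁' i hi']

/-! ### Triality for groups -/

theorem eq_re_of_comm {t : Octonion} (h : ∀ y : Octonion, y * t = t * y) : t = re t • 1 := by
  have c (x y : Octonion) (hxy : x = y) : x.fst.re = y.fst.re ∧ x.fst.imI = y.fst.imI ∧
      x.fst.imJ = y.fst.imJ ∧ x.fst.imK = y.fst.imK ∧ x.snd.re = y.snd.re ∧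
      x.snd.imI = y.snd.imI ∧ x.snd.imJ = y.snd.imJ ∧ x.snd.imK = y.snd.imK := by
    simp [hxy]
  have c₁ := c _ _ (h (e 1))
  have c₂ := c _ _ (h (e 2))
  simp [e] at c₁ c₂
  apply ext_coords <;> simp [re_apply] <;> linarith

theorem eq_one_or_eq_neg_one {t : Octonion} (h : t = re t • 1) (ht : ip t t = 1) :
    t = 1 ∨ t = -1 := by
  rw [h, map_smul, map_smul, LinearMap.smul_apply, ip_one_left, re_one, smul_eq_mul, smul_eq_mul,
    mul_one, mul_self_eq_one_iff] at ht
  rcases ht with ht | ht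
  · left; rw [h, ht, one_smul]
  · right; rw [h, ht, neg_smul, one_smul]

/-- Maps satisfying the principle of triality, one of which is the identity. -/
theorem triality_of_id {B C : Octonion → Octonion} (hB : ip (B 1) (B 1) = 1)
    (h : ∀ y z, B y * C z = y * z) : (B = id ∧ C = id) ∨ ((∀ y, B y = -y) ∧ ∀ z, C z = -z) := by
  set b := B 1
  have hC (z : Octonion) : C z = star b * z := by
    have h₁ := star_mul_cancel b (C z)
    rw [hB, one_smul, h, one_mul] at h₁
    exact h₁.symm
  have hc : ip (C 1) (C 1) = 1 := by rw [hC, mul_one, ip_star_star, hB]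
  have hB' (y : Octonion) : B y = y * b := by
    have h₁ := mul_mul_star_cancel (C 1) (B y)
    rw [hc, one_smul, h, mul_one, hC, mul_one, star_star] at h₁
    exact h₁.symm
  -- With `B` right multiplication by `b` and `C` left multiplication by its conjugate, replacing
  -- `y` by `y * star b` turns the hypothesis into associativity around `star b`.
  have h₁ : star b = re (star b) • 1 := eq_re_of_assoc fun y z => by
    have := h (y * star b) z
    rw [hB', hC, mul_star_mul_cancel, hB, one_smul] at this
    exact this.symm
  rcases eq_one_or_eq_neg_one h₁ (by rw [ip_star_star, hB]) with h₂ | h₂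
  · left
    have h₃ : b = 1 := by rw [← star_star b, h₂, star_one]
    constructor <;> ext1 x
    · rw [hB', h₃, mul_one]; rfl
    · rw [hC, h₂, one_mul]; rfl
  · right
    have h₃ : b = -1 := by rw [← star_star b, h₂, star_neg, star_one]
    exact ⟨fun y => by rw [hB', h₃]; simp, fun z => by rw [hC, h₂]; simp⟩

/-- The negative of the conjugation is not part of a triality triple. -/
theorem not_triality_of_conj {B C : Octonion → Octonion} (hB : ip (B 1) (B 1) = 1)
    (h : ∀ y z, B y * C z = -star (y * z)) : False := by
  set b := B 1
  have hC (z : Octonion) : C z = -(star b * star z) := by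
    have h₁ := star_mul_cancel b (C z)
    rw [hB, one_smul, h, one_mul, mul_neg] at h₁
    exact h₁.symm
  have hc : ip (C 1) (C 1) = 1 := by
    rw [hC, star_one, mul_one, map_neg, map_neg, LinearMap.neg_apply, neg_neg, ip_star_star, hB]
  have hB' (y : Octonion) : B y = star y * b := by
    have h₁ := mul_mul_star_cancel (C 1) (B y)
    rw [hc, one_smul, h, mul_one, hC, star_one, mul_one, star_neg, star_star, neg_mul_neg] at h₁
    exact h₁.symm
  have h₁ (y z : Octonion) : y * b * (star b * z) = z * y := by
    have := h (star y) (star z)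
    rw [hB', hC, mul_neg, neg_inj, star_mul] at this
    simpa using this
  -- Setting the first variable to `star b` shows that it commutes with everything. Then `b` is ±1
  -- and `h₁` would make the octonions commutative.
  have h₂ : star b = re (star b) • 1 := eq_re_of_comm fun y => by
    have := h₁ (star b) y
    have h₃ : star b * b = 1 := by
      have := star_mul_cancel b 1
      rwa [mul_one, hB, one_smul] at this
    rw [h₃, one_mul] at this
    exact this.symm
  have h₃ : b = re b • 1 := by
    have := congrArg star h₂
    rwa [star_star, star_smul', star_one, re_star] at this
  have h₄ (y z : Octonion) : y * z = z * y := by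
    have h₅ : re b * re b = 1 := by
      rw [h₃, map_smul, map_smul, LinearMap.smul_apply, ip_one_left, re_one] at hB
      simpa using hB
    rw [← h₁ y z, h₂, h₃]
    simp [smul_smul, smul_mul_assoc, mul_smul_comm, h₅]
  have h₅ := congrArg (fun x : Octonion => x.fst.imK) (h₄ (e 1) (e 2))
  simp [e] at h₅
  norm_num at h₅

theorem ext_idemStab {g : H3 ≃ₗ[ℝ] H3} (hg : g ∈ idemStab)
    (h : ∀ k v, g (off k v) = off k v) : g = 1 := by
  apply LinearEquiv.toLinearMap_injective
  exact end_ext (fun i => hg.2 i) h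

theorem triality_of_mem_idemStab {g : H3 ≃ₗ[ℝ] H3} (hg : g ∈ idemStab) (k : Fin 3)
    (x y z : Octonion) :
    re (od k (g (off k x)) * (od (k + 1) (g (off (k + 1) y)) * od (k + 2) (g (off (k + 2) z)))) =
      re (x * (y * z)) := by
  have h := mem_E6_iff_cubic.1 (mem_F4_iff.1 hg.1).1 (off k x) (off (k + 1) y) (off (k + 2) z)
  rwa [map_off_of_mem_idemStab hg k, map_off_of_mem_idemStab hg (k + 1),
    map_off_of_mem_idemStab hg (k + 2), cubic_off, cubic_off] at h

theorem eq_of_re_mul {u v : Octonion} (h : ∀ x, re (x * u) = re (x * v)) : u = v := by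
  apply star_injective
  refine ext_ip fun x => ?_
  rw [ip_comm, ip_comm (star v), ← re_mul_eq_ip, ← re_mul_eq_ip, h]

/-- Rotation through 2π, where the unit octonion of `flow_xy` is −1: two-sided multiplication by it
is trivial, one-sided multiplication is not. -/
theorem exists_neg (k : Fin 3) : ∃ h ∈ so8Group (k + 1), ∀ v, h (off k v) = off k v ∧
    h (off (k + 1) v) = off (k + 1) (-v) ∧ h (off (k + 2) v) = off (k + 2) (-v) := by
  refine ⟨flow (gen (k + 1) (.inl (.xy 0))) (.ofAdd (2 * Real.pi)), Subgroup.subset_closure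
    ⟨.xy 0, isTransform_iff.2 ⟨_, rfl⟩⟩, fun v => ?_⟩
  have h₁ (X : H3) := flow_xy k 0 X (2 * Real.pi)
  have h₂ : Real.cos (2 * Real.pi / 2) • (1 : Octonion) - Real.sin (2 * Real.pi / 2) • unit 0 =
      -1 := by
    rw [mul_div_cancel_left₀ _ two_ne_zero, Real.cos_pi, Real.sin_pi]; simp
  simp only [h₂] at h₁
  rw [gen, fin3_add_one_add_two k]
  refine ⟨?_, ?_, ?_⟩ <;> rw [h₁] <;> symm <;> apply eq_hmAt <;>
    simp [fin3_add_one_ne, fin3_add_two_ne, fin3_ne_add_two, fin3_add_two_ne_add_one,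
      fin3_add_one_ne_add_two, (fin3_add_one_ne k).symm]

/-- After reduction the element fixes the imaginary units of slot `k`, so there it is the identity
or minus conjugation. Triality excludes the latter, and in the former case makes the other two slots
both the identity or both its negative; the negative is the rotation through 2π. -/
theorem idemStab_le (τ : Fin 3) : idemStab ≤ so8Group τ := by
  obtain ⟨k, rfl⟩ : ∃ k, τ = k + 1 := ⟨τ + 2, by rw [fin3_add_two_add_one]⟩
  intro g hg
  obtain ⟨h, hh, h₁⟩ := exists_reduce k hg 7 le_rfl
  have hs : h * g ∈ idemStab := mul_mem (so8Group_le _ hh) hg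
  suffices h * g ∈ so8Group (k + 1) by
    have := mul_mem (inv_mem hh) this
    rwa [inv_mul_cancel_left] at this
  clear hg
  set f := h * g
  clear_value f
  have h₂ (p : Fin 7) : f (off k (unit p)) = off k (unit p) := by
    rw [← e_succ]; exact h₁ _ (by simp)
  have ht := triality_of_mem_idemStab hs k
  have hm := map_off_of_mem_idemStab hs
  have hB : ip (od (k + 1) (f (off (k + 1) 1))) (od (k + 1) (f (off (k + 1) 1))) = 1 := by
    rw [ip_of_map_off hs.1 (hm (k + 1) 1) (hm (k + 1) 1), ip_one_left, re_one]
  set a := od k (f (off k 1))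
  have ha : a = ip 1 a • 1 := by
    refine ext_e fun i => ?_
    rw [map_smul, ← e_zero, ip_e, smul_eq_mul]
    refine Fin.cases ?_ (fun p => ?_) i
    · simp
    · rw [e_succ, ip_of_map_off hs.1 (h₂ p) (hm k 1), ip_one_right, re_unit,
        if_neg (Fin.succ_ne_zero p), mul_zero]
  have ha' : a = 1 ∨ a = -1 := by
    refine eq_one_or_eq_neg_one (by rw [← ip_one_left]; exact ha) ?_
    rw [ip_of_map_off hs.1 (hm k 1) (hm k 1), ip_one_left, re_one]
  rcases ha' with ha' | ha'
  · have h₃ (x : Octonion) : f (off k x) = off k x := by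
      rw [← sum_ip_e x]
      simp only [map_sum, map_smul]
      refine Finset.sum_congr rfl fun i _ => ?_
      congr 1
      refine Fin.cases ?_ (fun p => ?_) i
      · rw [e_zero, hm k 1]
        change off k a = _
        rw [ha']
      · rw [e_succ, h₂]
    have h₄ (y z : Octonion) :
        od (k + 1) (f (off (k + 1) y)) * od (k + 2) (f (off (k + 2) z)) = y * z :=
      eq_of_re_mul fun x => by
        have := ht x y z
        rwa [h₃, od_off, if_pos rfl] at this
    rcases triality_of_id (B := fun y => od (k + 1) (f (off (k + 1) y)))
      (C := fun z => od (k + 2) (f (off (k + 2) z))) hB h₄ with ⟨h₅, h₆⟩ | ⟨h₅, h₆⟩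
    · suffices f = 1 by rw [this]; exact one_mem _
      refine ext_idemStab hs (fin3_cases k h₃ (fun v => ?_) fun v => ?_)
      · rw [hm (k + 1) v]; exact congrArg (off (k + 1)) (congrFun h₅ v)
      · rw [hm (k + 2) v]; exact congrArg (off (k + 2)) (congrFun h₆ v)
    · obtain ⟨h', hh', h₇⟩ := exists_neg k
      have h₈ : h' * f = 1 := by
        refine ext_idemStab (mul_mem (so8Group_le _ hh') hs)
          (fin3_cases k (fun v => ?_) (fun v => ?_) fun v => ?_)
        · rw [LinearEquiv.mul_apply, h₃, (h₇ v).1]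
        · rw [LinearEquiv.mul_apply, hm (k + 1) v, h₅, (h₇ _).2.1, neg_neg]
        · rw [LinearEquiv.mul_apply, hm (k + 2) v, h₆, (h₇ _).2.2, neg_neg]
      rw [eq_inv_of_mul_eq_one_right h₈]
      exact inv_mem hh'
  · exfalso
    have h₃ (x : Octonion) : f (off k x) = off k (-star x) := by
      rw [← sum_ip_e x]
      simp only [map_sum, map_smul, star_sum, star_smul', ← Finset.sum_neg_distrib, ← smul_neg]
      refine Finset.sum_congr rfl fun i _ => ?_
      congr 1
      refine Fin.cases ?_ (fun p => ?_) i
      · rw [e_zero, hm k 1, star_one]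
        change off k a = _
        rw [ha']
      · rw [e_succ, h₂, star_unit, neg_neg]
    refine not_triality_of_conj (B := fun y => od (k + 1) (f (off (k + 1) y)))
      (C := fun z => od (k + 2) (f (off (k + 2) z))) hB fun y z => ?_
    exact eq_of_re_mul fun x => by
      have := ht (-star x) y z
      rw [h₃, od_off, if_pos rfl, star_neg, neg_neg, star_star] at this
      rw [this, neg_mul, map_neg, mul_neg, map_neg, ← re_star (x * _), star_mul, star_star,
        re_mul_comm]

theorem so8Group_eq (σ τ : Fin 3) : so8Group σ = so8Group τ :=
  ((so8Group_le σ).trans (idemStab_le τ)).antisymm ((so8Group_le τ).trans (idemStab_le σ))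

/-! ### The rotations generate `F4` -/

theorem freudenthal_map {g : H3 ≃ₗ[ℝ] H3} (hg : g ∈ F4) (A B : H3) :
    freudenthal (g A) (g B) = g (freudenthal A B) := by
  have h := trace_eq_of_mem_F4 hg (jordan A B)
  rw [hg] at h
  simp only [freudenthal, map_add, map_sub, map_smul, map_idH3_of_mem_F4 hg, hg A B,
    trace_eq_of_mem_F4 hg, h]

theorem od_map_of_mem_idemStab {g : H3 ≃ₗ[ℝ] H3} (hg : g ∈ idemStab) (i : Fin 3) (X : H3) :
    od i (g X) = od i (g (off i (od i X))) := by
  conv_lhs => rw [← sum_idem_off X]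
  simp only [map_sum, map_add, map_smul, hg.2, od_idem, smul_zero, zero_add]
  rw [Finset.sum_eq_single i]
  · intro j _ hj
    rw [map_off_of_mem_idemStab hg, od_off, if_neg hj.symm]
  · simp

theorem so8Group_le_rotationGroup (τ : Fin 3) : so8Group τ ≤ rotationGroup :=
  Subgroup.closure_mono fun _ ⟨a, ha⟩ => ⟨τ, .inl a, trivial, ha⟩

theorem gen_mem_f4 (τ : Fin 3) {a : SL2Label} (ha : IsRotation a) : gen τ a ∈ f4 := by
  rw [← LieSubalgebra.mem_toSubmodule, ← rotationSpan_eq]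
  exact Submodule.subset_span ⟨τ, a, ha, isGenerator_iff.2 rfl⟩

theorem rotationGroup_le : rotationGroup ≤ F4 := by
  refine (Subgroup.closure_le _).2 ?_
  rintro g ⟨τ, a, ha, h⟩
  obtain ⟨θ, rfl⟩ := isTransform_iff.1 h
  exact flow_mem_F4 (gen_mem_f4 τ ha) _

/-- A rotation that diagonalizes a `2 × 2` block. -/
theorem exists_rotation_mix (k : Fin 3) (p : Fin 7) (t : ℝ) : ∃ h ∈ rotationGroup, ∀ X,
    h X = mix (-1) k (-unit p) (Real.cos t) (Real.sin t) X := by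
  refine ⟨flow (gen (k + 1) (.inr (.inl (.yz p)))) (.ofAdd (2 * t)), Subgroup.subset_closure
    ⟨k + 1, .inr (.inl (.yz p)), trivial, isTransform_iff.2 ⟨_, rfl⟩⟩, fun X => ?_⟩
  have h₁ : ip (-unit p) (-unit p) = 1 := by simp [ip_unit]
  have h₂ := flow_eq_mix (.inr rfl) k h₁ hasDerivAt_cos_half hasDerivAt_sin_half (by simp)
    (by simp) X (2 * t)
  rw [star_neg, star_unit, neg_neg, mul_div_cancel_left₀ _ two_ne_zero] at h₂
  rw [gen, fin3_add_one_add_two k, h₂]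

theorem mix_idem (k : Fin 3) (v : Octonion) (c s : ℝ) : mix (-1) k v c s (idem k) = idem k := by
  symm
  refine eq_hmAt ?_ ?_ ?_ ?_ ?_ ?_ <;> simp [fin3_add_one_ne, fin3_add_two_ne]

/-- A singular symmetric 2 × 2 matrix has a null direction; for `D ≠ 0` the vector (w, −D) is one,
and `t` is the argument of the complex number with parts −D and w. -/
theorem exists_angle {D E w : ℝ} (h : D * E = w * w) : ∃ t : ℝ,
    Real.sin t ^ 2 * D + 2 * (Real.cos t * Real.sin t) * w + Real.cos t ^ 2 * E = 0 := by
  by_cases hD : D = 0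
  · refine ⟨Real.pi / 2, ?_⟩
    simp [hD]
  · set z : ℂ := ⟨-D, w⟩
    have h₁ : ‖z‖ * Real.cos z.arg = -D := Complex.norm_mul_cos_arg z
    have h₂ : ‖z‖ * Real.sin z.arg = w := Complex.norm_mul_sin_arg z
    have hz : ‖z‖ ^ 2 ≠ 0 := by
      refine pow_ne_zero 2 (norm_ne_zero_iff.2 fun h₀ => hD ?_)
      have := congrArg Complex.re h₀
      simpa [z] using this
    refine ⟨z.arg, mul_left_cancel₀ hz ?_⟩
    rw [mul_zero]
    calc _ = (‖z‖ * Real.sin z.arg) ^ 2 * D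
          + 2 * ((‖z‖ * Real.cos z.arg) * (‖z‖ * Real.sin z.arg)) * w
          + (‖z‖ * Real.cos z.arg) ^ 2 * E := by ring
      _ = D * (D * E - w * w) := by rw [h₁, h₂]; ring
      _ = 0 := by rw [h]; ring

theorem dg_mul_dg {X : H3} (hX : freudenthal X X = 0) (k : Fin 3) :
    dg (k + 1) X * dg (k + 2) X = ip (od k X) (od k X) := by
  have := congrArg (dg k) hX
  rw [dg_freudenthal, map_zero] at this
  linarith

/-- An SO(8) rotation makes the off-diagonal entry a real multiple of ℓ. The block is then governed
by real numbers with vanishing minor, and a rotation in the direction ℓ diagonalizes it. -/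
theorem exists_kill_dg (k : Fin 3) {X : H3} (hX : freudenthal X X = 0) :
    ∃ h ∈ rotationGroup, h (idem k) = idem k ∧ dg (k + 2) (h X) = 0 := by
  obtain ⟨h, hh, -, c, -, h₁⟩ := exists_align k (j := Fin.succ 6) (by decide) (x := od k X)
    fun i hi => absurd hi (not_lt.2 (Fin.le_last i))
  have hs := so8Group_le _ hh
  have h₂ : od k (h X) = c • unit 6 := by
    rw [od_map_of_mem_idemStab hs, h₁, od_off, if_pos rfl, e_succ]
  have h₃ : freudenthal (h X) (h X) = 0 := by rw [freudenthal_map hs.1, hX, map_zero]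
  have h₄ := dg_mul_dg h₃ k
  rw [h₂, map_smul, map_smul, LinearMap.smul_apply, ip_unit, if_pos rfl, smul_eq_mul, smul_eq_mul,
    mul_one] at h₄
  obtain ⟨t, ht⟩ := exists_angle h₄
  obtain ⟨h', hh', h₅⟩ := exists_rotation_mix k 6 t
  refine ⟨h' * h, mul_mem hh' (so8Group_le_rotationGroup _ hh), ?_, ?_⟩
  · rw [LinearEquiv.mul_apply, hs.2, h₅, mix_idem]
  · rw [LinearEquiv.mul_apply, h₅, mix, dg_two_hmAt, h₂, star_neg, star_unit, neg_neg, map_smul,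
      ip_unit, if_pos rfl, smul_eq_mul, mul_one, ht]

/-- For a rank-one matrix the squared norm of each off-diagonal entry is a product of two diagonal
entries, so one nonzero diagonal entry leaves nothing else. -/
theorem eq_idem {X : H3} (hX : freudenthal X X = 0) (ht : trace X = 1) {i : Fin 3}
    (h₁ : dg (i + 1) X = 0) (h₂ : dg (i + 2) X = 0) : X = idem i := by
  have h₃ : dg i X = 1 := by
    rw [trace_eq] at ht
    fin_cases i <;> simp_all [Fin.sum_univ_three]
  have h₄ (j : Fin 3) : od j X = 0 := by
    refine ip_self_eq_zero.1 ?_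
    rw [← dg_mul_dg hX]
    revert j
    refine fin3_cases i ?_ ?_ ?_
    · rw [h₁, zero_mul]
    · rw [fin3_add_one_add_one, h₂, zero_mul]
    · rw [fin3_add_two_add_two, h₁, mul_zero]
  refine H3_ext (fin3_cases i ?_ ?_ ?_) fun j => by rw [h₄, od_idem]
  · rw [h₃, dg_idem, if_pos rfl]
  · rw [h₁, dg_idem, if_neg (fin3_add_one_ne i)]
  · rw [h₂, dg_idem, if_neg (fin3_add_two_ne i)]

theorem freudenthal_idem (i : Fin 3) : freudenthal (idem i) (idem i) = 0 := by
  refine H3_ext (fun j => ?_) fun j => ?_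
  · rw [dg_freudenthal]
    fin_cases i <;> fin_cases j <;> simp
  · rw [od_freudenthal]
    simp

theorem trace_idem (i : Fin 3) : trace (idem i) = 1 := by
  rw [trace_eq]; simp

theorem rotationGroup_eq : rotationGroup = F4 := by
  refine le_antisymm rotationGroup_le fun g hg => ?_
  have hF {h : H3 ≃ₗ[ℝ] H3} (hh : h ∈ F4) (i : Fin 3) :
      freudenthal (h (idem i)) (h (idem i)) = 0 := by
    rw [freudenthal_map hh, freudenthal_idem, map_zero]
  have hT {h : H3 ≃ₗ[ℝ] H3} (hh : h ∈ F4) (i : Fin 3) : trace (h (idem i)) = 1 := by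
    rw [trace_eq_of_mem_F4 hh, trace_idem]
  have step {f : H3 ≃ₗ[ℝ] H3} (hf : f ∈ F4) (k i : Fin 3) : ∃ h ∈ rotationGroup,
      h (idem k) = idem k ∧ dg k (h (f (idem i))) = dg k (f (idem i)) ∧
        dg (k + 2) (h (f (idem i))) = 0 := by
    obtain ⟨h, hh, h₁, h₂⟩ := exists_kill_dg k (hF hf i)
    exact ⟨h, hh, h₁, dg_map_of_mem_F4 (rotationGroup_le hh) h₁ _, h₂⟩
  -- For the image of `idem 0`, the block opposite index 0 clears entry 2, and the block opposite
  -- index 2 then clears entry 1 while keeping entry 2. For `idem 1` one block suffices, since entry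
  -- 0 already vanishes, and `idem 2` follows from the identity matrix.
  obtain ⟨a, ha, -, -, a₁⟩ := step hg 0 0
  have hag := mul_mem (rotationGroup_le ha) hg
  obtain ⟨b, hb, -, b₁, b₂⟩ := step hag 2 0
  have hbag := mul_mem (rotationGroup_le hb) hag
  have e₀ : (b * (a * g)) (idem 0) = idem 0 :=
    eq_idem (hF hbag 0) (hT hbag 0) b₂ (b₁.trans a₁)
  obtain ⟨c, hc, c₀, c₁, c₂⟩ := step hbag 0 1
  have hcbag := mul_mem (rotationGroup_le hc) hbag
  have e₁ : (c * (b * (a * g))) (idem 1) = idem 1 := by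
    refine eq_idem (hF hcbag 1) (hT hcbag 1) c₂ (c₁.trans ?_)
    refine (dg_map_of_mem_F4 hbag e₀ _).trans ?_
    simp
  have e₀' : (c * (b * (a * g))) (idem 0) = idem 0 := by
    rw [LinearEquiv.mul_apply, e₀, c₀]
  have e₂ : (c * (b * (a * g))) (idem 2) = idem 2 := by
    have h : idem 2 = idH3 - idem 0 - idem 1 := by
      refine H3_ext (fun j => ?_) fun j => ?_
      · fin_cases j <;> simp [dg_idH3]
      · simp [od_idH3]
    rw [h, map_sub, map_sub, map_idH3_of_mem_F4 hcbag, e₀', e₁]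
  have hs : c * (b * (a * g)) ∈ idemStab := ⟨hcbag, fin3_cases 0 e₀' e₁ e₂⟩
  have h₁ := so8Group_le_rotationGroup 0 (idemStab_le 0 hs)
  have h₂ := mul_mem (inv_mem (mul_mem hc (mul_mem hb ha))) h₁
  convert! h₂ using 1
  group

/-! ### Compactness of `F4` -/

theorem continuous_bilin {T V : Type*} [TopologicalSpace T] [AddCommGroup V] [Module ℝ V]
    [TopologicalSpace V] [IsTopologicalAddGroup V] [ContinuousSMul ℝ V]
    (B : H3 →ₗ[ℝ] H3 →ₗ[ℝ] V) {f g : T → H3} (hf : Continuous f) (hg : Continuous g) :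
    Continuous fun x => B (f x) (g x) := by
  let b := Module.Basis.ofEquivFun coordEquiv
  have h (x : T) : B (f x) (g x) =
      ∑ i, ∑ j, (b.coord i (f x) * b.coord j (g x)) • B (b i) (b j) := by
    conv_lhs => rw [← b.sum_repr (f x), ← b.sum_repr (g x)]
    simp only [map_sum, map_smul, LinearMap.sum_apply, LinearMap.smul_apply, Finset.smul_sum,
      smul_smul, Module.Basis.coord_apply]
    rw [Finset.sum_comm]
    exact Finset.sum_congr rfl fun i _ => Finset.sum_congr rfl fun j _ => by rw [mul_comm]
  simp only [h]
  have hc (i) : Continuous (b.coord i) := LinearMap.continuous_of_finiteDimensional _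
  exact continuous_finsetSum _ fun i _ => continuous_finsetSum _ fun j _ =>
    (((hc i).comp hf).mul ((hc j).comp hg)).smul continuous_const

theorem coordEquiv_sq_le (X : H3) (i) : coordEquiv X i ^ 2 ≤ jordanForm X X := by
  have h₁ (j : Fin 3) : 0 ≤ dg j X * dg j X + 2 * ip (od j X) (od j X) :=
    add_nonneg (mul_self_nonneg _) (mul_nonneg zero_le_two (ip_self_nonneg _))
  rw [jordanForm_apply, trace_jordan]
  rcases i with j | ⟨j, a⟩
  · refine le_trans ?_ (Finset.single_le_sum (fun j _ => h₁ j) (Finset.mem_univ j))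
    have h₂ := ip_self_nonneg (od j X)
    change dg j X ^ 2 ≤ _
    nlinarith
  · refine le_trans ?_ (Finset.single_le_sum (fun j _ => h₁ j) (Finset.mem_univ j))
    have h₂ : ip (e a) (od j X) ^ 2 ≤ ip (od j X) (od j X) := by
      have h₃ : ip (od j X) (od j X) = ∑ a, ip (e a) (od j X) ^ 2 := by
        conv_lhs => enter [2]; rw [← sum_ip_e (od j X)]
        simp only [map_sum, map_smul, smul_eq_mul, ip_comm (od j X) (e _), sq]
      rw [h₃]
      exact Finset.single_le_sum (f := fun a => ip (e a) (od j X) ^ 2) (fun a _ => sq_nonneg _)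
        (Finset.mem_univ a)
    change ip (e a) (od j X) ^ 2 ≤ _
    nlinarith [mul_self_nonneg (dg j X), ip_self_nonneg (od j X)]

/-- The sphere is closed and lies in a coordinate box; the bound `c + 1` replaces the square root of
`c`. -/
theorem isCompact_sphere (c : ℝ) : IsCompact {X : H3 | jordanForm X X = c} := by
  have h₁ : Continuous coordEquiv.symm :=
    LinearMap.continuous_of_finiteDimensional coordEquiv.symm.toLinearMap
  refine ((isCompact_univ_pi fun _ => isCompact_Icc (a := -(c + 1)) (b := c + 1)).image
    h₁).of_isClosed_subset
    (isClosed_eq (continuous_bilin jordanForm continuous_id continuous_id) continuous_const)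
    fun X hX => ⟨coordEquiv X, fun i _ => ?_, by simp⟩
  have h₂ := coordEquiv_sq_le X i
  have h₃ : jordanForm X X = c := hX
  rw [h₃] at h₂
  exact abs_le.1 (abs_le_of_sq_le_sq (by nlinarith [sq_nonneg (coordEquiv X i)])
    (by nlinarith [sq_nonneg (coordEquiv X i)]))

theorem isCompact_F4 :
    IsCompact ((fun g : H3 ≃ₗ[ℝ] H3 => LinearMap.toContinuousLinearMap (g : H3 →ₗ[ℝ] H3)) ''
      (F4 : Set (H3 ≃ₗ[ℝ] H3))) := by
  let b := Module.Basis.ofEquivFun coordEquiv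
  let φ := b.constr (M' := H3) ℝ
  have hφ (X : H3) : Continuous fun w => φ w X :=
    LinearMap.continuous_of_finiteDimensional (LinearMap.applyₗ X ∘ₗ φ.toLinearMap)
  -- Endomorphisms are encoded by the images of a basis. Preservation of the trace form is redundant
  -- for automorphisms, but it bounds those images and forces injectivity, so closed conditions
  -- alone describe the group.
  let K : Set ((Fin 3 ⊕ Fin 3 × Fin 8) → H3) := {w | ∀ X Y, φ w (jordan X Y) =
    jordan (φ w X) (φ w Y) ∧ jordanForm (φ w X) (φ w Y) = jordanForm X Y}
  have hK : IsCompact K := by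
    refine (isCompact_univ_pi fun i => isCompact_sphere (jordanForm (b i) (b i))).of_isClosed_subset
      ?_ fun w hw i _ => ?_
    · simp only [K, Set.ofPred_forall]
      exact isClosed_iInter fun X => isClosed_iInter fun Y =>
        (isClosed_eq (hφ _) (continuous_bilin jordan (hφ X) (hφ Y))).inter
          (isClosed_eq (continuous_bilin jordanForm (hφ X) (hφ Y)) continuous_const)
    · have := (hw (b i) (b i)).2
      simpa [φ] using this
  have hc : Continuous fun w => LinearMap.toContinuousLinearMap (φ w) :=
    LinearMap.continuous_of_finiteDimensional
      (LinearMap.toContinuousLinearMap.toLinearMap ∘ₗ φ.toLinearMap)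
  convert! hK.image hc using 1
  ext f
  constructor
  · rintro ⟨g, hg, rfl⟩
    have h₁ : φ (fun i => g (b i)) = g.toLinearMap := b.ext fun i => by simp [φ]
    refine ⟨fun i => g (b i), fun X Y => ?_, by simp only [h₁]⟩
    rw [h₁]
    exact ⟨hg X Y, jordanForm_map hg X Y⟩
  · rintro ⟨w, hw, rfl⟩
    have h₁ : Function.Injective (φ w) := (injective_iff_map_eq_zero _).2 fun X hX =>
      isInner_jordanForm.eq_zero X (by rw [← (hw X X).2, hX, map_zero])
    refine ⟨LinearEquiv.ofInjectiveEndo (φ w) h₁, fun X Y => ?_, ?_⟩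
    · exact (hw X Y).1
    · simp only
      congr 1

end OctonionicE6

end

open OctonionicE6 in
theorem mainTheorem3 :
    -- The type I, II and III transformations are one-parameter subgroups of `E₆`.
    (∀ (τ : Fin 3) (a : SL2Label), ∃ φ : Multiplicative ℝ →* (H3 ≃ₗ[ℝ] H3),
      (∀ s, φ s ∈ E6) ∧
      ∀ (θ : ℝ) (X : H3), (φ (Multiplicative.ofAdd θ) X : Mat3) = transform τ a θ X) ∧
    Nat.card SL2Label = 45 ∧
    -- Triality: the three copies of `SO(8)` coincide, and so do their Lie algebras.
    (∀ σ τ : Fin 3, so8Group σ = so8Group τ ∧ so8Span σ = so8Span τ) ∧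
    -- There are 79 transformations; the three `tz`-boosts are not independent.
    Nat.card Label = 79 ∧
    (∀ (β : ℝ) (X : H3),
      transform 0 (.inr (.inr .tz)) β
        (transform 1 (.inr (.inr .tz)) β (transform 2 (.inr (.inr .tz)) β X)) = X) ∧
    -- Removing any one of the `tz`-boosts leaves 78 transformations, 26 boosts and 52 rotations,
    -- whose generators form a basis of the Lie algebra.
    (∀ σ ρ : Fin 3,
      Nat.card {x : Label // x ≠ tzLabel ρ} = 78 ∧
      Nat.card {x : Label // x ≠ tzLabel ρ ∧ ¬ IsRotation x.toSL2} = 26 ∧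
      Nat.card {x : Label // x ≠ tzLabel ρ ∧ IsRotation x.toSL2} = 52 ∧
      ∃ B : Module.Basis {x : Label // x ≠ tzLabel ρ} ℝ e6,
        ∀ x, IsGenerator (x.1.type σ) x.1.toSL2 (B x : Module.End ℝ H3)) ∧
    -- The Lie algebra is the Lie algebra of `E₆`, and it is the real form `E₆₍₋₂₆₎`.
    (∀ D : Module.End ℝ H3, D ∈ e6 ↔ IsTangent E6 D) ∧
    IsE6Neg26 e6 ∧
    -- The boosts and the rotations are the positive and the negative directions.
    Module.finrank ℝ boostSpan = 26 ∧
    Module.finrank ℝ rotationSpan = 52 ∧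
    (∀ D : e6, D ≠ 0 → (D : Module.End ℝ H3) ∈ boostSpan → 0 < killingForm ℝ e6 D D) ∧
    (∀ D : e6, D ≠ 0 → (D : Module.End ℝ H3) ∈ rotationSpan → killingForm ℝ e6 D D < 0) ∧
    -- The rotations make up `F₄`, the trace-preserving subgroup of `E₆`, which is compact.
    (∀ g : H3 ≃ₗ[ℝ] H3, g ∈ F4 ↔ g ∈ E6 ∧ ∀ X, trace (g X) = trace X) ∧
    rotationGroup = F4 ∧
    IsCompact ((fun g : H3 ≃ₗ[ℝ] H3 => LinearMap.toContinuousLinearMap (g : H3 →ₗ[ℝ] H3)) ''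
      (F4 : Set (H3 ≃ₗ[ℝ] H3))) ∧
    (∀ D : Module.End ℝ H3, D ∈ f4 ↔ IsTangent F4 D) ∧
    (∀ D : Module.End ℝ H3, D ∈ f4 ↔ D ∈ e6 ∧ ∀ X, trace (D X) = 0) ∧
    rotationSpan = f4.toSubmodule ∧
    IsCompactF4 f4 := by 
  refine ⟨fun τ a => ⟨flow (gen τ a), flow_mem_E6 (gen_mem_e6 τ a),
      fun θ X => (transform_eq_flow τ a θ X).symm⟩, card_SL2Label,
    fun σ τ => ⟨so8Group_eq σ τ, (so8Span_eq σ).trans (so8Span_eq τ).symm⟩, card_Label,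
    tz_relation, fun σ ρ => ⟨card_Label_ne ρ, card_boost_Label ρ, card_rotation_Label ρ,
      exists_basis σ ρ⟩, mem_e6_iff_isTangent, isE6Neg26_e6, finrank_boostSpan,
    finrank_rotationSpan, killingForm_pos_of_mem_boostSpan, killingForm_neg_of_mem_rotationSpan,
    fun g => mem_F4_iff, rotationGroup_eq, isCompact_F4, mem_f4_iff_isTangent,
    fun D => mem_f4_iff, rotationSpan_eq, isCompactF4_f4⟩
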